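/- Let $d\ge 1$, $\mathbb{T}^d=\mathbb{R}^d/(2\pi\mathbb{Z})^d$, and, for real $\psi\in L^2(\mathbb{T}^d)$, put $\widehat\psi(\xi)=(2\pi)^{-d}\int_{\mathbb{T}^d}e^{-ix\cdot\xi}\psi(x)\,dx$ and $\|\psi\|_{H^{1/2}}^2=\sum_{\xi\in\mathbb{Z}^d}(1+|\xi|^2)^{1/2}|\widehat\psi(\xi)|^2$; $H^{1/2}(\mathbb{T}^d)$ is the space of those $\psi$ for which this is finite. For $h>0$ and a Lipschitz function $\eta:\mathbb{T}^d\to\mathbb{R}$ with $\inf\eta>-h$ let $\Omega=\{(x,y): x\in\mathbb{T}^d,\ -h<y<\eta(x)\}$. The variational solution $\phi_h$ of $$\Delta_{x,y}\phi_h=0\ \text{ in }\Omega,\qquad \phi_h|_{y=\eta(x)}=\psi,\qquad \partial_y\phi_h|_{y=-h}=0$$ is the function $\phi_h\in H^1(\Omega)$ with trace $\psi$ on $\{y=\eta(x)\}$ such that $\iint_\Omega\nabla_{x,y}\phi_h\cdot\nabla_{x,y}v\,dy\,dx=0$ for all $v\in H^1(\Omega)$ with zero trace on $\{y=\eta(x)\}$.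 (i) There is a constant $C>0$ depending only on $d$ such that, for all $h\in[2,+\infty)$, all $\psi\in H^{1/2}(\mathbb{T}^d)$ and all Lipschitz $\eta:\mathbb{T}^d\to\mathbb{R}$ with $\int_{\mathbb{T}^d}\eta\,dx=0$ and $\inf_{\mathbb{T}^d}\eta>-h/3$, the trace $\nabla_x\phi_h(\cdot,-h)$ of $\nabla_x\phi_h$ on the bottom $\{y=-h\}$ exists in $L^2(\mathbb{T}^d)$ and $$\int_{\mathbb{T}^d}|\nabla_x\phi_h(x,-h)|^2\,dx\le C\big(1+\|\nabla_x\eta\|_{L^\infty}^3\big)e^{-\frac14 h}\|\psi\|_{H^{1/2}(\mathbb{T}^d)}^2 .$$ (ii) Consequently, for every fixed $\psi\in H^{1/2}(\mathbb{T}^d)$ and every fixed Lipschitz $\eta$ on $\mathbb{T}^d$ with $\int_{\mathbb{T}^d}\eta\,dx=0$, the bottom term of the virial identity tends to zero: $\frac h4\int_{\mathbb{T}^d}|\nabla_x\phi_h(x,-h)|^2\,dx\to 0$ as $h\to+\infty$. -/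

import Mathlib

open MeasureTheory Filter Topology

noncomputable section

namespace BottomTrace

/-- The horizontal space `ℝ^d` with its Euclidean norm. Functions on the torus
`𝕋^d = ℝ^d / (2π ℤ)^d` are represented by `2π`-periodic functions on it. -/
abbrev Horiz (d : ℕ) : Type := EuclideanSpace ℝ (Fin d)

/-- `2π`-periodicity in each coordinate: `f` is (the lift of) a function on `𝕋^d`. -/
def TorusPeriodic {d : ℕ} {F : Type*} (f : Horiz d → F) : Prop :=
  ∀ (i : Fin d) (x : Horiz d), f (x + EuclideanSpace.single i (2 * Real.pi)) = f x

/-- `u` is (the lift of) a function on `𝕋^d × ℝ`: it is `2π`-periodic in the horizontal variables. -/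
def HorizPeriodic {d : ℕ} {F : Type*} (u : Horiz d × ℝ → F) : Prop :=
  ∀ y : ℝ, TorusPeriodic (fun x => u (x, y))

/-- The fundamental cell `[0, 2π)^d` of the torus; `∫_{𝕋^d} f` is `∫ x in cell d, f x`. -/
def cell (d : ℕ) : Set (Horiz d) := {x | ∀ i, x i ∈ Set.Ico 0 (2 * Real.pi)}

/-- The fluid domain `{-h < y < η(x)}`, lifted to `ℝ^d × ℝ`. -/
def fluid {d : ℕ} (h : ℝ) (η : Horiz d → ℝ) : Set (Horiz d × ℝ) :=
  {p | -h < p.2 ∧ p.2 < η p.1}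

/-- The part of the lifted fluid domain above the fundamental cell; integrals over the fluid domain
in `𝕋^d × ℝ` are integrals over this set. -/
def fluidCell {d : ℕ} (h : ℝ) (η : Horiz d → ℝ) : Set (Horiz d × ℝ) :=
  {p | p.1 ∈ cell d ∧ p ∈ fluid h η}

/-- The Fourier coefficient `(2π)^{-d} ∫_{𝕋^d} e^{-i x·ξ} f(x) dx`. -/
def fourierCoeffTorus {d : ℕ} (f : Horiz d → ℝ) (ξ : Fin d → ℤ) : ℂ :=
  ((2 * Real.pi : ℂ) ^ d)⁻¹ *
    ∫ x in cell d, Complex.exp (-Complex.I * ∑ i, (x i : ℂ) * (ξ i : ℂ)) * (f x : ℂ)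

/-- The term `(1 + |ξ|²)^s |f̂(ξ)|²`. -/
def sobolevTerm {d : ℕ} (s : ℝ) (f : Horiz d → ℝ) (ξ : Fin d → ℤ) : ℝ :=
  (1 + ∑ i, (ξ i : ℝ) ^ 2) ^ s * ‖fourierCoeffTorus f ξ‖ ^ 2

/-- `f ∈ H^s(𝕋^d)`, for `s ≥ 0`. -/
structure MemSobolev {d : ℕ} (s : ℝ) (f : Horiz d → ℝ) : Prop where
  periodic : TorusPeriodic f
  memLp : MemLp f 2 (volume.restrict (cell d))
  summable : Summable (sobolevTerm s f)

/-- `‖f‖²_{H^s(𝕋^d)} = ∑_ξ (1 + |ξ|²)^s |f̂(ξ)|²`. -/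
def sobolevNormSq {d : ℕ} (s : ℝ) (f : Horiz d → ℝ) : ℝ :=
  ∑' ξ : Fin d → ℤ, sobolevTerm s f ξ

/-- `‖∇_x η‖_{L^∞}`, for a Lipschitz function `η` (whose gradient exists almost everywhere). -/
def gradSupNorm {d : ℕ} (η : Horiz d → ℝ) : ℝ :=
  (eLpNorm (fun x => gradient η x) ⊤ volume).toReal

/-- `η` is a Lipschitz function on the torus with mean value zero. -/
structure IsProfile {d : ℕ} (η : Horiz d → ℝ) : Prop where
  periodic : TorusPeriodic η
  lipschitz : ∃ K : NNReal, LipschitzWith K η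
  mean_zero : ∫ x in cell d, η x = 0

/-- `u ∈ H¹(Ω)` with weak gradient `∇_x u = ux`, `∂_y u = uy`, where `Ω ⊆ 𝕋^d × ℝ` is the fluid
domain. The test functions `w` are the smooth functions with compact support in `Ω` (for the lift:
periodic, with closed support inside the lifted domain, which is bounded in `y`). The identity is
stated for the derivative in an arbitrary direction `(a, b)`. -/
structure IsH1 {d : ℕ} (h : ℝ) (η : Horiz d → ℝ)
    (u : Horiz d × ℝ → ℝ) (ux : Horiz d × ℝ → Horiz d) (uy : Horiz d × ℝ → ℝ) : Prop where
  periodic : HorizPeriodic u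
  periodic_x : HorizPeriodic ux
  periodic_y : HorizPeriodic uy
  memLp : MemLp u 2 (volume.restrict (fluidCell h η))
  memLp_x : MemLp ux 2 (volume.restrict (fluidCell h η))
  memLp_y : MemLp uy 2 (volume.restrict (fluidCell h η))
  weak : ∀ w : Horiz d × ℝ → ℝ, HorizPeriodic w → ContDiff ℝ ((⊤ : ℕ∞) : WithTop ℕ∞) w →
    tsupport w ⊆ fluid h η → ∀ (a : Horiz d) (b : ℝ),
      ∫ p in fluidCell h η, u p * fderiv ℝ w p (a, b) =
        -∫ p in fluidCell h η, (inner ℝ (ux p) a + uy p * b) * w p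

/-- The `L²` trace of `u` on the graph `{y = γ(x)}`, approached from below (`σ = -1`) or from above
(`σ = 1`): `ε⁻¹ ∫_0^ε ∫_{𝕋^d} |u(x, γ(x) + σ s) - g(x)|² dx ds → 0` as `ε → 0⁺`. It does not depend
on the choice of `u` in its class modulo null sets, it determines `g` almost everywhere, and for
`u ∈ H¹` it gives the usual trace. -/
def HasGraphTrace {d : ℕ} {F : Type*} [NormedAddCommGroup F] (γ : Horiz d → ℝ) (σ : ℝ)
    (u : Horiz d × ℝ → F) (g : Horiz d → F) : Prop :=
  Tendsto (fun ε : ℝ => ENNReal.ofReal ε⁻¹ *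
      ∫⁻ p in (cell d) ×ˢ (Set.Ioo (0 : ℝ) ε), ‖u (p.1, γ p.1 + σ * p.2) - g p.1‖ₑ ^ 2)
    (𝓝[>] 0) (𝓝 0)

/-- `u|_{y = η} = g`. -/
def HasSurfaceTrace {d : ℕ} (η : Horiz d → ℝ) (u : Horiz d × ℝ → ℝ) (g : Horiz d → ℝ) : Prop :=
  HasGraphTrace η (-1) u g

/-- `G ∈ L²(𝕋^d)` is the trace of the vector field `V` on the bottom `{y = -h}`; for `V = ∇_x u`
this is `G(x) = ∇_x u(x, -h)`. -/
structure HasBottomTrace {d : ℕ} (h : ℝ) (V : Horiz d × ℝ → Horiz d) (G : Horiz d → Horiz d) :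
    Prop where
  periodic : TorusPeriodic G
  memLp : MemLp G 2 (volume.restrict (cell d))
  trace : HasGraphTrace (fun _ => -h) 1 V G

/-- `φ`, with weak gradient `(φx, φy)`, is the variational solution of `Δ φ = 0` in the fluid
domain, `φ|_{y = η} = ψ`, `∂_y φ|_{y = -h} = 0`: it is in `H¹`, its trace on the free surface is `ψ`,
and `∫_Ω ∇φ · ∇v = 0` for all `v ∈ H¹` whose trace on the free surface vanishes. -/
structure IsVariationalSolution {d : ℕ} (h : ℝ) (η ψ : Horiz d → ℝ)
    (φ : Horiz d × ℝ → ℝ) (φx : Horiz d × ℝ → Horiz d) (φy : Horiz d × ℝ → ℝ) : Prop where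
  isH1 : IsH1 h η φ φx φy
  trace : HasSurfaceTrace η φ ψ
  variational : ∀ (v : Horiz d × ℝ → ℝ) (vx : Horiz d × ℝ → Horiz d) (vy : Horiz d × ℝ → ℝ),
    IsH1 h η v vx vy → HasSurfaceTrace η v (fun _ => 0) →
      ∫ p in fluidCell h η, (inner ℝ (φx p) (vx p) + φy p * vy p) = 0

end BottomTrace

end

open MeasureTheory Filter Topology

noncomputable section

namespace BottomTrace

/-! ### Fourier series on the cell, transported from the unit torus. -/

section

-- The flat strip -h < y < -h/3 lies inside the fluid, and there separation of variables applies. By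
-- the Neumann condition at the bottom, the mode of frequency ξ ≠ 0 is A_ξ cosh(|ξ|(y + h)).
-- Descending to the bottom from a height t above it divides this mode by cosh(|ξ|t) ≥ e^t/2,
-- because |ξ| ≥ 1; the zero mode contributes nothing to ∇_x. So the bottom gradient is
-- exponentially smaller than the horizontal gradient on any slice in the upper half of the strip,
-- and by averaging some such slice is controlled by the Dirichlet energy. This is
-- `IsVariationalSolution.exists_bottomTrace`; the strip has height 2h/3, so the gain is e^{-2h/3},
-- better than e^{-h/4}.
--
-- The energy is bounded independently of h by the Dirichlet principle,
-- `IsVariationalSolution.integral_energy_le`. The competitor is the real part of the sum of c_ξ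
-- e^{ix·ξ} e^{-|ξ|(η(x) - y)}, where c_ξ are the Fourier coefficients of ψ: a harmonic extension to
-- the half-space s > 0, evaluated at s = η(x) - y. On the half-space its energy is at most (2π)^d ∑
-- |ξ||c_ξ|², and the change of variables costs a factor 2(1 + L²), where L is the supremum of |∇η|.
-- Since 1 + L² ≤ 2(1 + L³), the cubic bound follows.
--
-- Elliptic regularity is not needed. Testing the weak formulation with χ(y) times the real and
-- imaginary parts of e^{-ix·ξ} gives for each ξ a weak first-order system in y, solved almost
-- everywhere by `ae_eq_cosh`; as χ need not vanish at y = -h, the sinh solution is excluded. The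
-- bottom trace exists because cosh is convex: at distance s from the bottom the squared L² distance
-- to the limit is O(s). Traces are unique (`HasGraphTrace.ae_eq`), so the estimate holds for every
-- G. Part (ii) follows because h e^{-h/4} tends to 0.

local instance : MeasureSpace UnitAddCircle := ⟨AddCircle.haarAddCircle⟩

/-- The pairing `x · ξ` of a point with a frequency. -/
def pairing {d : ℕ} (ξ : Fin d → ℤ) (x : Horiz d) : ℝ := ∑ i, x i * ξ i

/-- The complex exponential `e^{i x·ξ}`. -/
def expo {d : ℕ} (ξ : Fin d → ℤ) (x : Horiz d) : ℂ := Complex.exp (Complex.I * (pairing ξ x : ℂ))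

/-- The Fourier coefficient of a complex function on the cell. -/
def fc {d : ℕ} (f : Horiz d → ℂ) (ξ : Fin d → ℤ) : ℂ :=
  ((2 * Real.pi : ℂ) ^ d)⁻¹ * ∫ x in cell d, expo (-ξ) x * f x

theorem fourierCoeffTorus_eq {d : ℕ} (f : Horiz d → ℝ) :
    fourierCoeffTorus f = fc (fun x => (f x : ℂ)) := by
  funext ξ
  unfold fourierCoeffTorus fc expo pairing
  congr 2
  funext x
  congr 2
  push_cast
  simp [Finset.sum_neg_distrib]

theorem measurableSet_cell (d : ℕ) : MeasurableSet (cell d) := by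
  have : cell d = ⋂ i, (fun x : Horiz d => x i) ⁻¹' Set.Ico 0 (2 * Real.pi) := by
    ext x; simp [cell]
  rw [this]
  exact MeasurableSet.iInter fun i => (by fun_prop : Measurable fun x : Horiz d => x i) measurableSet_Ico

/-- The parametrisation of the cell by the unit torus. -/
def cellParam (d : ℕ) (t : UnitAddTorus (Fin d)) : Horiz d :=
  WithLp.toLp 2 fun i => 2 * Real.pi * (UnitAddTorus.measurableEquivPiIoc (fun _ => (0 : ℝ)) t).1 i

theorem measurable_cellParam (d : ℕ) : Measurable (cellParam d) := by
  unfold cellParam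
  have h1 : Measurable fun t : UnitAddTorus (Fin d) =>
      (UnitAddTorus.measurableEquivPiIoc (fun _ : Fin d => (0 : ℝ)) t).1 :=
    measurable_subtype_coe.comp (UnitAddTorus.measurableEquivPiIoc _).measurable
  refine (PiLp.continuous_toLp 2 (fun _ : Fin d => ℝ)).measurable.comp ?_
  exact measurable_pi_lambda _ fun i => ((measurable_pi_apply i).comp h1).const_mul _

theorem expo_cellParam {d : ℕ} (ξ : Fin d → ℤ) (t : UnitAddTorus (Fin d)) :
    expo ξ (cellParam d t) = UnitAddTorus.mFourier ξ t := by
  set y := UnitAddTorus.measurableEquivPiIoc (fun _ : Fin d => (0 : ℝ)) t with hy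
  have ht : t = fun i => (y.1 i : UnitAddCircle) := by
    rw [← UnitAddTorus.coe_symm_measurableEquivPiIoc_apply, hy, MeasurableEquiv.symm_apply_apply]
  have h2 : cellParam d t = WithLp.toLp 2 fun i => 2 * Real.pi * y.1 i := rfl
  rw [h2, ht]
  simp only [expo, pairing, UnitAddTorus.mFourier, ContinuousMap.coe_mk, fourier_coe_apply]
  rw [← Complex.exp_sum]
  congr 1
  push_cast
  rw [Finset.mul_sum]
  refine Finset.sum_congr rfl fun i _ => ?_
  simp; ring

/-- `volume` on the torus is here the product of the Haar probability measures, that is, Lebesgue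
measure on (0, 1]^d. Scaling by 2π produces the factor (2π)^{-d}. -/
theorem map_cellParam (d : ℕ) : Measure.map (cellParam d) volume =
    (ENNReal.ofReal ((2 * Real.pi) ^ d))⁻¹ • (volume : Measure (Horiz d)).restrict (cell d) := by
  set S : Set (Fin d → ℝ) := {x | ∀ i, x i ∈ Set.Ioc (0 : ℝ) (0 + 1)} with hS
  have hSm : MeasurableSet S := by
    have : S = ⋂ i, (fun x : Fin d → ℝ => x i) ⁻¹' Set.Ioc 0 (0 + 1) := by ext x; simp [hS]
    rw [this]
    exact MeasurableSet.iInter fun i => (measurable_pi_apply i) measurableSet_Ioc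
  have h1 : Measure.map (fun t : UnitAddTorus (Fin d) =>
      (UnitAddTorus.measurableEquivPiIoc (fun _ : Fin d => (0 : ℝ)) t).1) volume
      = (volume : Measure (Fin d → ℝ)).restrict S := by
    have h := (UnitAddTorus.measurePreserving_equivPiIoc (fun _ : Fin d => (0 : ℝ))).map_eq
    refine Eq.trans ?_ (map_comap_subtype_coe hSm volume)
    refine Eq.trans ?_ (congrArg (Measure.map Subtype.val) h)
    rw [Measure.map_map measurable_subtype_coe (UnitAddTorus.measurableEquivPiIoc _).measurable]
    rfl
  have hpi : (0 : ℝ) < 2 * Real.pi := by positivity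
  set S2 : Set (Fin d → ℝ) := {x | ∀ i, x i ∈ Set.Ioc (0 : ℝ) (2 * Real.pi)} with hS2
  have hS2m : MeasurableSet S2 := by
    have : S2 = ⋂ i, (fun x : Fin d → ℝ => x i) ⁻¹' Set.Ioc 0 (2 * Real.pi) := by ext x; simp [hS2]
    rw [this]
    exact MeasurableSet.iInter fun i => (measurable_pi_apply i) measurableSet_Ioc
  have hpre : (fun x : Fin d → ℝ => (2 * Real.pi) • x) ⁻¹' S2 = S := by
    ext x
    simp only [hS, hS2, Set.mem_preimage, Set.mem_ofPred_eq, Pi.smul_apply, smul_eq_mul, Set.mem_Ioc]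
    refine forall_congr' fun i => and_congr (by simp [hpi]) ?_
    rw [zero_add]
    constructor
    · intro h; nlinarith
    · intro h; nlinarith
  have h2 : Measure.map (fun x : Fin d → ℝ => (2 * Real.pi) • x) ((volume : Measure (Fin d → ℝ)).restrict S)
      = (ENNReal.ofReal ((2 * Real.pi) ^ d))⁻¹ • (volume : Measure (Fin d → ℝ)).restrict S2 := by
    rw [← hpre, ← Measure.restrict_map (by fun_prop) hS2m, Measure.map_addHaar_smul _ hpi.ne',
      Measure.restrict_smul]
    congr 1
    rw [Module.finrank_pi, Fintype.card_fin, abs_of_pos (by positivity),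
      ENNReal.ofReal_inv_of_pos (by positivity)]
  have h3 : (volume : Measure (Fin d → ℝ)).restrict S2
      = (volume : Measure (Fin d → ℝ)).restrict ((WithLp.toLp 2 : (Fin d → ℝ) → Horiz d) ⁻¹' cell d) := by
    -- The parametrisation lands in (0, 2π]^d while the cell is [0, 2π)^d; both agree almost
    -- everywhere with the closed cube.
    refine Measure.restrict_congr_set ?_
    have e1 : S2 = Set.pi Set.univ fun _ : Fin d => Set.Ioc (0 : ℝ) (2 * Real.pi) := by
      ext x; simp [hS2]
    have e2 : ((WithLp.toLp 2 : (Fin d → ℝ) → Horiz d) ⁻¹' cell d)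
        = Set.pi Set.univ fun _ : Fin d => Set.Ico (0 : ℝ) (2 * Real.pi) := by
      ext x; simp [cell]
    rw [e1, e2]
    exact (Measure.univ_pi_Ioc_ae_eq_Icc (f := fun _ : Fin d => (0 : ℝ))
      (g := fun _ => 2 * Real.pi)).trans Measure.univ_pi_Ico_ae_eq_Icc.symm
  have h4 : Measure.map (WithLp.toLp 2 : (Fin d → ℝ) → Horiz d)
      ((volume : Measure (Fin d → ℝ)).restrict ((WithLp.toLp 2 : (Fin d → ℝ) → Horiz d) ⁻¹' cell d))
      = (volume : Measure (Horiz d)).restrict (cell d) := by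
    rw [← Measure.restrict_map (PiLp.continuous_toLp 2 (fun _ : Fin d => ℝ)).measurable
      (measurableSet_cell d), (PiLp.volume_preserving_toLp (Fin d)).map_eq]
  have hm1 : Measurable fun t : UnitAddTorus (Fin d) =>
      (UnitAddTorus.measurableEquivPiIoc (fun _ : Fin d => (0 : ℝ)) t).1 :=
    measurable_subtype_coe.comp (UnitAddTorus.measurableEquivPiIoc _).measurable
  have hm3 : Measurable (WithLp.toLp 2 : (Fin d → ℝ) → Horiz d) :=
    (PiLp.continuous_toLp 2 (fun _ : Fin d => ℝ)).measurable
  have : cellParam d = (WithLp.toLp 2 : (Fin d → ℝ) → Horiz d) ∘ ((fun x : Fin d → ℝ => (2 * Real.pi) • x) ∘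
      (fun t : UnitAddTorus (Fin d) =>
      (UnitAddTorus.measurableEquivPiIoc (fun _ : Fin d => (0 : ℝ)) t).1)) := rfl
  rw [this, ← Measure.map_map hm3 ((measurable_const_smul _).comp hm1),
    ← Measure.map_map (measurable_const_smul _) hm1, h1, h2, Measure.map_smul, h3, h4]

theorem integral_torus {d : ℕ} {E : Type*} [NormedAddCommGroup E] [NormedSpace ℝ E] {f : Horiz d → E}
    (hf : AEStronglyMeasurable f (volume.restrict (cell d))) :
    ∫ t, f (cellParam d t) = ((2 * Real.pi) ^ d)⁻¹ • ∫ x in cell d, f x := by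
  rw [← integral_map (measurable_cellParam d).aemeasurable, map_cellParam, integral_smul_measure]
  · congr 1
    rw [ENNReal.toReal_inv, ENNReal.toReal_ofReal (by positivity)]
  · rw [map_cellParam]
    exact hf.mono_ac Measure.smul_absolutelyContinuous

theorem continuous_pairing {d : ℕ} (ξ : Fin d → ℤ) : Continuous (pairing ξ) := by
  unfold pairing; fun_prop

theorem continuous_expo {d : ℕ} (ξ : Fin d → ℤ) : Continuous (expo ξ) := by
  unfold expo
  have := continuous_pairing ξ
  fun_prop

theorem norm_expo {d : ℕ} (ξ : Fin d → ℤ) (x : Horiz d) : ‖expo ξ x‖ = 1 := by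
  unfold expo
  rw [mul_comm]
  exact Complex.norm_exp_ofReal_mul_I _

theorem mFourierCoeff_cellParam {d : ℕ} {f : Horiz d → ℂ}
    (hf : AEStronglyMeasurable f (volume.restrict (cell d))) (ξ : Fin d → ℤ) :
    UnitAddTorus.mFourierCoeff (fun t => f (cellParam d t)) ξ = fc f ξ := by
  unfold UnitAddTorus.mFourierCoeff
  simp_rw [← expo_cellParam, smul_eq_mul]
  rw [integral_torus (f := fun x => expo (-ξ) x * f x)
    ((continuous_expo _).aestronglyMeasurable.mul hf)]
  rw [fc, Complex.real_smul]
  push_cast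
  rfl

/-- Parseval's identity on the cell. -/
theorem hasSum_sq_fc {d : ℕ} {f : Horiz d → ℂ} (hf : MemLp f 2 (volume.restrict (cell d))) :
    HasSum (fun ξ => ‖fc f ξ‖ ^ 2) (((2 * Real.pi) ^ d)⁻¹ * ∫ x in cell d, ‖f x‖ ^ 2) := by
  have hF : MemLp (fun t => f (cellParam d t)) 2 (volume : Measure (UnitAddTorus (Fin d))) := by
    refine MemLp.comp_of_map (g := f) (f := cellParam d) ?_ (measurable_cellParam d).aemeasurable
    rw [map_cellParam]
    exact hf.smul_measure (ENNReal.inv_ne_top.2 (by simp; positivity))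
  set g := MemLp.toLp _ hF with hg
  have h := UnitAddTorus.hasSum_sq_mFourierCoeff g
  have e1 : ∀ ξ, UnitAddTorus.mFourierCoeff g ξ = fc f ξ := fun ξ => by
    rw [← mFourierCoeff_cellParam hf.1]
    refine integral_congr_ae ?_
    filter_upwards [hF.coeFn_toLp] with t ht
    rw [ht]
  have e2 : ∫ t, ‖g t‖ ^ 2 = ((2 * Real.pi) ^ d)⁻¹ * ∫ x in cell d, ‖f x‖ ^ 2 := by
    rw [← smul_eq_mul, ← integral_torus (f := fun x => ‖f x‖ ^ 2) (hf.1.norm.pow 2)]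
    refine integral_congr_ae ?_
    filter_upwards [hF.coeFn_toLp] with t ht
    rw [ht]
  simpa only [e1, e2] using h

end

/-! ### Absolutely convergent trigonometric series. -/

section

theorem volume_cell (d : ℕ) : volume (cell d) = ENNReal.ofReal ((2 * Real.pi) ^ d) := by
  have h := congrArg (fun μ => μ Set.univ) (map_cellParam d)
  simp only [Measure.map_apply (measurable_cellParam d) MeasurableSet.univ, Set.preimage_univ,
    Measure.smul_apply, Measure.restrict_apply_univ, smul_eq_mul] at h
  have h1 : (Measure.pi fun _ : Fin d => (AddCircle.haarAddCircle : Measure UnitAddCircle)) Set.univ = 1 :=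
    measure_univ
  -- The instance that made this measure `volume` was local to the previous section, so the product
  -- measure is spelled out.
  change (Measure.pi fun _ : Fin d => (AddCircle.haarAddCircle : Measure UnitAddCircle)) Set.univ = _ at h
  rw [h1, eq_comm, mul_comm, ← div_eq_mul_inv, ENNReal.div_eq_one_iff] at h
  · exact h
  · simp; positivity
  · simp

instance isFiniteMeasure_cell (d : ℕ) : IsFiniteMeasure ((volume : Measure (Horiz d)).restrict (cell d)) :=
  ⟨by rw [Measure.restrict_apply_univ, volume_cell]; exact ENNReal.ofReal_lt_top⟩

theorem memLp_cell_of_continuous {d : ℕ} {f : Horiz d → ℂ} (hf : Continuous f) {C : ℝ} (hC : ∀ x, ‖f x‖ ≤ C) :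
    MemLp f 2 (volume.restrict (cell d)) :=
  MemLp.of_bound hf.aestronglyMeasurable C (Eventually.of_forall hC)

theorem fc_expo {d : ℕ} (ξ ζ : Fin d → ℤ) : fc (expo ζ) ξ = if ζ = ξ then 1 else 0 := by
  rw [← mFourierCoeff_cellParam (continuous_expo ζ).aestronglyMeasurable]
  simp_rw [expo_cellParam]
  rw [← UnitAddTorus.mFourierCoeff_toLp, ← UnitAddTorus.mFourierBasis_repr,
    HilbertBasis.repr_apply_apply, UnitAddTorus.coe_mFourierBasis]
  have := orthonormal_iff_ite.1 (UnitAddTorus.orthonormal_mFourier (d := Fin d)) ξ ζ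
  rw [this]
  simp only [eq_comm]

theorem integrable_expo_mul {d : ℕ} {f : Horiz d → ℂ} (hf : Integrable f (volume.restrict (cell d)))
    (ξ : Fin d → ℤ) : Integrable (fun x => expo ξ x * f x) (volume.restrict (cell d)) :=
  hf.bdd_mul (continuous_expo ξ).aestronglyMeasurable (Eventually.of_forall fun x => (norm_expo ξ x).le)

theorem fc_sub {d : ℕ} {f g : Horiz d → ℂ} (hf : Integrable f (volume.restrict (cell d)))
    (hg : Integrable g (volume.restrict (cell d))) (ξ : Fin d → ℤ) :
    fc (fun x => f x - g x) ξ = fc f ξ - fc g ξ := by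
  unfold fc
  simp_rw [mul_sub]
  rw [integral_sub (integrable_expo_mul hf _) (integrable_expo_mul hg _), mul_sub]

/-- The trigonometric series with coefficients `c`. -/
def trigSeries {d : ℕ} (c : (Fin d → ℤ) → ℂ) (x : Horiz d) : ℂ := ∑' ξ, c ξ * expo ξ x

theorem hasSum_trigSeries {d : ℕ} {c : (Fin d → ℤ) → ℂ} (hc : Summable fun ξ => ‖c ξ‖) (x : Horiz d) :
    HasSum (fun ξ => c ξ * expo ξ x) (trigSeries c x) :=
  (Summable.of_norm (by simpa [norm_expo] using hc)).hasSum

theorem continuous_trigSeries {d : ℕ} {c : (Fin d → ℤ) → ℂ} (hc : Summable fun ξ => ‖c ξ‖) :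
    Continuous (trigSeries c) :=
  continuous_tsum (fun ξ => continuous_const.mul (continuous_expo ξ)) hc
    fun ξ x => by rw [norm_mul, norm_expo, mul_one]

theorem norm_trigSeries_le {d : ℕ} {c : (Fin d → ℤ) → ℂ} (hc : Summable fun ξ => ‖c ξ‖) (x : Horiz d) :
    ‖trigSeries c x‖ ≤ ∑' ξ, ‖c ξ‖ := by
  refine (norm_tsum_le_tsum_norm (by simpa [norm_expo] using hc)).trans (le_of_eq ?_)
  simp [norm_expo]

theorem memLp_trigSeries {d : ℕ} {c : (Fin d → ℤ) → ℂ} (hc : Summable fun ξ => ‖c ξ‖) :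
    MemLp (trigSeries c) 2 (volume.restrict (cell d)) :=
  memLp_cell_of_continuous (continuous_trigSeries hc) (norm_trigSeries_le hc)

/-- Absolute convergence allows integration term by term, and orthogonality of the exponentials
leaves one term. -/
theorem fc_trigSeries {d : ℕ} {c : (Fin d → ℤ) → ℂ} (hc : Summable fun ξ => ‖c ξ‖) (ξ : Fin d → ℤ) :
    fc (trigSeries c) ξ = c ξ := by
  have h : HasSum (fun ζ => ∫ x in cell d, expo (-ξ) x * (c ζ * expo ζ x))
      (∫ x in cell d, expo (-ξ) x * trigSeries c x) := by
    refine hasSum_integral_of_dominated_convergence (fun ζ _ => ‖c ζ‖) (fun ζ => ?_) (fun ζ => ?_) ?_ ?_ ?_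
    · exact ((continuous_expo _).mul (continuous_const.mul (continuous_expo _))).aestronglyMeasurable
    · exact Eventually.of_forall fun x => by simp [norm_expo]
    · exact Eventually.of_forall fun x => hc
    · exact integrable_const _
    · exact Eventually.of_forall fun x => (hasSum_trigSeries hc x).mul_left _
  have h2 := h.mul_left (((2 * Real.pi : ℂ) ^ d)⁻¹)
  have h3 : ∀ ζ, ((2 * Real.pi : ℂ) ^ d)⁻¹ * ∫ x in cell d, expo (-ξ) x * (c ζ * expo ζ x)
      = if ζ = ξ then c ξ else 0 := fun ζ => by
    have h4 := fc_expo ξ ζ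
    have : ∀ x, expo (-ξ) x * (c ζ * expo ζ x) = c ζ * (expo (-ξ) x * expo ζ x) := fun x => by ring
    simp_rw [this]
    rw [integral_const_mul, mul_left_comm]
    change c ζ * fc (expo ζ) ξ = _
    rw [h4]
    split_ifs with hh
    · rw [hh, mul_one]
    · simp
  simp_rw [h3] at h2
  exact h2.unique (hasSum_ite_eq ξ (c ξ))

/-- The Euclidean length of a frequency. -/
def freqNorm {d : ℕ} (ξ : Fin d → ℤ) : ℝ := Real.sqrt (∑ i, (ξ i : ℝ) ^ 2)

theorem freqNorm_nonneg {d : ℕ} (ξ : Fin d → ℤ) : 0 ≤ freqNorm ξ := Real.sqrt_nonneg _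

theorem freqNorm_sq {d : ℕ} (ξ : Fin d → ℤ) : freqNorm ξ ^ 2 = ∑ i, (ξ i : ℝ) ^ 2 :=
  Real.sq_sqrt (Finset.sum_nonneg fun _ _ => sq_nonneg _)

theorem abs_le_freqNorm {d : ℕ} (ξ : Fin d → ℤ) (i : Fin d) : |(ξ i : ℝ)| ≤ freqNorm ξ := by
  refine Real.abs_le_sqrt ?_
  exact Finset.single_le_sum (f := fun i => (ξ i : ℝ) ^ 2) (fun i _ => sq_nonneg _) (Finset.mem_univ i)

theorem one_le_freqNorm {d : ℕ} {ξ : Fin d → ℤ} (hξ : ξ ≠ 0) : 1 ≤ freqNorm ξ := by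
  obtain ⟨i, hi⟩ := Function.ne_iff.1 hξ
  refine le_trans ?_ (abs_le_freqNorm ξ i)
  exact_mod_cast Int.one_le_abs hi

@[simp] theorem freqNorm_zero {d : ℕ} : freqNorm (0 : Fin d → ℤ) = 0 := by simp [freqNorm]

/-- Since ∑ |ξ_i| ≤ d |ξ|, the exponential is dominated by a product of one-dimensional geometric
terms, whose finite partial sums lie in boxes and factorise. -/
theorem summable_exp_neg_freqNorm (d : ℕ) {s : ℝ} (hs : 0 < s) :
    Summable fun ξ : Fin d → ℤ => Real.exp (-s * freqNorm ξ) := by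
  -- Dividing by d + 1 instead of d covers d = 0 as well.
  set r : ℝ := s / (d + 1) with hr
  have hr0 : 0 < r := by positivity
  set g : ℤ → ℝ := fun n => Real.exp (-r * |(n : ℝ)|) with hg
  have hg0 : ∀ n, 0 ≤ g n := fun n => (Real.exp_pos _).le
  have hgs : Summable g := by
    have h1 : Summable fun n : ℕ => Real.exp (-r * n) := by
      have := summable_geometric_of_lt_one (Real.exp_pos (-r)).le (Real.exp_lt_one_iff.2 (by linarith))
      refine this.congr fun n => ?_
      rw [← Real.exp_nat_mul]; ring_nf
    refine Summable.of_nat_of_neg ?_ ?_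
    · simpa [hg] using h1
    · simpa [hg] using h1
  have hle : ∀ ξ : Fin d → ℤ, Real.exp (-s * freqNorm ξ) ≤ ∏ i, g (ξ i) := fun ξ => by
    rw [hg, ← Real.exp_sum]
    refine Real.exp_le_exp.2 ?_
    rw [← Finset.mul_sum]
    have h1 : ∑ i, |(ξ i : ℝ)| ≤ d * freqNorm ξ := by
      simpa using Finset.sum_le_sum fun i (_ : i ∈ Finset.univ) => abs_le_freqNorm ξ i
    have h2 : s = r * (d + 1) := by rw [hr]; field_simp
    have h3 := freqNorm_nonneg ξ
    rw [h2]
    nlinarith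
  refine Summable.of_nonneg_of_le (fun _ => (Real.exp_pos _).le) hle ?_
  refine summable_of_sum_le (c := (∑' n, g n) ^ d) (fun ξ => Finset.prod_nonneg fun i _ => hg0 _) fun F => ?_
  classical
  set T : Fin d → Finset ℤ := fun i => F.image fun ξ => ξ i
  have hsub : F ⊆ Fintype.piFinset T := fun ξ hξ =>
    Fintype.mem_piFinset.2 fun i => Finset.mem_image_of_mem _ hξ
  refine (Finset.sum_le_sum_of_subset_of_nonneg hsub fun ξ _ _ => Finset.prod_nonneg fun i _ => hg0 _).trans ?_
  rw [← Finset.prod_univ_sum]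
  calc ∏ i, ∑ j ∈ T i, g j ≤ ∏ _i : Fin d, ∑' n, g n :=
        Finset.prod_le_prod (fun i _ => Finset.sum_nonneg fun _ _ => hg0 _)
          fun i _ => hgs.sum_le_tsum _ fun _ _ => hg0 _
    _ = _ := by simp

/-- Half of the exponential absorbs the linear factor: x e^{-sx/2} ≤ 2/s. -/
theorem summable_mul_exp_neg_freqNorm (d : ℕ) {s : ℝ} (hs : 0 < s) :
    Summable fun ξ : Fin d → ℤ => (1 + freqNorm ξ) * Real.exp (-s * freqNorm ξ) := by
  refine Summable.of_nonneg_of_le (fun ξ => by have := freqNorm_nonneg ξ; positivity) (fun ξ => ?_)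
    ((summable_exp_neg_freqNorm d (half_pos hs)).mul_left (1 + 2 / s))
  have h0 := freqNorm_nonneg ξ
  have h1 : Real.exp (-s * freqNorm ξ) = Real.exp (-(s / 2) * freqNorm ξ) * Real.exp (-(s / 2) * freqNorm ξ) := by
    rw [← Real.exp_add]; ring_nf
  have h2 : freqNorm ξ * Real.exp (-(s / 2) * freqNorm ξ) ≤ 2 / s := by
    rw [neg_mul, Real.exp_neg, ← div_eq_mul_inv, div_le_iff₀ (Real.exp_pos _)]
    have := Real.add_one_le_exp (s / 2 * freqNorm ξ)
    calc freqNorm ξ = 2 / s * (s / 2 * freqNorm ξ) := by field_simp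
      _ ≤ _ := by gcongr; linarith
  have h3 : Real.exp (-(s / 2) * freqNorm ξ) ≤ 1 := Real.exp_le_one_iff.2 (by nlinarith)
  rw [h1, ← mul_assoc]
  gcongr
  linarith

end

/-! ### Periodicity, and integration by parts over the periodic column. -/

section

/-- The basis of the lattice `(2π ℤ)^d`. -/
def latticeBasis (d : ℕ) : Module.Basis (Fin d) ℝ (Horiz d) :=
  (EuclideanSpace.basisFun (Fin d) ℝ).toBasis.isUnitSMul
    (fun _ => (Ne.isUnit (by positivity : (2 * Real.pi : ℝ) ≠ 0)))

theorem latticeBasis_apply {d : ℕ} (i : Fin d) :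
    latticeBasis d i = EuclideanSpace.single i (2 * Real.pi) := by
  rw [latticeBasis, Module.Basis.isUnitSMul_apply]
  ext j
  simp

theorem fundamentalDomain_latticeBasis (d : ℕ) : ZSpan.fundamentalDomain (latticeBasis d) = cell d := by
  ext x
  have hpi : (0 : ℝ) < 2 * Real.pi := by positivity
  have h : ∀ i, (latticeBasis d).repr x i = (2 * Real.pi)⁻¹ * x i := fun i => by
    rw [latticeBasis, Module.Basis.repr_isUnitSMul]
    simp [Units.smul_def]
  simp only [ZSpan.mem_fundamentalDomain, h, cell, Set.mem_ofPred_eq, Set.mem_Ico]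
  refine forall_congr' fun i => and_congr ?_ ?_
  · rw [mul_nonneg_iff_of_pos_left (by positivity)]
  · rw [inv_mul_lt_iff₀ hpi, mul_one]

theorem TorusPeriodic.add_lattice {d : ℕ} {F : Type*} {f : Horiz d → F} (hf : TorusPeriodic f)
    {v : Horiz d} (hv : v ∈ Submodule.span ℤ (Set.range (latticeBasis d))) (x : Horiz d) :
    f (x + v) = f x := by
  induction hv using Submodule.span_induction generalizing x with
  | mem v hv =>
    obtain ⟨i, rfl⟩ := hv
    rw [latticeBasis_apply]; exact hf i x
  | zero => rw [add_zero]
  | add v w _ _ h1 h2 => rw [← add_assoc, h2, h1]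
  | smul n v _ h =>
    have hn : ∀ (n : ℕ) x, f (x + n • v) = f x := fun n => by
      induction n with
      | zero => simp
      | succ k ih => intro x; rw [succ_nsmul, ← add_assoc, h, ih]
    obtain ⟨m, rfl | rfl⟩ := n.eq_nat_or_neg
    · simpa using hn m x
    · have := hn m (x + (-(m : ℤ)) • v)
      rw [← this]
      congr 1
      simp

open scoped Pointwise in
-- The cell and its translate are both fundamental domains of the lattice (2πℤ)^d.
theorem setIntegral_cell_add {d : ℕ} {f : Horiz d → ℝ} (hf : TorusPeriodic f) (v : Horiz d) :
    ∫ x in cell d, f (x + v) = ∫ x in cell d, f x := by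
  set Λ := (Submodule.span ℤ (Set.range (latticeBasis d))).toAddSubgroup with hΛ
  have : Countable Λ :=
    inferInstanceAs (Countable (Submodule.span ℤ (Set.range (latticeBasis d))))
  have h0 : IsAddFundamentalDomain Λ (cell d) volume := by
    rw [← fundamentalDomain_latticeBasis]
    exact ZSpan.isAddFundamentalDomain' (latticeBasis d) volume
  have h1 : IsAddFundamentalDomain Λ (v +ᵥ cell d) volume := h0.vadd_of_comm v
  have h2 : ∫ x in v +ᵥ cell d, f x = ∫ x in cell d, f x := by
    refine h1.setIntegral_eq h0 fun g x => ?_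
    rw [AddSubgroup.vadd_def, vadd_eq_add, add_comm]
    exact hf.add_lattice g.2 x
  rw [← h2]
  have h3 : v +ᵥ cell d = (fun x => x + v) '' cell d := by
    ext x; simp only [Set.mem_vadd_set, Set.mem_image, vadd_eq_add, add_comm]
  rw [h3, (measurePreserving_add_right volume v).setIntegral_image_emb (measurableEmbedding_addRight v)]

theorem isBounded_cell (d : ℕ) : Bornology.IsBounded (cell d) := by
  rw [← fundamentalDomain_latticeBasis]
  exact ZSpan.fundamentalDomain_isBounded _

theorem measurableSet_column (d : ℕ) : MeasurableSet (cell d ×ˢ (Set.univ : Set ℝ)) :=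
  (measurableSet_cell d).prod MeasurableSet.univ

/-- A ball that contains the part of the column over the cell at heights at most `R`. -/
theorem exists_ball (d : ℕ) (R : ℝ) : ∃ r : ℝ, 0 < r ∧ ∀ p : Horiz d × ℝ, p.1 ∈ cell d → |p.2| ≤ R →
    p ∈ Metric.closedBall (0 : Horiz d × ℝ) r := by
  obtain ⟨r, hr⟩ := (isBounded_cell d).exists_norm_le
  refine ⟨max (max r R) 1, by positivity, fun p h1 h2 => ?_⟩
  rw [mem_closedBall_zero_iff, Prod.norm_def]
  exact max_le ((hr _ h1).trans ((le_max_left _ _).trans (le_max_left _ _)))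
    (h2.trans ((le_max_right _ _).trans (le_max_left _ _)))

theorem exists_bound_of_continuous {d : ℕ} {F : Type*} [NormedAddCommGroup F] {f : Horiz d × ℝ → F}
    (hf : Continuous f) {R : ℝ} (hR : ∀ p, R < |p.2| → f p = 0) :
    ∃ C : ℝ, 0 ≤ C ∧ ∀ p : Horiz d × ℝ, p.1 ∈ cell d → ‖f p‖ ≤ C := by
  obtain ⟨r, -, hr⟩ := exists_ball d R
  obtain ⟨C, hC⟩ := (isCompact_closedBall (0 : Horiz d × ℝ) r).exists_bound_of_continuousOn hf.continuousOn
  refine ⟨max C 0, le_max_right _ _, fun p hp => ?_⟩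
  rcases lt_or_ge R |p.2| with h | h
  · rw [hR p h, norm_zero]; exact le_max_right _ _
  · exact (hC p (hr p hp h)).trans (le_max_left _ _)

theorem integrableOn_column_indicator (d : ℕ) (R C : ℝ) :
    IntegrableOn (fun p : Horiz d × ℝ => if |p.2| ≤ R then C else 0) (cell d ×ˢ Set.univ) := by
  have h1 : MeasurableSet (cell d ×ˢ Set.Icc (-R) R) := (measurableSet_cell d).prod measurableSet_Icc
  refine IntegrableOn.of_forall_sdiff_eq_zero (s := cell d ×ˢ Set.Icc (-R) R) ?_ (measurableSet_column d) ?_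
  · have : IntegrableOn (fun _ : Horiz d × ℝ => C) (cell d ×ˢ Set.Icc (-R) R) := by
      refine integrableOn_const ?_
      rw [Measure.volume_eq_prod, Measure.prod_prod, volume_cell]
      exact ENNReal.mul_ne_top ENNReal.ofReal_ne_top (by simp)
    refine this.congr_fun (fun p hp => ?_) h1
    rw [if_pos (abs_le.2 hp.2)]
  · rintro p ⟨hp1, hp2⟩
    rw [if_neg]
    exact fun h => hp2 ⟨hp1.1, abs_le.1 h⟩

theorem integrableOn_column {d : ℕ} {F : Type*} [NormedAddCommGroup F] {f : Horiz d × ℝ → F}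
    (hf : Continuous f) {R : ℝ} (hR : ∀ p, R < |p.2| → f p = 0) :
    IntegrableOn f (cell d ×ˢ Set.univ) := by
  obtain ⟨C, -, hC⟩ := exists_bound_of_continuous hf hR
  refine (integrableOn_column_indicator d R C).mono' hf.aestronglyMeasurable ?_
  refine (ae_restrict_iff' (measurableSet_column d)).2 (Eventually.of_forall fun p hp => ?_)
  split_ifs with h
  · exact hC p hp.1
  · rw [hR p (not_le.1 h), norm_zero]

theorem restrict_column (d : ℕ) : (volume : Measure (Horiz d × ℝ)).restrict (cell d ×ˢ Set.univ)
    = (volume.restrict (cell d)).prod volume := by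
  rw [Measure.volume_eq_prod, ← Measure.prod_restrict, Measure.restrict_univ]

/-- By Fubini, the vertical shift is absorbed by translation invariance on ℝ and the horizontal one
by `setIntegral_cell_add`. -/
theorem setIntegral_column_add {d : ℕ} {f : Horiz d × ℝ → ℝ} (hp : HorizPeriodic f) (hf : Continuous f)
    {R : ℝ} (hR : ∀ p, R < |p.2| → f p = 0) (v : Horiz d × ℝ) :
    ∫ p in cell d ×ˢ Set.univ, f (p + v) = ∫ p in cell d ×ˢ Set.univ, f p := by
  have hi := integrableOn_column hf hR
  have hi2 : IntegrableOn (fun p => f (p + v)) (cell d ×ˢ Set.univ) := by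
    refine integrableOn_column (R := R + |v.2|) (by fun_prop) fun p h => hR _ ?_
    have := abs_sub_abs_le_abs_sub p.2 (-v.2)
    rw [abs_neg, sub_neg_eq_add] at this
    change R < |p.2 + v.2|
    linarith
  unfold IntegrableOn at hi hi2
  rw [restrict_column] at hi hi2 ⊢
  rw [integral_prod _ hi, integral_prod _ hi2]
  have h1 : ∀ x : Horiz d, ∫ y, f ((x, y) + v) = ∫ y, f (x + v.1, y) := fun x =>
    integral_add_right_eq_self (fun y => f (x + v.1, y)) v.2
  simp_rw [h1]
  refine setIntegral_cell_add (f := fun x => ∫ y, f (x, y)) (fun i x => ?_) v.1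
  simp_rw [fun y => hp y i x]

/-- The integral over the column of a directional derivative of a periodic locally Lipschitz function
with support bounded in `y` is zero. -/
theorem setIntegral_column_lineDeriv {d : ℕ} {f D : Horiz d × ℝ → ℝ} (hp : HorizPeriodic f)
    (hf : LocallyLipschitz f) {R : ℝ} (hR : ∀ p, R < |p.2| → f p = 0) (v : Horiz d × ℝ)
    (hD : ∀ᵐ p, HasLineDerivAt ℝ f (D p) p v) : ∫ p in cell d ×ˢ Set.univ, D p = 0 := by
  set R' := R + ‖v‖ with hR'
  obtain ⟨r, hr0, hr⟩ := exists_ball d R'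
  -- The radius is enlarged by ‖v‖ so that one Lipschitz constant bounds all difference quotients
  -- with step at most 1.
  obtain ⟨K, hK⟩ := hf.locallyLipschitzOn.exists_lipschitzOnWith_of_compact
    (isCompact_closedBall (0 : Horiz d × ℝ) (r + ‖v‖))
  have hv2 : |v.2| ≤ ‖v‖ := norm_snd_le v
  set t : ℕ → ℝ := fun n => ((n : ℝ) + 1)⁻¹ with ht
  have ht0 : ∀ n, 0 < t n := fun n => by simp only [ht]; positivity
  have ht1 : ∀ n, t n ≤ 1 := fun n => inv_le_one_of_one_le₀ (by simp)
  have hsupp : ∀ n p, R' < |p.2| → f (p + t n • v) = 0 := fun n p h => hR _ <| by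
    have h1 := abs_sub_abs_le_abs_sub p.2 (-(t n * v.2))
    rw [abs_neg, sub_neg_eq_add, abs_mul, abs_of_pos (ht0 n)] at h1
    have h2 : t n * |v.2| ≤ 1 * ‖v‖ := mul_le_mul (ht1 n) hv2 (abs_nonneg _) zero_le_one
    change R < |p.2 + t n * v.2|
    linarith
  have hsupp0 : ∀ p, R' < |p.2| → f p = 0 := fun p h => hR _ (by have := norm_nonneg v; linarith)
  -- The integral of the derivative is the limit of integrals of difference quotients, each of which
  -- is zero by translation invariance.
  have hlim : Tendsto (fun n => ∫ p in cell d ×ˢ Set.univ, (t n)⁻¹ * (f (p + t n • v) - f p)) atTop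
      (𝓝 (∫ p in cell d ×ˢ Set.univ, D p)) := by
    refine tendsto_integral_of_dominated_convergence (fun p => if |p.2| ≤ R' then K * ‖v‖ else 0)
      (fun n => ?_) (integrableOn_column_indicator d R' _) (fun n => ?_) ?_
    · have := hf.continuous
      exact (by fun_prop : Continuous fun p => (t n)⁻¹ * (f (p + t n • v) - f p)).aestronglyMeasurable
    · refine (ae_restrict_iff' (measurableSet_column d)).2 (Eventually.of_forall fun p hp => ?_)
      split_ifs with h
      · have hp1 : p ∈ Metric.closedBall (0 : Horiz d × ℝ) r := hr p hp.1 h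
        rw [mem_closedBall_zero_iff] at hp1
        have hv := norm_nonneg v
        have e1 : ‖t n • v‖ ≤ ‖v‖ := by
          rw [norm_smul, Real.norm_of_nonneg (ht0 n).le]
          exact mul_le_of_le_one_left hv (ht1 n)
        have h1 := hK.dist_le_mul (p + t n • v) (mem_closedBall_zero_iff.2
          ((norm_add_le _ _).trans (by linarith))) p (mem_closedBall_zero_iff.2 (by linarith))
        rw [Real.dist_eq, dist_eq_norm, add_sub_cancel_left, norm_smul, Real.norm_of_nonneg (ht0 n).le] at h1
        rw [Real.norm_eq_abs, abs_mul, abs_of_pos (inv_pos.2 (ht0 n)), inv_mul_le_iff₀ (ht0 n)]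
        linarith
      · rw [hsupp n p (not_le.1 h), hsupp0 p (not_le.1 h)]; simp
    · refine ae_restrict_of_ae ?_
      filter_upwards [hD] with p hpD
      have h1 := hpD.tendsto_slope_zero
      have h2 : Tendsto t atTop (𝓝[≠] 0) := by
        refine tendsto_nhdsWithin_iff.2 ⟨?_, Eventually.of_forall fun n => (ht0 n).ne'⟩
        exact tendsto_inv_atTop_zero.comp (tendsto_atTop_add_const_right _ _ tendsto_natCast_atTop_atTop)
      exact h1.comp h2
  have hzero : ∀ n, ∫ p in cell d ×ˢ Set.univ, (t n)⁻¹ * (f (p + t n • v) - f p) = 0 := fun n => by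
    have hi2 : IntegrableOn (fun p => f (p + t n • v)) (cell d ×ˢ Set.univ) := by
      have := hf.continuous
      exact integrableOn_column (by fun_prop) (hsupp n)
    rw [integral_const_mul, integral_sub hi2 (integrableOn_column hf.continuous hR),
      setIntegral_column_add hp hf.continuous hR, sub_self, mul_zero]
  simp_rw [hzero] at hlim
  exact (tendsto_nhds_unique hlim tendsto_const_nhds)

end

/-! ### Test functions, membership in H¹, and linearity of weak derivatives and traces. -/

section

theorem TorusPeriodic.exists_mem_cell {d : ℕ} {F : Type*} {f : Horiz d → F} (hf : TorusPeriodic f)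
    (x : Horiz d) : ∃ x₀ ∈ cell d, f x₀ = f x := by
  refine ⟨ZSpan.fract (latticeBasis d) x, ?_, ?_⟩
  · rw [← fundamentalDomain_latticeBasis]
    exact ZSpan.fract_mem_fundamentalDomain _ _
  · rw [ZSpan.fract_apply, sub_eq_add_neg]
    exact hf.add_lattice (neg_mem (ZSpan.floor (latticeBasis d) x).2) x

theorem IsProfile.continuous {d : ℕ} {η : Horiz d → ℝ} (hη : IsProfile η) : Continuous η :=
  hη.lipschitz.choose_spec.continuous

theorem IsProfile.exists_bound {d : ℕ} {η : Horiz d → ℝ} (hη : IsProfile η) : ∃ M : ℝ, 0 ≤ M ∧ ∀ x, |η x| ≤ M := by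
  have hc : IsCompact (closure (cell d)) := (isBounded_cell d).isCompact_closure
  obtain ⟨M, hM⟩ := hc.exists_bound_of_continuousOn hη.continuous.continuousOn
  refine ⟨max M 0, le_max_right _ _, fun x => ?_⟩
  obtain ⟨x₀, h1, h2⟩ := hη.periodic.exists_mem_cell x
  rw [← h2]
  exact (hM x₀ (subset_closure h1)).trans (le_max_left _ _)

theorem measurableSet_fluid {d : ℕ} {η : Horiz d → ℝ} (hη : Continuous η) (h : ℝ) :
    MeasurableSet (fluid h η) :=
  ((isOpen_lt continuous_const continuous_snd).inter
    (isOpen_lt continuous_snd (hη.comp continuous_fst))).measurableSet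

theorem fluidCell_eq {d : ℕ} (η : Horiz d → ℝ) (h : ℝ) :
    fluidCell h η = (cell d ×ˢ Set.univ) ∩ fluid h η := by
  ext p; simp [fluidCell]

theorem measurableSet_fluidCell {d : ℕ} {η : Horiz d → ℝ} (hη : Continuous η) (h : ℝ) :
    MeasurableSet (fluidCell h η) := by
  rw [fluidCell_eq]
  exact (measurableSet_column d).inter (measurableSet_fluid hη h)

theorem volume_fluidCell_lt_top {d : ℕ} {η : Horiz d → ℝ} {M : ℝ} (hM : ∀ x, |η x| ≤ M) (h : ℝ) :
    volume (fluidCell h η) < ⊤ := by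
  have h1 : fluidCell h η ⊆ cell d ×ˢ Set.Icc (-h) M := fun p hp =>
    ⟨hp.1, hp.2.1.le, hp.2.2.le.trans ((le_abs_self _).trans (hM _))⟩
  refine (measure_mono h1).trans_lt ?_
  rw [Measure.volume_eq_prod, Measure.prod_prod, volume_cell]
  exact ENNReal.mul_lt_top ENNReal.ofReal_lt_top (by simp)

/-- Admissible test functions for the weak gradient on the fluid domain. -/
structure IsTest {d : ℕ} (h : ℝ) (η : Horiz d → ℝ) (w : Horiz d × ℝ → ℝ) : Prop where
  periodic : HorizPeriodic w
  smooth : ContDiff ℝ ((⊤ : ℕ∞) : WithTop ℕ∞) w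
  supp : tsupport w ⊆ fluid h η

variable {d : ℕ} {h : ℝ} {η : Horiz d → ℝ} {w : Horiz d × ℝ → ℝ}

theorem IsTest.eq_zero (hw : IsTest h η w) {p : Horiz d × ℝ} (hp : p ∉ fluid h η) : w p = 0 :=
  image_eq_zero_of_notMem_tsupport fun hh => hp (hw.supp hh)

theorem IsTest.fderiv_eq_zero (hw : IsTest h η w) {p : Horiz d × ℝ} (hp : p ∉ fluid h η) :
    fderiv ℝ w p = 0 :=
  fderiv_of_notMem_tsupport ℝ fun hh => hp (hw.supp hh)

theorem notMem_fluid_of_lt {M : ℝ} (hM : ∀ x, |η x| ≤ M) {p : Horiz d × ℝ} (hp : max |h| M < |p.2|) :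
    p ∉ fluid h η := by
  rintro ⟨h1, h2⟩
  refine absurd hp (not_lt.2 (abs_le.2 ⟨?_, ?_⟩))
  · have := le_max_left |h| M
    have := le_abs_self h
    linarith
  · exact h2.le.trans ((le_abs_self _).trans ((hM _).trans (le_max_right _ _)))

theorem IsTest.continuous_fderiv (hw : IsTest h η w) : Continuous (fderiv ℝ w) :=
  hw.smooth.continuous_fderiv (by simp)

theorem IsTest.exists_bound (hw : IsTest h η w) {M : ℝ} (hM : ∀ x, |η x| ≤ M) :
    ∃ C : ℝ, 0 ≤ C ∧ ∀ p : Horiz d × ℝ, p.1 ∈ cell d → |w p| ≤ C ∧ ‖fderiv ℝ w p‖ ≤ C := by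
  obtain ⟨C1, h1, h1'⟩ := exists_bound_of_continuous hw.smooth.continuous
    fun p hp => hw.eq_zero (notMem_fluid_of_lt hM hp)
  obtain ⟨C2, h2, h2'⟩ := exists_bound_of_continuous hw.continuous_fderiv
    fun p hp => hw.fderiv_eq_zero (notMem_fluid_of_lt hM hp)
  exact ⟨max C1 C2, h1.trans (le_max_left _ _), fun p hp =>
    ⟨(h1' p hp).trans (le_max_left _ _), (h2' p hp).trans (le_max_right _ _)⟩⟩

theorem isFiniteMeasure_fluidCell {M : ℝ} (hM : ∀ x, |η x| ≤ M) (h : ℝ) :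
    IsFiniteMeasure ((volume : Measure (Horiz d × ℝ)).restrict (fluidCell h η)) :=
  ⟨by rw [Measure.restrict_apply_univ]; exact volume_fluidCell_lt_top hM h⟩

theorem IsTest.integrable_mul (hw : IsTest h η w) (hη : Continuous η) {M : ℝ} (hM : ∀ x, |η x| ≤ M)
    {u : Horiz d × ℝ → ℝ} (hu : MemLp u 2 (volume.restrict (fluidCell h η))) :
    IntegrableOn (fun p => u p * w p) (fluidCell h η) := by
  have := isFiniteMeasure_fluidCell hM h
  obtain ⟨C, -, hC⟩ := hw.exists_bound hM
  refine (hu.integrable one_le_two).mul_bdd (c := C) hw.smooth.continuous.aestronglyMeasurable ?_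
  exact (ae_restrict_iff' (measurableSet_fluidCell hη h)).2
    (Eventually.of_forall fun p hp => (hC p hp.1).1)

theorem IsTest.integrable_mul_fderiv (hw : IsTest h η w) (hη : Continuous η) {M : ℝ} (hM : ∀ x, |η x| ≤ M)
    {u : Horiz d × ℝ → ℝ} (hu : MemLp u 2 (volume.restrict (fluidCell h η))) (v : Horiz d × ℝ) :
    IntegrableOn (fun p => u p * fderiv ℝ w p v) (fluidCell h η) := by
  have := isFiniteMeasure_fluidCell hM h
  have hc := hw.continuous_fderiv
  obtain ⟨C, -, hC⟩ := hw.exists_bound hM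
  refine (hu.integrable one_le_two).mul_bdd (c := C * ‖v‖) (by fun_prop) ?_
  exact (ae_restrict_iff' (measurableSet_fluidCell hη h)).2
    (Eventually.of_forall fun p hp => (ContinuousLinearMap.le_opNorm _ _).trans
      (mul_le_mul_of_nonneg_right (hC p hp.1).2 (norm_nonneg _)))

theorem memLp_directional {ux : Horiz d × ℝ → Horiz d} {uy : Horiz d × ℝ → ℝ} {μ : Measure (Horiz d × ℝ)}
    (hx : MemLp ux 2 μ) (hy : MemLp uy 2 μ) (a : Horiz d) (b : ℝ) :
    MemLp (fun p => inner ℝ (ux p) a + uy p * b) 2 μ := by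
  have h1 : MemLp (fun p => inner ℝ (ux p) a) 2 μ :=
    (hx.norm.mul_const ‖a‖).mono (hx.1.inner aestronglyMeasurable_const)
      (Eventually.of_forall fun p => by
        simpa using abs_real_inner_le_norm (ux p) a)
  exact h1.add (hy.mul_const b)

/-- A locally Lipschitz function with square integrable gradient is in `H¹`. -/
theorem IsH1.of_locallyLipschitz {u : Horiz d × ℝ → ℝ} {ux : Horiz d × ℝ → Horiz d}
    {uy : Horiz d × ℝ → ℝ} (hη : Continuous η) {M : ℝ} (hM : ∀ x, |η x| ≤ M)
    (hp : HorizPeriodic u) (hpx : HorizPeriodic ux) (hpy : HorizPeriodic uy)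
    (hu : MemLp u 2 (volume.restrict (fluidCell h η))) (hux : MemLp ux 2 (volume.restrict (fluidCell h η)))
    (huy : MemLp uy 2 (volume.restrict (fluidCell h η))) (hl : LocallyLipschitz u)
    (hD : ∀ᵐ p, ∀ (a : Horiz d) (b : ℝ), HasLineDerivAt ℝ u (inner ℝ (ux p) a + uy p * b) p (a, b)) :
    IsH1 h η u ux uy := by
  refine ⟨hp, hpx, hpy, hu, hux, huy, fun w hwp hws hwt a b => ?_⟩
  have hw : IsTest h η w := ⟨hwp, hws, hwt⟩
  have hmul : LocallyLipschitz fun p => u p * w p := by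
    have h1 : LocallyLipschitz fun q : ℝ × ℝ => q.1 * q.2 :=
      (contDiff_fst.mul contDiff_snd : ContDiff ℝ 1 fun q : ℝ × ℝ => q.1 * q.2).locallyLipschitz
    exact h1.comp (hl.prodMk (hw.smooth.of_le (by exact_mod_cast le_top) : ContDiff ℝ 1 w).locallyLipschitz)
  have hmp : HorizPeriodic fun p => u p * w p := fun y i x => by
    have h1 := hp y i x
    have h2 := hwp y i x
    simp only at h1 h2 ⊢
    rw [h1, h2]
  have hder : ∀ᵐ p, HasLineDerivAt ℝ (fun p => u p * w p)
      (u p * fderiv ℝ w p (a, b) + (inner ℝ (ux p) a + uy p * b) * w p) p (a, b) := by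
    filter_upwards [hD] with p hpD
    have h1 := hpD a b
    have h2 : HasLineDerivAt ℝ w (fderiv ℝ w p (a, b)) p (a, b) :=
      ((hw.smooth.differentiable (by simp)) p).hasFDerivAt.hasLineDerivAt _
    have h3 := HasDerivAt.mul h1 h2
    simp only [zero_smul, add_zero] at h3
    rw [add_comm]
    exact h3
  -- Integration by parts for a product that vanishes off the fluid, so that no boundary term
  -- appears and no smoothness of the surface is used.
  have hz := setIntegral_column_lineDeriv hmp hmul
    (fun p hh => by rw [hw.eq_zero (notMem_fluid_of_lt hM hh), mul_zero]) (a, b) hder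
  have hsub : fluidCell h η ⊆ cell d ×ˢ Set.univ := by rw [fluidCell_eq]; exact Set.inter_subset_left
  rw [setIntegral_eq_of_subset_of_forall_sdiff_eq_zero (measurableSet_column d) hsub,
    integral_add (hw.integrable_mul_fderiv hη hM hu _)
      (hw.integrable_mul hη hM (memLp_directional hux huy a b))] at hz
  · linarith
  · rintro p ⟨h1, h2⟩
    have h3 : p ∉ fluid h η := fun hh => h2 (by rw [fluidCell_eq]; exact ⟨h1, hh⟩)
    rw [hw.eq_zero h3, hw.fderiv_eq_zero h3]
    simp

theorem HorizPeriodic.sub {F : Type*} [Sub F] {u v : Horiz d × ℝ → F} (hu : HorizPeriodic u)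
    (hv : HorizPeriodic v) : HorizPeriodic fun p => u p - v p := fun y i x => by
  have h1 := hu y i x
  have h2 := hv y i x
  simp only at h1 h2 ⊢
  rw [h1, h2]

theorem IsH1.sub {u v : Horiz d × ℝ → ℝ} {ux vx : Horiz d × ℝ → Horiz d} {uy vy : Horiz d × ℝ → ℝ}
    (hη : Continuous η) {M : ℝ} (hM : ∀ x, |η x| ≤ M) (hu : IsH1 h η u ux uy) (hv : IsH1 h η v vx vy) :
    IsH1 h η (fun p => u p - v p) (fun p => ux p - vx p) (fun p => uy p - vy p) := by
  refine ⟨hu.periodic.sub hv.periodic, hu.periodic_x.sub hv.periodic_x, hu.periodic_y.sub hv.periodic_y,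
    hu.memLp.sub hv.memLp, hu.memLp_x.sub hv.memLp_x, hu.memLp_y.sub hv.memLp_y,
    fun w hwp hws hwt a b => ?_⟩
  have hw : IsTest h η w := ⟨hwp, hws, hwt⟩
  have e1 : ∀ p, (u p - v p) * fderiv ℝ w p (a, b) = u p * fderiv ℝ w p (a, b) - v p * fderiv ℝ w p (a, b) :=
    fun p => by ring
  have e2 : ∀ p, (inner ℝ (ux p - vx p) a + (uy p - vy p) * b) * w p =
      (inner ℝ (ux p) a + uy p * b) * w p - (inner ℝ (vx p) a + vy p * b) * w p := fun p => by
    rw [inner_sub_left]; ring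
  simp_rw [e1, e2]
  rw [integral_sub (hw.integrable_mul_fderiv hη hM hu.memLp _) (hw.integrable_mul_fderiv hη hM hv.memLp _),
    integral_sub (hw.integrable_mul hη hM (memLp_directional hu.memLp_x hu.memLp_y a b))
      (hw.integrable_mul hη hM (memLp_directional hv.memLp_x hv.memLp_y a b)),
    hu.weak w hwp hws hwt, hv.weak w hwp hws hwt]
  ring

theorem enorm_sub_sq_le {F : Type*} [NormedAddCommGroup F] (a b : F) :
    ‖a - b‖ₑ ^ 2 ≤ 2 * ‖a‖ₑ ^ 2 + 2 * ‖b‖ₑ ^ 2 := by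
  have h1 : ‖a - b‖ ^ 2 ≤ 2 * ‖a‖ ^ 2 + 2 * ‖b‖ ^ 2 := by
    have := norm_sub_le a b
    nlinarith [norm_nonneg (a - b), sq_nonneg (‖a‖ - ‖b‖), norm_nonneg a, norm_nonneg b]
  have h2 : ∀ c : F, ‖c‖ₑ ^ 2 = ENNReal.ofReal (‖c‖ ^ 2) := fun c => by
    rw [← ofReal_norm, ENNReal.ofReal_pow (norm_nonneg _)]
  rw [h2, h2, h2, ← ENNReal.ofReal_ofNat 2, ← ENNReal.ofReal_mul (by norm_num),
    ← ENNReal.ofReal_mul (by norm_num), ← ENNReal.ofReal_add (by positivity) (by positivity)]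
  exact ENNReal.ofReal_le_ofReal h1

/-- From |a - b|² ≤ 2|a|² + 2|b|². Measurability of one of the two squares suffices to split the
lower integral of the sum. -/
theorem HasGraphTrace.sub {F : Type*} [NormedAddCommGroup F] {γ : Horiz d → ℝ} {σ : ℝ}
    {u v : Horiz d × ℝ → F} {f g : Horiz d → F} (hu : HasGraphTrace γ σ u f) (hv : HasGraphTrace γ σ v g)
    (hm : ∀ᶠ ε in 𝓝[>] (0 : ℝ), AEMeasurable (fun p : Horiz d × ℝ => ‖v (p.1, γ p.1 + σ * p.2) - g p.1‖ₑ ^ 2)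
      (volume.restrict (cell d ×ˢ Set.Ioo 0 ε))) :
    HasGraphTrace γ σ (fun p => u p - v p) (fun x => f x - g x) := by
  unfold HasGraphTrace at *
  have h0 := (ENNReal.Tendsto.const_mul hu (Or.inr (by simp : (2 : ENNReal) ≠ ⊤))).add
    (ENNReal.Tendsto.const_mul hv (Or.inr (by simp : (2 : ENNReal) ≠ ⊤)))
  rw [mul_zero, add_zero] at h0
  refine tendsto_of_tendsto_of_tendsto_of_le_of_le' tendsto_const_nhds h0
    (Eventually.of_forall fun _ => zero_le) ?_
  filter_upwards [hm] with ε hε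
  calc _ ≤ ENNReal.ofReal ε⁻¹ * ∫⁻ p in (cell d) ×ˢ (Set.Ioo (0 : ℝ) ε),
        (2 * ‖u (p.1, γ p.1 + σ * p.2) - f p.1‖ₑ ^ 2 + 2 * ‖v (p.1, γ p.1 + σ * p.2) - g p.1‖ₑ ^ 2) := by
        gcongr with p
        rw [sub_sub_sub_comm]
        exact enorm_sub_sq_le _ _
    _ = _ := by
        rw [lintegral_add_right' _ (hε.const_mul _), lintegral_const_mul' _ _ (by simp),
          lintegral_const_mul' _ _ (by simp)]
        ring

end

/-! ### The harmonic extension to the half-space, and its reflection below the surface. -/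

section

variable {d : ℕ} {h : ℝ} {η : Horiz d → ℝ}

theorem enorm_sq_eq_ofReal {F : Type*} [NormedAddCommGroup F] (a : F) :
    ‖a‖ₑ ^ 2 = ENNReal.ofReal (‖a‖ ^ 2) := by
  rw [← ofReal_norm, ENNReal.ofReal_pow (norm_nonneg _)]

theorem memLp_two_iff {α F : Type*} [MeasurableSpace α] [NormedAddCommGroup F] {μ : Measure α} {f : α → F} :
    MemLp f 2 μ ↔ AEStronglyMeasurable f μ ∧ ∫⁻ x, ‖f x‖ₑ ^ 2 ∂μ < ⊤ := by
  unfold MemLp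
  rw [eLpNorm_lt_top_iff_lintegral_rpow_enorm_lt_top (by norm_num) (by norm_num)]
  simp

theorem lintegral_enorm_sq {α F : Type*} [MeasurableSpace α] [NormedAddCommGroup F] {μ : Measure α} {f : α → F}
    (hf : MemLp f 2 μ) : ∫⁻ x, ‖f x‖ₑ ^ 2 ∂μ = ENNReal.ofReal (∫ x, ‖f x‖ ^ 2 ∂μ) := by
  rw [ofReal_integral_eq_lintegral_ofReal hf.norm.integrable_sq (Eventually.of_forall fun x => by positivity)]
  simp_rw [enorm_sq_eq_ofReal]

theorem two_pi_pow_pos (d : ℕ) : (0 : ℝ) < (2 * Real.pi) ^ d := by positivity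

/-- Parseval's identity, in extended nonnegative reals. -/
theorem lintegral_sq_eq {f : Horiz d → ℂ} (hf : MemLp f 2 (volume.restrict (cell d))) :
    ∫⁻ x in cell d, ‖f x‖ₑ ^ 2 = ENNReal.ofReal ((2 * Real.pi) ^ d) * ∑' ξ, ‖fc f ξ‖ₑ ^ 2 := by
  have h1 := hasSum_sq_fc hf
  have h2 := two_pi_pow_pos d
  rw [lintegral_enorm_sq hf]
  simp_rw [enorm_sq_eq_ofReal]
  rw [← ENNReal.ofReal_tsum_of_nonneg (fun ξ => by positivity) h1.summable, h1.tsum_eq,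
    ← ENNReal.ofReal_mul h2.le, mul_inv_cancel_left₀ h2.ne']

/-- Coefficients of at most linear growth. -/
def Tempered (m : (Fin d → ℤ) → ℂ) : Prop := ∃ B : ℝ, 0 ≤ B ∧ ∀ ξ, ‖m ξ‖ ≤ B * (1 + freqNorm ξ)

/-- The coefficients `m_ξ e^{-|ξ| s}`. -/
def damp (m : (Fin d → ℤ) → ℂ) (s : ℝ) (ξ : Fin d → ℤ) : ℂ := m ξ * (Real.exp (-s * freqNorm ξ) : ℂ)

theorem norm_damp (m : (Fin d → ℤ) → ℂ) (s : ℝ) (ξ : Fin d → ℤ) :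
    ‖damp m s ξ‖ = ‖m ξ‖ * Real.exp (-s * freqNorm ξ) := by
  rw [damp, norm_mul, Complex.norm_of_nonneg (Real.exp_pos _).le]

theorem Tempered.summable_damp {m : (Fin d → ℤ) → ℂ} (hm : Tempered m) {s : ℝ} (hs : 0 < s) :
    Summable fun ξ => ‖damp m s ξ‖ := by
  obtain ⟨B, hB, hm⟩ := hm
  refine Summable.of_nonneg_of_le (fun _ => norm_nonneg _) (fun ξ => ?_)
    ((summable_mul_exp_neg_freqNorm d hs).mul_left B)
  rw [norm_damp, ← mul_assoc]
  exact mul_le_mul_of_nonneg_right (hm ξ) (Real.exp_pos _).le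

/-- The real part of the harmonic extension to `s > 0` of the trigonometric series with
coefficients `m`. -/
def harmExt (m : (Fin d → ℤ) → ℂ) (p : Horiz d × ℝ) : ℝ :=
  if 0 < p.2 then (trigSeries (damp m p.2) p.1).re else 0

/-- One mode of the harmonic extension. -/
def mode (m : (Fin d → ℤ) → ℂ) (ξ : Fin d → ℤ) (p : Horiz d × ℝ) : ℝ :=
  (m ξ * expo ξ p.1).re * Real.exp (-p.2 * freqNorm ξ)

theorem continuous_mode (m : (Fin d → ℤ) → ℂ) (ξ : Fin d → ℤ) : Continuous (mode m ξ) := by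
  unfold mode
  have := continuous_expo ξ
  fun_prop

theorem hasSum_mode {m : (Fin d → ℤ) → ℂ} (hm : Tempered m) {p : Horiz d × ℝ} (hp : 0 < p.2) :
    HasSum (fun ξ => mode m ξ p) (harmExt m p) := by
  rw [harmExt, if_pos hp]
  refine (Complex.hasSum_re (hasSum_trigSeries (hm.summable_damp hp) p.1)).congr_fun fun ξ => ?_
  rw [mode, damp, mul_right_comm, Complex.re_mul_ofReal]

theorem abs_mode_le (m : (Fin d → ℤ) → ℂ) (ξ : Fin d → ℤ) (p : Horiz d × ℝ) :
    |mode m ξ p| ≤ ‖damp m p.2 ξ‖ := by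
  rw [mode, norm_damp, abs_mul, abs_of_pos (Real.exp_pos _)]
  refine mul_le_mul_of_nonneg_right ((Complex.abs_re_le_norm _).trans ?_) (Real.exp_pos _).le
  rw [norm_mul, norm_expo, mul_one]

/-- A pointwise limit of finite sums of modes; extending by 0 to s ≤ 0 makes this hold on the whole
space. -/
theorem measurable_harmExt {m : (Fin d → ℤ) → ℂ} (hm : Tempered m) : Measurable (harmExt m) := by
  have hs : MeasurableSet {p : Horiz d × ℝ | 0 < p.2} := (isOpen_lt continuous_const continuous_snd).measurableSet
  refine measurable_of_tendsto_metrizable' (ι := Finset (Fin d → ℤ)) atTop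
    (f := fun F p => ∑ ξ ∈ F, if 0 < p.2 then mode m ξ p else 0) (fun F => ?_) (tendsto_pi_nhds.2 fun p => ?_)
  · exact Finset.measurable_fun_sum _ fun ξ _ => Measurable.ite hs (continuous_mode m ξ).measurable measurable_const
  · by_cases hp : 0 < p.2
    · simp only [hp, if_true]
      exact hasSum_mode hm hp
    · simp [harmExt, hp]

/-- Parseval for the complex series at height s; passing to the real part can only decrease the
norm. -/
theorem lintegral_cell_harmExt_le {m : (Fin d → ℤ) → ℂ} (hm : Tempered m) {s : ℝ} (hs : 0 < s) :
    ∫⁻ x in cell d, ‖harmExt m (x, s)‖ₑ ^ 2 ≤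
      ENNReal.ofReal ((2 * Real.pi) ^ d) * ∑' ξ, ‖m ξ‖ₑ ^ 2 * ENNReal.ofReal (Real.exp (-(2 * freqNorm ξ) * s)) := by
  have h1 := hm.summable_damp hs
  have h2 : ∀ ξ, ‖m ξ‖ₑ ^ 2 * ENNReal.ofReal (Real.exp (-(2 * freqNorm ξ) * s)) = ‖fc (trigSeries (damp m s)) ξ‖ₑ ^ 2 := by
    intro ξ
    rw [fc_trigSeries h1, enorm_sq_eq_ofReal, enorm_sq_eq_ofReal, ← ENNReal.ofReal_mul (by positivity), norm_damp,
      mul_pow, ← Real.exp_nat_mul]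
    congr 3
    push_cast; ring
  simp_rw [h2]
  rw [← lintegral_sq_eq (memLp_trigSeries h1)]
  refine lintegral_mono fun x => ?_
  rw [enorm_sq_eq_ofReal, enorm_sq_eq_ofReal]
  refine ENNReal.ofReal_le_ofReal (pow_le_pow_left₀ (norm_nonneg _) ?_ 2)
  simp only [harmExt, hs, if_true]
  exact Complex.abs_re_le_norm _

theorem lintegral_cell_prod {s : Set ℝ} {f : Horiz d × ℝ → ENNReal}
    (hf : AEMeasurable f (volume.restrict (cell d ×ˢ s))) :
    ∫⁻ p in cell d ×ˢ s, f p = ∫⁻ y in s, ∫⁻ x in cell d, f (x, y) := by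
  rw [Measure.volume_eq_prod, ← Measure.prod_restrict] at hf ⊢
  rw [lintegral_prod_symm _ hf]

theorem lintegral_prod_harmExt_le {m : (Fin d → ℤ) → ℂ} (hm : Tempered m) {s : Set ℝ} (hs : MeasurableSet s)
    (hs0 : s ⊆ Set.Ioi 0) :
    ∫⁻ p in cell d ×ˢ s, ‖harmExt m p‖ₑ ^ 2 ≤ ENNReal.ofReal ((2 * Real.pi) ^ d) *
      ∑' ξ, ‖m ξ‖ₑ ^ 2 * ∫⁻ y in s, ENNReal.ofReal (Real.exp (-(2 * freqNorm ξ) * y)) := by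
  rw [lintegral_cell_prod ((measurable_harmExt hm).enorm.pow_const 2).aemeasurable]
  calc _ ≤ ∫⁻ y in s, ENNReal.ofReal ((2 * Real.pi) ^ d) *
        ∑' ξ, ‖m ξ‖ₑ ^ 2 * ENNReal.ofReal (Real.exp (-(2 * freqNorm ξ) * y)) :=
        setLIntegral_mono' hs fun y hy => lintegral_cell_harmExt_le hm (hs0 hy)
    _ = _ := by
        rw [lintegral_const_mul' _ _ ENNReal.ofReal_ne_top, lintegral_tsum]
        · congr 2
          funext ξ
          rw [lintegral_const_mul' _ _ (by simp)]
        · intro ξ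
          fun_prop

theorem lintegral_exp_Ioi {κ : ℝ} (hκ : 0 < κ) :
    ∫⁻ y in Set.Ioi (0 : ℝ), ENNReal.ofReal (Real.exp (-κ * y)) = ENNReal.ofReal κ⁻¹ := by
  rw [← ofReal_integral_eq_lintegral_ofReal]
  · rw [integral_exp_mul_Ioi (neg_lt_zero.2 hκ)]
    simp
  · exact exp_neg_integrableOn_Ioi 0 hκ
  · exact Eventually.of_forall fun y => (Real.exp_pos _).le

/-- The reflection `(x, y) ↦ (x, η(x) - y)`. -/
def flip (η : Horiz d → ℝ) (p : Horiz d × ℝ) : Horiz d × ℝ := (p.1, η p.1 - p.2)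

theorem measurePreserving_flip (hη : Continuous η) : MeasurePreserving (flip η) volume volume := by
  rw [Measure.volume_eq_prod]
  refine MeasurePreserving.skew_product (g := fun x y => η x - y) (MeasurePreserving.id _) ?_ ?_
  · unfold Function.uncurry; fun_prop
  · exact Eventually.of_forall fun x => (Measure.measurePreserving_sub_left volume (η x)).map_eq

/-- The reflection preserves volume, since on each vertical line it is a reflection, and it maps the
fluid cell into a flat slab on which Parseval can be used height by height. -/
theorem lintegral_fluidCell_flip_le (hη : Continuous η) {M : ℝ} (hM : ∀ x, |η x| ≤ M) {f : Horiz d × ℝ → ENNReal}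
    (hf : Measurable f) : ∫⁻ p in fluidCell h η, f (flip η p) ≤ ∫⁻ p in cell d ×ˢ Set.Ioo 0 (M + h), f p := by
  rw [← (measurePreserving_flip hη).setLIntegral_comp_preimage
    ((measurableSet_cell d).prod measurableSet_Ioo) hf]
  refine lintegral_mono_set fun p hp => ⟨hp.1, ?_, ?_⟩
  · exact sub_pos.2 hp.2.2
  · have h1 := hp.2.1
    have h2 := (le_abs_self _).trans (hM p.1)
    change η p.1 - p.2 < M + h
    linarith

/-- A bound that is linear in the distance to the graph gives the trace. -/
theorem HasGraphTrace.of_lintegral_le {F : Type*} [NormedAddCommGroup F] {γ : Horiz d → ℝ} {σ : ℝ}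
    {u : Horiz d × ℝ → F} {g : Horiz d → F} {A s₀ : ℝ} (hs₀ : 0 < s₀)
    (hm : AEMeasurable (fun p : Horiz d × ℝ => ‖u (p.1, γ p.1 + σ * p.2) - g p.1‖ₑ ^ 2)
      (volume.restrict (cell d ×ˢ Set.Ioo 0 s₀)))
    (hb : ∀ᵐ s, s ∈ Set.Ioo 0 s₀ → ∫⁻ x in cell d, ‖u (x, γ x + σ * s) - g x‖ₑ ^ 2 ≤ ENNReal.ofReal (A * s)) :
    HasGraphTrace γ σ u g := by
  have hlim : Tendsto (fun ε : ℝ => ENNReal.ofReal (|A| * ε)) (𝓝[>] 0) (𝓝 0) := by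
    have h1 : Tendsto (fun ε : ℝ => ENNReal.ofReal (|A| * ε)) (𝓝 0) (𝓝 (ENNReal.ofReal (|A| * 0))) :=
      (ENNReal.continuous_ofReal.comp (continuous_const.mul continuous_id)).tendsto 0
    simp only [mul_zero, ENNReal.ofReal_zero] at h1
    exact h1.mono_left nhdsWithin_le_nhds
  refine tendsto_of_tendsto_of_tendsto_of_le_of_le' tendsto_const_nhds hlim
    (Eventually.of_forall fun _ => zero_le) ?_
  filter_upwards [Ioo_mem_nhdsGT hs₀] with ε hε
  rw [lintegral_cell_prod (hm.mono_set (Set.prod_mono_right (Set.Ioo_subset_Ioo_right hε.2.le)))]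
  calc _ ≤ ENNReal.ofReal ε⁻¹ * ∫⁻ _ in Set.Ioo 0 ε, ENNReal.ofReal (|A| * ε) := by
        gcongr 1
        refine lintegral_mono_ae ?_
        refine (ae_restrict_iff' measurableSet_Ioo).2 ?_
        filter_upwards [hb] with s hs hs2
        refine (hs ⟨hs2.1, hs2.2.trans hε.2⟩).trans (ENNReal.ofReal_le_ofReal ?_)
        exact mul_le_mul (le_abs_self _) hs2.2.le hs2.1.le (abs_nonneg _)
    _ = _ := by
        rw [setLIntegral_const, Real.volume_Ioo, sub_zero, mul_comm, mul_assoc,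
          ← ENNReal.ofReal_mul hε.1.le, mul_inv_cancel₀ hε.1.ne', ENNReal.ofReal_one, mul_one]

end

/-! ### Single modes below a Lipschitz surface. -/

section

variable {d : ℕ} {h : ℝ} {η : Horiz d → ℝ}

theorem pairing_add (ξ : Fin d → ℤ) (x y : Horiz d) : pairing ξ (x + y) = pairing ξ x + pairing ξ y := by
  simp [pairing, add_mul, Finset.sum_add_distrib]

theorem pairing_smul (ξ : Fin d → ℤ) (t : ℝ) (x : Horiz d) : pairing ξ (t • x) = t * pairing ξ x := by
  simp [pairing, Finset.mul_sum, mul_assoc]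

theorem pairing_single (ξ : Fin d → ℤ) (i : Fin d) (t : ℝ) :
    pairing ξ (EuclideanSpace.single i t) = t * ξ i := by
  simp [pairing]

theorem expo_periodic (ξ : Fin d → ℤ) : TorusPeriodic (expo ξ) := fun i x => by
  unfold expo
  rw [pairing_add, pairing_single]
  push_cast
  rw [mul_add, Complex.exp_add]
  have : Complex.I * (2 * (Real.pi : ℂ) * (ξ i : ℂ)) = (ξ i : ℂ) * (2 * Real.pi * Complex.I) := by ring
  rw [this, Complex.exp_int_mul_two_pi_mul_I, mul_one]

theorem trigSeries_periodic (c : (Fin d → ℤ) → ℂ) : TorusPeriodic (trigSeries c) := fun i x => by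
  unfold trigSeries
  simp_rw [expo_periodic _ i x]

theorem IsProfile.gradient_periodic (hη : IsProfile η) : TorusPeriodic (gradient η) := fun i x => by
  unfold gradient
  rw [← fderiv_comp_add_right]
  congr 2
  funext y
  exact hη.periodic i y

theorem measurable_gradient (η : Horiz d → ℝ) : Measurable (gradient η) := by
  unfold gradient
  exact (LinearIsometryEquiv.continuous _).measurable.comp (measurable_fderiv ℝ η)

theorem norm_gradient_eq (x : Horiz d) : ‖gradient η x‖ = ‖fderiv ℝ η x‖ := by
  unfold gradient
  exact LinearIsometryEquiv.norm_map _ _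

theorem IsProfile.exists_gradient_bound (hη : IsProfile η) : ∃ K : ℝ, 0 ≤ K ∧ ∀ x, ‖gradient η x‖ ≤ K := by
  obtain ⟨K, hK⟩ := hη.lipschitz
  refine ⟨K, K.2, fun x => ?_⟩
  rw [norm_gradient_eq]
  exact norm_fderiv_le_of_lipschitz ℝ hK

theorem gradSupNorm_nonneg (η : Horiz d → ℝ) : 0 ≤ gradSupNorm η := ENNReal.toReal_nonneg

/-- The essential supremum bounds the gradient only almost everywhere. It enters the final constant,
whereas the everywhere bound of `IsProfile.exists_gradient_bound` serves qualitative purposes. -/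
theorem IsProfile.ae_gradient_le (hη : IsProfile η) : ∀ᵐ x, ‖gradient η x‖ ≤ gradSupNorm η := by
  obtain ⟨K, -, hK⟩ := hη.exists_gradient_bound
  have hfin : eLpNorm (fun x => gradient η x) ⊤ volume ≠ ⊤ :=
    (memLp_top_of_bound (measurable_gradient η).aestronglyMeasurable K (Eventually.of_forall hK)).2.ne
  have := ae_le_eLpNormEssSup (f := fun x => gradient η x) (μ := volume)
  filter_upwards [this] with x hx
  rw [gradSupNorm, ← toReal_enorm]
  rw [eLpNorm_exponent_top] at hfin ⊢
  exact ENNReal.toReal_mono hfin hx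

/-- Rademacher's theorem; one null set serves all directions. -/
theorem IsProfile.ae_hasLineDerivAt (hη : IsProfile η) :
    ∀ᵐ x, ∀ a, HasLineDerivAt ℝ η (inner ℝ (gradient η x) a) x a := by
  obtain ⟨K, hK⟩ := hη.lipschitz
  filter_upwards [hK.ae_differentiableAt (μ := volume)] with x hx a
  have := hx.hasGradientAt.hasFDerivAt.hasLineDerivAt a
  simpa using this

/-- Coefficients of the normal derivative. -/
def normalCoeff (c : (Fin d → ℤ) → ℂ) (ξ : Fin d → ℤ) : ℂ := (freqNorm ξ : ℂ) * c ξ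

/-- Coefficients of the derivative in the direction `j`. -/
def dirCoeff (c : (Fin d → ℤ) → ℂ) (j : Fin d) (ξ : Fin d → ℤ) : ℂ := Complex.I * ξ j * c ξ

theorem norm_normalCoeff (c : (Fin d → ℤ) → ℂ) (ξ : Fin d → ℤ) : ‖normalCoeff c ξ‖ = freqNorm ξ * ‖c ξ‖ := by
  rw [normalCoeff, norm_mul, Complex.norm_of_nonneg (freqNorm_nonneg ξ)]

theorem norm_dirCoeff (c : (Fin d → ℤ) → ℂ) (j : Fin d) (ξ : Fin d → ℤ) :
    ‖dirCoeff c j ξ‖ = |(ξ j : ℝ)| * ‖c ξ‖ := by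
  rw [dirCoeff, norm_mul, norm_mul, Complex.norm_I, one_mul, Complex.norm_intCast]

theorem sum_norm_dirCoeff_sq (c : (Fin d → ℤ) → ℂ) (ξ : Fin d → ℤ) :
    ∑ j, ‖dirCoeff c j ξ‖ ^ 2 = freqNorm ξ ^ 2 * ‖c ξ‖ ^ 2 := by
  simp_rw [norm_dirCoeff, mul_pow, sq_abs]
  rw [← Finset.sum_mul, freqNorm_sq]

theorem norm_dirCoeff_le (c : (Fin d → ℤ) → ℂ) (j : Fin d) (ξ : Fin d → ℤ) :
    ‖dirCoeff c j ξ‖ ≤ freqNorm ξ * ‖c ξ‖ := by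
  rw [norm_dirCoeff]
  exact mul_le_mul_of_nonneg_right (abs_le_freqNorm ξ j) (norm_nonneg _)

section Bounded

variable {c : (Fin d → ℤ) → ℂ} {B : ℝ}

theorem Tempered.of_bounded (hc : ∀ ξ, ‖c ξ‖ ≤ B) : Tempered c :=
  ⟨B, (norm_nonneg _).trans (hc 0), fun ξ => by
    have := (norm_nonneg _).trans (hc 0)
    nlinarith [hc ξ, freqNorm_nonneg ξ]⟩

theorem Tempered.of_norm_le {m : (Fin d → ℤ) → ℂ} (hc : ∀ ξ, ‖c ξ‖ ≤ B) (hm : ∀ ξ, ‖m ξ‖ ≤ freqNorm ξ * ‖c ξ‖) :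
    Tempered m :=
  ⟨B, (norm_nonneg _).trans (hc 0), fun ξ => by
    have := (norm_nonneg _).trans (hc 0)
    nlinarith [hc ξ, freqNorm_nonneg ξ, hm ξ]⟩

theorem Tempered.normalCoeff (hc : ∀ ξ, ‖c ξ‖ ≤ B) : Tempered (normalCoeff c) :=
  Tempered.of_norm_le hc fun ξ => (norm_normalCoeff c ξ).le

theorem Tempered.dirCoeff (hc : ∀ ξ, ‖c ξ‖ ≤ B) (j : Fin d) : Tempered (dirCoeff c j) :=
  Tempered.of_norm_le hc fun ξ => norm_dirCoeff_le c j ξ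

end Bounded

/-- The horizontal gradient of one mode, composed with the reflection. -/
def modeX (η : Horiz d → ℝ) (c : (Fin d → ℤ) → ℂ) (ξ : Fin d → ℤ) (p : Horiz d × ℝ) : Horiz d :=
  WithLp.toLp 2 (fun j => mode (dirCoeff c j) ξ (flip η p)) - mode (normalCoeff c) ξ (flip η p) • gradient η p.1

theorem mode_flip_periodic (hη : IsProfile η) (m : (Fin d → ℤ) → ℂ) (ξ : Fin d → ℤ) :
    HorizPeriodic fun p => mode m ξ (flip η p) := fun y i x => by
  simp only [mode, flip]
  rw [expo_periodic ξ i x, hη.periodic i x]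

theorem modeX_periodic (hη : IsProfile η) (c : (Fin d → ℤ) → ℂ) (ξ : Fin d → ℤ) :
    HorizPeriodic (modeX η c ξ) := fun y i x => by
  have h1 := fun m => mode_flip_periodic hη m ξ y i x
  have h2 := hη.gradient_periodic i x
  simp only [modeX] at h1 ⊢
  simp_rw [h1]
  rw [h2]

theorem contDiff_mode (m : (Fin d → ℤ) → ℂ) (ξ : Fin d → ℤ) : ContDiff ℝ 1 (mode m ξ) := by
  unfold mode
  have h1 : ContDiff ℝ 1 fun p : Horiz d × ℝ => ((pairing ξ p.1 : ℝ) : ℂ) := by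
    have h0 : ContDiff ℝ 1 fun p : Horiz d × ℝ => pairing ξ p.1 := by
      unfold pairing
      fun_prop
    exact Complex.ofRealCLM.contDiff.comp h0
  have h2 : ContDiff ℝ 1 fun p : Horiz d × ℝ => m ξ * expo ξ p.1 :=
    contDiff_const.mul (contDiff_const.mul h1).cexp
  exact (Complex.reCLM.contDiff.comp h2).mul (contDiff_snd.neg.mul contDiff_const).exp

/-- The reflection is only Lipschitz, like η, so the composition cannot be treated as smooth; local
Lipschitz continuity is what `IsH1.of_locallyLipschitz` asks for. -/
theorem locallyLipschitz_mode_flip (hη : IsProfile η) (m : (Fin d → ℤ) → ℂ) (ξ : Fin d → ℤ) :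
    LocallyLipschitz fun p => mode m ξ (flip η p) := by
  obtain ⟨K, hK⟩ := hη.lipschitz
  have h1 : LipschitzWith (K * 1 + 1) fun p : Horiz d × ℝ => η p.1 - p.2 :=
    (hK.comp LipschitzWith.prod_fst).sub LipschitzWith.prod_snd
  exact (contDiff_mode m ξ).locallyLipschitz.comp
    (LipschitzWith.prod_fst.locallyLipschitz.prodMk h1.locallyLipschitz)

/-- The chain rule for e^{ix·ξ} e^{-|ξ|(η(x) - y)}: differentiating in y gives +|ξ|, and
differentiating in x gives iξ - |ξ|∇η. Only the derivative of η in the direction a is used. -/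
theorem hasLineDerivAt_mode_flip {c : (Fin d → ℤ) → ℂ} {ξ : Fin d → ℤ} {p : Horiz d × ℝ} {a : Horiz d} {b : ℝ}
    (hg : HasLineDerivAt ℝ η (inner ℝ (gradient η p.1) a) p.1 a) :
    HasLineDerivAt ℝ (fun p => mode c ξ (flip η p))
      (inner ℝ (modeX η c ξ p) a + mode (normalCoeff c) ξ (flip η p) * b) p (a, b) := by
  have h1 : HasDerivAt (fun t : ℝ => c ξ * expo ξ (p.1 + t • a))
      (c ξ * (expo ξ p.1 * (Complex.I * pairing ξ a))) 0 := by
    have e : ∀ t : ℝ, expo ξ (p.1 + t • a) =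
        Complex.exp (Complex.I * pairing ξ p.1 + (t : ℂ) * (Complex.I * pairing ξ a)) := fun t => by
      rw [expo, pairing_add, pairing_smul]; push_cast; ring_nf
    simp_rw [e]
    have h2 : HasDerivAt (fun t : ℝ => Complex.I * pairing ξ p.1 + (t : ℂ) * (Complex.I * pairing ξ a))
        (1 * (Complex.I * pairing ξ a)) 0 :=
      ((Complex.ofRealCLM.hasDerivAt (x := (0 : ℝ))).mul_const _).const_add _
    have h3 := (h2.cexp).const_mul (c ξ)
    simpa [expo] using h3
  have h2 : HasDerivAt (fun t : ℝ => (c ξ * expo ξ (p.1 + t • a)).re)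
      (c ξ * (expo ξ p.1 * (Complex.I * pairing ξ a))).re 0 :=
    (Complex.reCLM.hasFDerivAt.comp_hasDerivAt (0 : ℝ) h1)
  have h3 : HasDerivAt (fun t : ℝ => Real.exp (-(η (p.1 + t • a) - (p.2 + t * b)) * freqNorm ξ))
      (Real.exp (-(η p.1 - p.2) * freqNorm ξ) * (-(inner ℝ (gradient η p.1) a - b) * freqNorm ξ)) 0 := by
    have h4 : HasDerivAt (fun t : ℝ => p.2 + t * b) b 0 := by
      simpa using ((hasDerivAt_id (0 : ℝ)).mul_const b).const_add p.2
    have h5 := (((HasDerivAt.sub hg h4).neg).mul_const (freqNorm ξ)).exp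
    simpa using h5
  have h4 := h2.mul h3
  have e1 : ∀ t : ℝ, mode c ξ (flip η (p + t • (a, b))) = (c ξ * expo ξ (p.1 + t • a)).re *
      Real.exp (-(η (p.1 + t • a) - (p.2 + t * b)) * freqNorm ξ) := fun t => rfl
  unfold HasLineDerivAt
  simp_rw [e1]
  refine h4.congr_deriv ?_
  simp only [zero_smul, add_zero, zero_mul]
  have e2 : inner ℝ (modeX η c ξ p) a = (c ξ * (expo ξ p.1 * (Complex.I * pairing ξ a))).re *
      Real.exp (-(η p.1 - p.2) * freqNorm ξ) - mode (normalCoeff c) ξ (flip η p) * inner ℝ (gradient η p.1) a := by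
    rw [modeX, inner_sub_left, inner_smul_left]
    simp only [conj_trivial]
    congr 1
    rw [PiLp.inner_apply]
    simp only [mode, dirCoeff, flip, pairing]
    push_cast
    simp only [Finset.mul_sum, Complex.re_sum, Finset.sum_mul]
    refine Finset.sum_congr rfl fun j _ => ?_
    have : c ξ * (expo ξ p.1 * (Complex.I * ((a j : ℂ) * (ξ j : ℂ)))) =
        (Complex.I * ξ j * c ξ * expo ξ p.1) * ((a j : ℝ) : ℂ) := by ring
    rw [this, Complex.re_mul_ofReal]
    simp
    ring
  have e3 : mode (normalCoeff c) ξ (flip η p) =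
      freqNorm ξ * ((c ξ * expo ξ p.1).re * Real.exp (-(η p.1 - p.2) * freqNorm ξ)) := by
    simp only [mode, normalCoeff, flip]
    rw [mul_assoc (freqNorm ξ : ℂ), Complex.re_ofReal_mul, mul_assoc]
  rw [e2, e3]
  ring

theorem IsProfile.ae_prod_hasLineDerivAt (hη : IsProfile η) :
    ∀ᵐ p : Horiz d × ℝ, ∀ a, HasLineDerivAt ℝ η (inner ℝ (gradient η p.1) a) p.1 a := by
  rw [Measure.volume_eq_prod]
  exact Measure.quasiMeasurePreserving_fst.ae hη.ae_hasLineDerivAt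

theorem measurable_modeX (hη : IsProfile η) (c : (Fin d → ℤ) → ℂ) (ξ : Fin d → ℤ) : Measurable (modeX η c ξ) := by
  have hf : Measurable (flip η) := (measurePreserving_flip hη.continuous).measurable
  unfold modeX
  refine Measurable.sub ?_ (((continuous_mode _ _).measurable.comp hf).smul
    ((measurable_gradient η).comp measurable_fst))
  refine (PiLp.continuous_toLp 2 (fun _ : Fin d => ℝ)).measurable.comp ?_
  exact measurable_pi_lambda _ fun j => (continuous_mode _ _).measurable.comp hf

theorem norm_toLp_le (v : Fin d → ℝ) : ‖(WithLp.toLp 2 v : Horiz d)‖ ≤ ∑ j, |v j| := by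
  have h1 : (WithLp.toLp 2 v : Horiz d) = ∑ j, EuclideanSpace.single j (v j) := by
    ext i; simp [Finset.sum_apply]
  rw [h1]
  refine (norm_sum_le _ _).trans (le_of_eq ?_)
  simp

theorem norm_modeX_le {B K : ℝ} {c : (Fin d → ℤ) → ℂ} (hc : ∀ ξ, ‖c ξ‖ ≤ B) (hK : ∀ x, ‖gradient η x‖ ≤ K)
    (ξ : Fin d → ℤ) (p : Horiz d × ℝ) : ‖modeX η c ξ p‖ ≤
      (d + K) * (freqNorm ξ * B) * Real.exp (-(flip η p).2 * freqNorm ξ) := by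
  have h0 := freqNorm_nonneg ξ
  have h1 : ∀ j, |mode (dirCoeff c j) ξ (flip η p)| ≤ freqNorm ξ * B * Real.exp (-(flip η p).2 * freqNorm ξ) := fun j => by
    refine (abs_mode_le _ _ _).trans ?_
    rw [norm_damp]
    gcongr
    exact (norm_dirCoeff_le c j ξ).trans (by gcongr; exact hc ξ)
  have h2 : |mode (normalCoeff c) ξ (flip η p)| ≤ freqNorm ξ * B * Real.exp (-(flip η p).2 * freqNorm ξ) := by
    refine (abs_mode_le _ _ _).trans ?_
    rw [norm_damp, norm_normalCoeff]
    gcongr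
    exact hc ξ
  calc ‖modeX η c ξ p‖ ≤ ‖(WithLp.toLp 2 (fun j => mode (dirCoeff c j) ξ (flip η p)) : Horiz d)‖
        + ‖mode (normalCoeff c) ξ (flip η p) • gradient η p.1‖ := norm_sub_le _ _
    _ ≤ ∑ _j : Fin d, freqNorm ξ * B * Real.exp (-(flip η p).2 * freqNorm ξ)
        + freqNorm ξ * B * Real.exp (-(flip η p).2 * freqNorm ξ) * K := by
        refine add_le_add ((norm_toLp_le _).trans (Finset.sum_le_sum fun j _ => h1 j)) ?_
        rw [norm_smul, Real.norm_eq_abs]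
        exact mul_le_mul h2 (hK _) (norm_nonneg _) ((abs_nonneg _).trans h2)
    _ = _ := by
        rw [Finset.sum_const, Finset.card_univ, Fintype.card_fin, nsmul_eq_mul]
        ring

/-- Inside the fluid the reflected height is positive, so the exponential factor is at most 1 and
everything is bounded. -/
theorem isH1_mode (hη : IsProfile η) {B : ℝ} {c : (Fin d → ℤ) → ℂ} (hc : ∀ ξ, ‖c ξ‖ ≤ B) (h : ℝ)
    (ξ : Fin d → ℤ) : IsH1 h η (fun p => mode c ξ (flip η p)) (modeX η c ξ)
      (fun p => mode (normalCoeff c) ξ (flip η p)) := by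
  obtain ⟨M, -, hM⟩ := hη.exists_bound
  obtain ⟨K, hK0, hK⟩ := hη.exists_gradient_bound
  have := isFiniteMeasure_fluidCell hM h
  have hf : Measurable (flip η) := (measurePreserving_flip hη.continuous).measurable
  have hB := (norm_nonneg _).trans (hc 0)
  have h0 := freqNorm_nonneg ξ
  have hexp : ∀ p ∈ fluidCell h η, Real.exp (-(flip η p).2 * freqNorm ξ) ≤ 1 := fun p hp => by
    refine Real.exp_le_one_iff.2 ?_
    have : 0 < (flip η p).2 := sub_pos.2 hp.2.2
    nlinarith
  have hmode : ∀ m : (Fin d → ℤ) → ℂ, MemLp (fun p => mode m ξ (flip η p)) 2 (volume.restrict (fluidCell h η)) :=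
    fun m => MemLp.of_bound (((continuous_mode m ξ).measurable.comp hf).aestronglyMeasurable) ‖m ξ‖
      ((ae_restrict_iff' (measurableSet_fluidCell hη.continuous h)).2 (Eventually.of_forall fun p hp =>
        (abs_mode_le m ξ _).trans (by
          rw [norm_damp]
          exact mul_le_of_le_one_right (norm_nonneg _) (hexp p hp))))
  refine IsH1.of_locallyLipschitz hη.continuous hM (mode_flip_periodic hη c ξ) (modeX_periodic hη c ξ)
    (mode_flip_periodic hη _ ξ) (hmode c) ?_ (hmode _) (locallyLipschitz_mode_flip hη c ξ) ?_
  · refine MemLp.of_bound (measurable_modeX hη c ξ).aestronglyMeasurable ((d + K) * (freqNorm ξ * B)) ?_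
    refine (ae_restrict_iff' (measurableSet_fluidCell hη.continuous h)).2 (Eventually.of_forall fun p hp => ?_)
    exact (norm_modeX_le hc hK ξ p).trans (mul_le_of_le_one_right (by positivity) (hexp p hp))
  · filter_upwards [hη.ae_prod_hasLineDerivAt] with p hp a b
    exact hasLineDerivAt_mode_flip (hp a)

end

/-! ### The lift of the boundary data: energy and weak gradient. -/

section

variable {d : ℕ} {h : ℝ} {η : Horiz d → ℝ} {c : (Fin d → ℤ) → ℂ}

/-- The horizontal gradient of the reflected harmonic extension. -/
def liftX (η : Horiz d → ℝ) (c : (Fin d → ℤ) → ℂ) (p : Horiz d × ℝ) : Horiz d :=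
  WithLp.toLp 2 (fun j => harmExt (dirCoeff c j) (flip η p)) - harmExt (normalCoeff c) (flip η p) • gradient η p.1

theorem harmExt_flip_periodic (hη : IsProfile η) (m : (Fin d → ℤ) → ℂ) :
    HorizPeriodic fun p => harmExt m (flip η p) := fun y i x => by
  change harmExt m (x + _, η (x + _) - y) = harmExt m (x, η x - y)
  rw [hη.periodic i x]
  simp only [harmExt, trigSeries_periodic _ i x]

theorem liftX_periodic (hη : IsProfile η) (c : (Fin d → ℤ) → ℂ) : HorizPeriodic (liftX η c) := fun y i x => by
  have h1 := fun m => harmExt_flip_periodic hη m y i x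
  have h2 := hη.gradient_periodic i x
  simp only [liftX] at h1 ⊢
  simp_rw [h1]
  rw [h2]

theorem measurable_harmExt_flip (hη : IsProfile η) {m : (Fin d → ℤ) → ℂ} (hm : Tempered m) :
    Measurable fun p => harmExt m (flip η p) :=
  (measurable_harmExt hm).comp (measurePreserving_flip hη.continuous).measurable

theorem measurable_liftX (hη : IsProfile η) {B : ℝ} (hc : ∀ ξ, ‖c ξ‖ ≤ B) : Measurable (liftX η c) := by
  unfold liftX
  refine Measurable.sub ?_ ((measurable_harmExt_flip hη (Tempered.normalCoeff hc)).smul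
    ((measurable_gradient η).comp measurable_fst))
  refine (PiLp.continuous_toLp 2 (fun _ : Fin d => ℝ)).measurable.comp ?_
  exact measurable_pi_lambda _ fun j => measurable_harmExt_flip hη (Tempered.dirCoeff hc j)

/-- The zero mode does not decay in s, so the finite height M + h of the slab is used here. Only
finiteness matters for this bound, which may depend on h. -/
theorem memLp_harmExt_flip (hη : IsProfile η) {B : ℝ} (hc : ∀ ξ, ‖c ξ‖ ≤ B) (hs : Summable fun ξ => ‖c ξ‖ ^ 2)
    (h : ℝ) : MemLp (fun p => harmExt c (flip η p)) 2 (volume.restrict (fluidCell h η)) := by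
  obtain ⟨M, -, hM⟩ := hη.exists_bound
  have hm := Tempered.of_bounded hc
  refine memLp_two_iff.2 ⟨(measurable_harmExt_flip hη hm).aestronglyMeasurable, ?_⟩
  refine (lintegral_fluidCell_flip_le hη.continuous hM (f := fun p => ‖harmExt c p‖ₑ ^ 2)
    ((measurable_harmExt hm).enorm.pow_const 2)).trans_lt ?_
  refine (lintegral_prod_harmExt_le hm measurableSet_Ioo Set.Ioo_subset_Ioi_self).trans_lt ?_
  refine ENNReal.mul_lt_top ENNReal.ofReal_lt_top ?_
  calc _ ≤ ∑' ξ, ENNReal.ofReal (‖c ξ‖ ^ 2) * ENNReal.ofReal (M + h - 0) := by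
        refine ENNReal.tsum_le_tsum fun ξ => ?_
        rw [enorm_sq_eq_ofReal]
        gcongr
        rw [← Real.volume_Ioo, ← setLIntegral_one]
        refine setLIntegral_mono' measurableSet_Ioo fun y hy => ?_
        rw [ENNReal.ofReal_le_one]
        exact Real.exp_le_one_iff.2 (by have := freqNorm_nonneg ξ; have := hy.1; nlinarith)
    _ = ENNReal.ofReal (∑' ξ, ‖c ξ‖ ^ 2) * ENNReal.ofReal (M + h - 0) := by
        rw [ENNReal.tsum_mul_right, ENNReal.ofReal_tsum_of_nonneg (fun ξ => by positivity) hs]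
    _ < ⊤ := ENNReal.mul_lt_top ENNReal.ofReal_lt_top ENNReal.ofReal_lt_top

section Derivative

variable {m : (Fin d → ℤ) → ℂ} {B : ℝ}

theorem sq_div_freqNorm_le (hm : ∀ ξ, ‖m ξ‖ ≤ freqNorm ξ * ‖c ξ‖) (ξ : Fin d → ℤ) :
    ‖m ξ‖ ^ 2 / (2 * freqNorm ξ) ≤ freqNorm ξ * ‖c ξ‖ ^ 2 := by
  have h0 := freqNorm_nonneg ξ
  have h1 := pow_le_pow_left₀ (norm_nonneg _) (hm ξ) 2
  rcases h0.eq_or_lt with h2 | h2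
  · rw [← h2]; simp
  · rw [div_le_iff₀ (by positivity)]
    nlinarith [sq_nonneg (freqNorm ξ * ‖c ξ‖)]

theorem summable_sq_div_freqNorm (hm : ∀ ξ, ‖m ξ‖ ≤ freqNorm ξ * ‖c ξ‖)
    (hs : Summable fun ξ => freqNorm ξ * ‖c ξ‖ ^ 2) : Summable fun ξ => ‖m ξ‖ ^ 2 / (2 * freqNorm ξ) :=
  Summable.of_nonneg_of_le (fun ξ => by have := freqNorm_nonneg ξ; positivity) (sq_div_freqNorm_le hm) hs

/-- For derivatives the slab can be enlarged to the half-space, because the integral of e^{-2|ξ|s}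
over s > 0 is 1/(2|ξ|). This makes the energy bound independent of h. -/
theorem lintegral_fluidCell_harmExt_le (hη : IsProfile η) (hc : ∀ ξ, ‖c ξ‖ ≤ B)
    (hm : ∀ ξ, ‖m ξ‖ ≤ freqNorm ξ * ‖c ξ‖) (hs : Summable fun ξ => freqNorm ξ * ‖c ξ‖ ^ 2) (h : ℝ) :
    ∫⁻ p in fluidCell h η, ‖harmExt m (flip η p)‖ₑ ^ 2 ≤
      ENNReal.ofReal ((2 * Real.pi) ^ d * ∑' ξ, ‖m ξ‖ ^ 2 / (2 * freqNorm ξ)) := by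
  obtain ⟨M, -, hM⟩ := hη.exists_bound
  have hT := Tempered.of_norm_le hc hm
  refine (lintegral_fluidCell_flip_le hη.continuous hM (f := fun p => ‖harmExt m p‖ₑ ^ 2)
    ((measurable_harmExt hT).enorm.pow_const 2)).trans ?_
  refine (lintegral_prod_harmExt_le hT measurableSet_Ioo Set.Ioo_subset_Ioi_self).trans ?_
  rw [ENNReal.ofReal_mul (two_pi_pow_pos d).le, ENNReal.ofReal_tsum_of_nonneg
    (fun ξ => by have := freqNorm_nonneg ξ; positivity) (summable_sq_div_freqNorm hm hs)]
  gcongr with ξ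
  -- At |ξ| = 0 the hypothesis forces the coefficient to vanish, in agreement with the convention x
  -- / 0 = 0.
  rcases (freqNorm_nonneg ξ).eq_or_lt with h2 | h2
  · have : m ξ = 0 := by
      have := hm ξ
      rw [← h2, zero_mul] at this
      exact norm_le_zero_iff.1 this
    simp [this]
  · rw [enorm_sq_eq_ofReal, div_eq_mul_inv, ENNReal.ofReal_mul (by positivity),
      ← lintegral_exp_Ioi (by positivity)]
    gcongr
    exact Set.Ioo_subset_Ioi_self

theorem memLp_harmExt_flip_of_le (hη : IsProfile η) (hc : ∀ ξ, ‖c ξ‖ ≤ B)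
    (hm : ∀ ξ, ‖m ξ‖ ≤ freqNorm ξ * ‖c ξ‖) (hs : Summable fun ξ => freqNorm ξ * ‖c ξ‖ ^ 2) (h : ℝ) :
    MemLp (fun p => harmExt m (flip η p)) 2 (volume.restrict (fluidCell h η)) :=
  memLp_two_iff.2 ⟨(measurable_harmExt_flip hη (Tempered.of_norm_le hc hm)).aestronglyMeasurable,
    (lintegral_fluidCell_harmExt_le hη hc hm hs h).trans_lt ENNReal.ofReal_lt_top⟩

theorem integral_fluidCell_harmExt_le (hη : IsProfile η) (hc : ∀ ξ, ‖c ξ‖ ≤ B)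
    (hm : ∀ ξ, ‖m ξ‖ ≤ freqNorm ξ * ‖c ξ‖) (hs : Summable fun ξ => freqNorm ξ * ‖c ξ‖ ^ 2) (h : ℝ) :
    ∫ p in fluidCell h η, harmExt m (flip η p) ^ 2 ≤
      (2 * Real.pi) ^ d * ∑' ξ, ‖m ξ‖ ^ 2 / (2 * freqNorm ξ) := by
  have h1 := lintegral_fluidCell_harmExt_le hη hc hm hs h
  rw [lintegral_enorm_sq (memLp_harmExt_flip_of_le hη hc hm hs h)] at h1
  have h2 : 0 ≤ ∑' ξ, ‖m ξ‖ ^ 2 / (2 * freqNorm ξ) :=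
    tsum_nonneg fun ξ => by have := freqNorm_nonneg ξ; positivity
  have h3 := (ENNReal.ofReal_le_ofReal_iff (mul_nonneg (two_pi_pow_pos d).le h2)).1 h1
  simpa using h3

end Derivative

section Lift

variable {B : ℝ}

theorem memLp_liftX (hη : IsProfile η) (hc : ∀ ξ, ‖c ξ‖ ≤ B)
    (hs : Summable fun ξ => freqNorm ξ * ‖c ξ‖ ^ 2) (h : ℝ) :
    MemLp (liftX η c) 2 (volume.restrict (fluidCell h η)) := by
  obtain ⟨K, hK0, hK⟩ := hη.exists_gradient_bound
  have h1 : ∀ j, MemLp (fun p => ‖harmExt (dirCoeff c j) (flip η p)‖) 2 (volume.restrict (fluidCell h η)) := fun j =>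
    (memLp_harmExt_flip_of_le hη hc (norm_dirCoeff_le c j) hs h).norm
  have h2 := (memLp_harmExt_flip_of_le hη hc (fun ξ => (norm_normalCoeff c ξ).le) hs h).norm.mul_const K
  have h3 := (memLp_finsetSum Finset.univ fun j _ => h1 j).add h2
  refine h3.mono (measurable_liftX hη hc).aestronglyMeasurable (Eventually.of_forall fun p => ?_)
  simp only [Pi.add_apply]
  rw [Real.norm_of_nonneg (by positivity)]
  refine (norm_sub_le _ _).trans (add_le_add (norm_toLp_le _) ?_)
  rw [norm_smul]
  gcongr
  exact hK _

/-- The Dirichlet energy of the lift. -/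
theorem integral_energy_lift_le (hη : IsProfile η) (hc : ∀ ξ, ‖c ξ‖ ≤ B)
    (hs : Summable fun ξ => freqNorm ξ * ‖c ξ‖ ^ 2) (h : ℝ) :
    ∫ p in fluidCell h η, (‖liftX η c p‖ ^ 2 + harmExt (normalCoeff c) (flip η p) ^ 2) ≤
      2 * (1 + gradSupNorm η ^ 2) * ((2 * Real.pi) ^ d * ∑' ξ, freqNorm ξ * ‖c ξ‖ ^ 2) := by
  have hn : ∀ ξ, ‖normalCoeff c ξ‖ ≤ freqNorm ξ * ‖c ξ‖ := fun ξ => (norm_normalCoeff c ξ).le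
  have hj := norm_dirCoeff_le c
  have i1 := fun j => (memLp_harmExt_flip_of_le hη hc (hj j) hs h).integrable_sq
  have i2 := (memLp_harmExt_flip_of_le hη hc hn hs h).integrable_sq
  -- The horizontal derivatives together and the normal derivative each contribute |ξ||c_ξ|²/2.
  have hsum : (∑ j, ∫ p in fluidCell h η, harmExt (dirCoeff c j) (flip η p) ^ 2)
      + ∫ p in fluidCell h η, harmExt (normalCoeff c) (flip η p) ^ 2
      ≤ (2 * Real.pi) ^ d * ∑' ξ, freqNorm ξ * ‖c ξ‖ ^ 2 := by
    refine (add_le_add (Finset.sum_le_sum fun j _ => integral_fluidCell_harmExt_le hη hc (hj j) hs h)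
      (integral_fluidCell_harmExt_le hη hc hn hs h)).trans (le_of_eq ?_)
    rw [← Finset.mul_sum, ← mul_add, ← Summable.tsum_finsetSum fun j _ => summable_sq_div_freqNorm (hj j) hs,
      ← Summable.tsum_add (summable_sum fun j _ => summable_sq_div_freqNorm (hj j) hs)
        (summable_sq_div_freqNorm hn hs)]
    congr 2
    funext ξ
    rw [← Finset.sum_div, sum_norm_dirCoeff_sq, norm_normalCoeff]
    rcases (freqNorm_nonneg ξ).eq_or_lt with h2 | h2
    · rw [← h2]; simp
    · field_simp; ring
  calc _ ≤ ∫ p in fluidCell h η, 2 * (1 + gradSupNorm η ^ 2) *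
        (∑ j, harmExt (dirCoeff c j) (flip η p) ^ 2 + harmExt (normalCoeff c) (flip η p) ^ 2) := by
        refine integral_mono_ae ?_ ?_ ?_
        · exact (memLp_liftX hη hc hs h).norm.integrable_sq.add i2
        · exact ((integrable_finsetSum _ fun j _ => i1 j).add i2).const_mul _
        · have hg : ∀ᵐ p : Horiz d × ℝ, ‖gradient η p.1‖ ≤ gradSupNorm η := by
            rw [Measure.volume_eq_prod]
            exact Measure.quasiMeasurePreserving_fst.ae hη.ae_gradient_le
          refine ae_restrict_of_ae ?_
          filter_upwards [hg] with p hp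
          have hL := gradSupNorm_nonneg η
          set A : Horiz d := WithLp.toLp 2 (fun j => harmExt (dirCoeff c j) (flip η p)) with hA
          set b := harmExt (normalCoeff c) (flip η p) with hb
          have e1 : ‖A‖ ^ 2 = ∑ j, harmExt (dirCoeff c j) (flip η p) ^ 2 := by
            rw [EuclideanSpace.norm_sq_eq]
            simp [hA]
          rw [← e1]
          -- The reflection turns the horizontal gradient A into A - b∇η; squaring the triangle
          -- inequality costs the factor 2(1 + L²).
          have h1 : ‖liftX η c p‖ ≤ ‖A‖ + |b| * gradSupNorm η := by
            refine (norm_sub_le _ _).trans ?_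
            rw [norm_smul, Real.norm_eq_abs]
            gcongr
          have h2 := pow_le_pow_left₀ (norm_nonneg _) h1 2
          have h3 : (‖A‖ + |b| * gradSupNorm η) ^ 2 ≤ 2 * ‖A‖ ^ 2 + 2 * (b ^ 2 * gradSupNorm η ^ 2) := by
            rw [← sq_abs b]
            nlinarith [sq_nonneg (‖A‖ - |b| * gradSupNorm η)]
          nlinarith [mul_nonneg (sq_nonneg (gradSupNorm η)) (sq_nonneg ‖A‖), sq_nonneg b]
    _ = 2 * (1 + gradSupNorm η ^ 2) * ((∑ j, ∫ p in fluidCell h η, harmExt (dirCoeff c j) (flip η p) ^ 2)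
        + ∫ p in fluidCell h η, harmExt (normalCoeff c) (flip η p) ^ 2) := by
        rw [integral_const_mul, integral_add (integrable_finsetSum _ fun j _ => i1 j) i2,
          integral_finsetSum _ fun j _ => i1 j]
    _ ≤ _ := by gcongr

theorem hasSum_modeX (hc : ∀ ξ, ‖c ξ‖ ≤ B) {p : Horiz d × ℝ} (hp : p.2 < η p.1) :
    HasSum (fun ξ => modeX η c ξ p) (liftX η c p) := by
  have hf : 0 < (flip η p).2 := sub_pos.2 hp
  refine HasSum.sub ?_ ((hasSum_mode (Tempered.normalCoeff hc) hf).smul_const _)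
  have h1 : HasSum (fun ξ => fun j => mode (dirCoeff c j) ξ (flip η p))
      (fun j => harmExt (dirCoeff c j) (flip η p)) :=
    Pi.hasSum.2 fun j => hasSum_mode (Tempered.dirCoeff hc j) hf
  exact h1.mapL (EuclideanSpace.equiv (Fin d) ℝ).symm.toContinuousLinearMap

/-- Over the bounded cell the support of a test function lies in a compact set on which η(x) - y is
continuous and positive. -/
theorem exists_gap {w : Horiz d × ℝ → ℝ} (hw : IsTest h η w) (hη : IsProfile η) :
    ∃ δ > 0, ∀ p : Horiz d × ℝ, p.1 ∈ cell d → p ∈ tsupport w → δ ≤ η p.1 - p.2 := by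
  obtain ⟨M, -, hM⟩ := hη.exists_bound
  obtain ⟨r, -, hr⟩ := exists_ball d (max |h| M)
  have hK : IsCompact (Metric.closedBall (0 : Horiz d × ℝ) r ∩ tsupport w) :=
    (isCompact_closedBall _ _).inter_right (isClosed_tsupport w)
  have hc := hη.continuous
  obtain ⟨δ, hδ, h2⟩ := hK.exists_forall_le' (f := fun p => η p.1 - p.2) (a := 0) (by fun_prop)
    fun p hp => sub_pos.2 (hw.supp hp.2).2
  refine ⟨δ, hδ, fun p h3 h4 => h2 p ⟨hr p h3 ?_, h4⟩⟩
  by_contra hcon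
  exact notMem_fluid_of_lt hM (not_le.1 hcon) (hw.supp h4)

/-- The reflected harmonic extension is in `H¹` of the fluid domain. -/
theorem isH1_lift (hη : IsProfile η) (hc : ∀ ξ, ‖c ξ‖ ≤ B) (hs0 : Summable fun ξ => ‖c ξ‖ ^ 2)
    (hs : Summable fun ξ => freqNorm ξ * ‖c ξ‖ ^ 2) (h : ℝ) :
    IsH1 h η (fun p => harmExt c (flip η p)) (liftX η c) (fun p => harmExt (normalCoeff c) (flip η p)) := by
  obtain ⟨M, -, hM⟩ := hη.exists_bound
  obtain ⟨K, hK0, hK⟩ := hη.exists_gradient_bound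
  refine ⟨harmExt_flip_periodic hη c, liftX_periodic hη c, harmExt_flip_periodic hη _,
    memLp_harmExt_flip hη hc hs0 h, memLp_liftX hη hc hs h,
    memLp_harmExt_flip_of_le hη hc (fun ξ => (norm_normalCoeff c ξ).le) hs h, fun w hwp hws hwt a b => ?_⟩
  have hw : IsTest h η w := ⟨hwp, hws, hwt⟩
  have hfin := isFiniteMeasure_fluidCell hM h
  obtain ⟨C, hC0, hC⟩ := hw.exists_bound hM
  obtain ⟨δ, hδ, hgap⟩ := exists_gap hw hη
  have hB := (norm_nonneg _).trans (hc 0)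
  have hsδ := summable_mul_exp_neg_freqNorm d hδ
  have hmeas := measurableSet_fluidCell hη.continuous h
  have hmode1 := isH1_mode hη hc h
  have hexp : ∀ p : Horiz d × ℝ, p.1 ∈ cell d → p ∈ tsupport w → ∀ ξ : Fin d → ℤ,
      Real.exp (-(flip η p).2 * freqNorm ξ) ≤ Real.exp (-δ * freqNorm ξ) := fun p h1 h2 ξ => by
    refine Real.exp_le_exp.2 ?_
    have h3 := hgap p h1 h2
    have h4 := freqNorm_nonneg ξ
    change -(η p.1 - p.2) * freqNorm ξ ≤ _
    nlinarith
  -- The weak identity is summed over modes. On the support of w the gap δ supplies the factor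
  -- e^{-δ|ξ|}, which dominates the series even with a factor |ξ| from differentiation; off the
  -- support the terms vanish.
  have hL : HasSum (fun ξ => ∫ p in fluidCell h η, mode c ξ (flip η p) * fderiv ℝ w p (a, b))
      (∫ p in fluidCell h η, harmExt c (flip η p) * fderiv ℝ w p (a, b)) := by
    refine hasSum_integral_of_dominated_convergence
      (fun ξ _ => (B * (C * ‖(a, b)‖)) * ((1 + freqNorm ξ) * Real.exp (-δ * freqNorm ξ)))
      (fun ξ => (hw.integrable_mul_fderiv hη.continuous hM (hmode1 ξ).memLp (a, b)).aestronglyMeasurable)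
      (fun ξ => ?_) (Eventually.of_forall fun p => hsδ.mul_left _) (integrable_const _) ?_
    · refine (ae_restrict_iff' hmeas).2 (Eventually.of_forall fun p hp => ?_)
      by_cases hpw : p ∈ tsupport w
      · have h1 := abs_mode_le c ξ (flip η p)
        rw [norm_damp] at h1
        have h2 : ‖fderiv ℝ w p (a, b)‖ ≤ C * ‖(a, b)‖ := (ContinuousLinearMap.le_opNorm _ _).trans
          (mul_le_mul_of_nonneg_right (hC p hp.1).2 (norm_nonneg _))
        have h3 := freqNorm_nonneg ξ
        rw [norm_mul, Real.norm_eq_abs]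
        calc _ ≤ (B * Real.exp (-δ * freqNorm ξ)) * (C * ‖(a, b)‖) := by
              refine mul_le_mul (h1.trans ?_) h2 (norm_nonneg _) (by positivity)
              exact mul_le_mul (hc ξ) (hexp p hp.1 hpw ξ) (Real.exp_pos _).le hB
          _ = (B * (C * ‖(a, b)‖)) * (1 * Real.exp (-δ * freqNorm ξ)) := by ring
          _ ≤ _ := by gcongr; linarith
      · rw [fderiv_of_notMem_tsupport ℝ hpw]
        have h3 := freqNorm_nonneg ξ
        simp
        positivity
    · refine (ae_restrict_iff' hmeas).2 (Eventually.of_forall fun p hp => ?_)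
      exact (hasSum_mode (Tempered.of_bounded hc) (sub_pos.2 hp.2.2)).mul_right _
  have hR : HasSum (fun ξ => ∫ p in fluidCell h η,
      (inner ℝ (modeX η c ξ p) a + mode (normalCoeff c) ξ (flip η p) * b) * w p)
      (∫ p in fluidCell h η, (inner ℝ (liftX η c p) a + harmExt (normalCoeff c) (flip η p) * b) * w p) := by
    refine hasSum_integral_of_dominated_convergence
      (fun ξ _ => (B * ((d + K) * ‖a‖ + |b|) * C) * ((1 + freqNorm ξ) * Real.exp (-δ * freqNorm ξ)))
      (fun ξ => (hw.integrable_mul hη.continuous hM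
        (memLp_directional (hmode1 ξ).memLp_x (hmode1 ξ).memLp_y a b)).aestronglyMeasurable)
      (fun ξ => ?_) (Eventually.of_forall fun p => hsδ.mul_left _) (integrable_const _) ?_
    · refine (ae_restrict_iff' hmeas).2 (Eventually.of_forall fun p hp => ?_)
      have h3 := freqNorm_nonneg ξ
      by_cases hpw : p ∈ tsupport w
      · have h1 := norm_modeX_le hc hK ξ p
        have h2 := abs_mode_le (normalCoeff c) ξ (flip η p)
        rw [norm_damp, norm_normalCoeff] at h2
        have he := hexp p hp.1 hpw ξ
        have h4 : |inner ℝ (modeX η c ξ p) a| ≤ (d + K) * (freqNorm ξ * B) * Real.exp (-δ * freqNorm ξ) * ‖a‖ := by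
          refine (abs_real_inner_le_norm _ _).trans ?_
          gcongr
          exact h1.trans (by gcongr)
        have h5 : |mode (normalCoeff c) ξ (flip η p)| ≤ freqNorm ξ * B * Real.exp (-δ * freqNorm ξ) :=
          h2.trans (by gcongr; exact hc ξ)
        rw [norm_mul, Real.norm_eq_abs]
        calc _ ≤ ((d + K) * (freqNorm ξ * B) * Real.exp (-δ * freqNorm ξ) * ‖a‖
              + freqNorm ξ * B * Real.exp (-δ * freqNorm ξ) * |b|) * C := by
              refine mul_le_mul ?_ (hC p hp.1).1 (norm_nonneg _) (by positivity)
              refine (abs_add_le _ _).trans (add_le_add h4 ?_)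
              rw [abs_mul]
              gcongr
          _ = (B * ((d + K) * ‖a‖ + |b|) * C) * (freqNorm ξ * Real.exp (-δ * freqNorm ξ)) := by ring
          _ ≤ _ := by gcongr; linarith
      · rw [image_eq_zero_of_notMem_tsupport hpw]
        simp
        positivity
    · refine (ae_restrict_iff' hmeas).2 (Eventually.of_forall fun p hp => ?_)
      refine HasSum.mul_right _ (HasSum.add ?_ ((hasSum_mode (Tempered.normalCoeff hc)
        (sub_pos.2 hp.2.2 : 0 < (flip η p).2)).mul_right b))
      have := (hasSum_modeX hc hp.2.2).mapL (innerSL ℝ a)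
      simpa [real_inner_comm] using this
  have hterm := fun ξ => (hmode1 ξ).weak w hwp hws hwt a b
  simp_rw [hterm] at hL
  exact hL.unique hR.neg

end Lift

end

/-! ### Trace of the lift and the Dirichlet principle. -/

section

variable {d : ℕ} {h : ℝ} {η ψ : Horiz d → ℝ}

theorem MemSobolev.memLp_ofReal {s : ℝ} (hψ : MemSobolev s ψ) :
    MemLp (fun x => (ψ x : ℂ)) 2 (volume.restrict (cell d)) := hψ.memLp.ofReal

theorem MemSobolev.summable_sq {s : ℝ} (hψ : MemSobolev s ψ) : Summable fun ξ => ‖fourierCoeffTorus ψ ξ‖ ^ 2 := by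
  rw [fourierCoeffTorus_eq]
  exact (hasSum_sq_fc hψ.memLp_ofReal).summable

theorem MemSobolev.exists_bound {s : ℝ} (hψ : MemSobolev s ψ) : ∃ B, ∀ ξ, ‖fourierCoeffTorus ψ ξ‖ ≤ B := by
  refine ⟨Real.sqrt (∑' ξ, ‖fourierCoeffTorus ψ ξ‖ ^ 2), fun ξ => Real.le_sqrt_of_sq_le ?_⟩
  exact hψ.summable_sq.le_tsum ξ fun _ _ => by positivity

theorem freqNorm_mul_le_sobolevTerm (ψ : Horiz d → ℝ) (ξ : Fin d → ℤ) :
    freqNorm ξ * ‖fourierCoeffTorus ψ ξ‖ ^ 2 ≤ sobolevTerm (1 / 2) ψ ξ := by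
  rw [sobolevTerm, ← Real.sqrt_eq_rpow]
  gcongr
  exact Real.sqrt_le_sqrt (by linarith)

theorem MemSobolev.summable_freqNorm_mul (hψ : MemSobolev (1 / 2) ψ) :
    Summable fun ξ => freqNorm ξ * ‖fourierCoeffTorus ψ ξ‖ ^ 2 :=
  Summable.of_nonneg_of_le (fun ξ => by have := freqNorm_nonneg ξ; positivity)
    (freqNorm_mul_le_sobolevTerm ψ) hψ.summable

theorem sq_one_sub_exp_le {t : ℝ} (ht : 0 ≤ t) : (1 - Real.exp (-t)) ^ 2 ≤ t := by
  have h1 := Real.add_one_le_exp (-t)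
  have h2 : Real.exp (-t) ≤ 1 := Real.exp_le_one_iff.2 (by linarith)
  have h3 := Real.exp_pos (-t)
  nlinarith

/-- By Parseval the distance is ∑ |c_ξ|²(1 - e^{-|ξ|s})², and (1 - e^{-t})² ≤ t turns the H^{1/2}
summability into a rate linear in s. -/
theorem lintegral_harmExt_sub_le (hψ : MemSobolev (1 / 2) ψ) {s : ℝ} (hs : 0 < s) :
    ∫⁻ x in cell d, ‖harmExt (fourierCoeffTorus ψ) (x, s) - ψ x‖ₑ ^ 2 ≤ ENNReal.ofReal
      ((2 * Real.pi) ^ d * (∑' ξ, freqNorm ξ * ‖fourierCoeffTorus ψ ξ‖ ^ 2) * s) := by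
  obtain ⟨B, hB⟩ := hψ.exists_bound
  set c := fourierCoeffTorus ψ with hc
  have hd := (Tempered.of_bounded hB).summable_damp hs
  have hsum := hψ.summable_freqNorm_mul
  have h1 : MemLp (fun x => trigSeries (damp c s) x - (ψ x : ℂ)) 2 (volume.restrict (cell d)) :=
    (memLp_trigSeries hd).sub hψ.memLp_ofReal
  have h2 : ∀ ξ, fc (fun x => trigSeries (damp c s) x - (ψ x : ℂ)) ξ = damp c s ξ - c ξ := fun ξ => by
    rw [fc_sub ((memLp_trigSeries hd).integrable one_le_two) (hψ.memLp_ofReal.integrable one_le_two),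
      fc_trigSeries hd, hc, fourierCoeffTorus_eq]
  calc _ ≤ ∫⁻ x in cell d, ‖trigSeries (damp c s) x - (ψ x : ℂ)‖ₑ ^ 2 := by
        refine lintegral_mono fun x => ?_
        rw [enorm_sq_eq_ofReal, enorm_sq_eq_ofReal]
        refine ENNReal.ofReal_le_ofReal (pow_le_pow_left₀ (norm_nonneg _) ?_ 2)
        have : harmExt c (x, s) - ψ x = (trigSeries (damp c s) x - (ψ x : ℂ)).re := by
          simp [harmExt, hs]
        rw [this]
        exact Complex.abs_re_le_norm _
    _ = ENNReal.ofReal ((2 * Real.pi) ^ d) * ∑' ξ, ‖damp c s ξ - c ξ‖ₑ ^ 2 := by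
        rw [lintegral_sq_eq h1]
        simp_rw [h2]
    _ ≤ ENNReal.ofReal ((2 * Real.pi) ^ d) * ∑' ξ, ENNReal.ofReal (freqNorm ξ * ‖c ξ‖ ^ 2 * s) := by
        gcongr with ξ
        rw [enorm_sq_eq_ofReal]
        refine ENNReal.ofReal_le_ofReal ?_
        have e1 : damp c s ξ - c ξ = -(c ξ * ((1 - Real.exp (-(s * freqNorm ξ)) : ℝ) : ℂ)) := by
          rw [damp, neg_mul]; push_cast; ring
        have h3 := sq_one_sub_exp_le (mul_nonneg hs.le (freqNorm_nonneg ξ))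
        rw [e1, norm_neg, norm_mul, mul_pow, Complex.norm_real, Real.norm_eq_abs, sq_abs]
        nlinarith [sq_nonneg ‖c ξ‖]
    _ = _ := by
        rw [← ENNReal.ofReal_tsum_of_nonneg (fun ξ => by have := freqNorm_nonneg ξ; positivity)
          (hsum.mul_right s), ← ENNReal.ofReal_mul (two_pi_pow_pos d).le, tsum_mul_right, mul_assoc]

theorem flip_graph (η : Horiz d → ℝ) (x : Horiz d) (s : ℝ) : flip η (x, η x + -1 * s) = (x, s) := by
  simp [flip]

theorem aemeasurable_lift_trace (η : Horiz d → ℝ) (hψ : MemSobolev (1 / 2) ψ) (ε : ℝ) :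
    AEMeasurable (fun p : Horiz d × ℝ =>
      ‖harmExt (fourierCoeffTorus ψ) (flip η (p.1, η p.1 + -1 * p.2)) - ψ p.1‖ₑ ^ 2)
      (volume.restrict (cell d ×ˢ Set.Ioo 0 ε)) := by
  obtain ⟨B, hB⟩ := hψ.exists_bound
  simp_rw [flip_graph]
  have h1 : AEMeasurable (fun p : Horiz d × ℝ => ψ p.1) (volume.restrict (cell d ×ˢ Set.Ioo 0 ε)) := by
    rw [Measure.volume_eq_prod, ← Measure.prod_restrict]
    exact hψ.memLp.1.aemeasurable.comp_fst
  exact (((measurable_harmExt (Tempered.of_bounded hB)).aemeasurable.sub h1).enorm.pow_const 2)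

theorem hasSurfaceTrace_lift (η : Horiz d → ℝ) (hψ : MemSobolev (1 / 2) ψ) :
    HasSurfaceTrace η (fun p => harmExt (fourierCoeffTorus ψ) (flip η p)) ψ := by
  refine HasGraphTrace.of_lintegral_le (s₀ := 1)
    (A := (2 * Real.pi) ^ d * ∑' ξ, freqNorm ξ * ‖fourierCoeffTorus ψ ξ‖ ^ 2) one_pos (aemeasurable_lift_trace η hψ 1)
    (Eventually.of_forall fun s hs => ?_)
  simp_rw [flip_graph]
  exact lintegral_harmExt_sub_le hψ hs.1

theorem integrable_inner_of_memLp {α : Type*} [MeasurableSpace α] {μ : Measure α} {f g : α → Horiz d}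
    (hf : MemLp f 2 μ) (hg : MemLp g 2 μ) : Integrable (fun p => inner ℝ (f p) (g p)) μ :=
  (hf.norm.integrable_mul hg.norm).mono (hf.1.inner hg.1) (Eventually.of_forall fun p => by
    simpa using abs_real_inner_le_norm (f p) (g p))

/-- The Dirichlet principle with the reflected harmonic extension as competitor. -/
theorem IsVariationalSolution.integral_energy_le {φ : Horiz d × ℝ → ℝ} {φx : Horiz d × ℝ → Horiz d}
    {φy : Horiz d × ℝ → ℝ} (hφ : IsVariationalSolution h η ψ φ φx φy) (hη : IsProfile η)
    (hψ : MemSobolev (1 / 2) ψ) :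
    ∫ p in fluidCell h η, (‖φx p‖ ^ 2 + φy p ^ 2) ≤
      2 * (1 + gradSupNorm η ^ 2) * ((2 * Real.pi) ^ d * sobolevNormSq (1 / 2) ψ) := by
  obtain ⟨M, -, hM⟩ := hη.exists_bound
  obtain ⟨B, hB⟩ := hψ.exists_bound
  have hs := hψ.summable_freqNorm_mul
  set c := fourierCoeffTorus ψ with hc
  have hL := isH1_lift hη hB hψ.summable_sq hs h
  -- The solution and the lift have the same trace, so their difference is an admissible test
  -- function.
  have htr : HasSurfaceTrace η (fun p => φ p - harmExt c (flip η p)) fun _ => 0 := by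
    have := HasGraphTrace.sub hφ.trace (hasSurfaceTrace_lift η hψ)
      (Eventually.of_forall fun ε => aemeasurable_lift_trace η hψ ε)
    simp only [sub_self] at this
    exact this
  have h0 := hφ.variational _ _ _ (hφ.isH1.sub hη.continuous hM hL) htr
  set ψx := liftX η c with hψx
  set ψy := fun p => harmExt (normalCoeff c) (flip η p) with hψy
  have hE := integral_energy_lift_le hη hB hs h
  have i1 : Integrable (fun p => ‖φx p‖ ^ 2 + φy p ^ 2) (volume.restrict (fluidCell h η)) :=
    hφ.isH1.memLp_x.norm.integrable_sq.add hφ.isH1.memLp_y.integrable_sq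
  have i2 : Integrable (fun p => ‖ψx p‖ ^ 2 + ψy p ^ 2) (volume.restrict (fluidCell h η)) :=
    hL.memLp_x.norm.integrable_sq.add hL.memLp_y.integrable_sq
  have i3 : Integrable (fun p => inner ℝ (φx p) (φx p - ψx p) + φy p * (φy p - ψy p))
      (volume.restrict (fluidCell h η)) :=
    (integrable_inner_of_memLp hφ.isH1.memLp_x (hφ.isH1.memLp_x.sub hL.memLp_x)).add
      (hφ.isH1.memLp_y.integrable_mul (hφ.isH1.memLp_y.sub hL.memLp_y))
  -- Pointwise |∇φ|² ≤ |∇Ψ|² + 2∇φ·(∇φ - ∇Ψ), with Ψ the lift: the two sides differ by |∇φ - ∇Ψ|².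
  -- The cross term integrates to zero by the variational equation.
  have h1 : ∫ p in fluidCell h η, (‖φx p‖ ^ 2 + φy p ^ 2) ≤ ∫ p in fluidCell h η,
      ((‖ψx p‖ ^ 2 + ψy p ^ 2) + 2 * (inner ℝ (φx p) (φx p - ψx p) + φy p * (φy p - ψy p))) := by
    refine integral_mono i1 (i2.add (i3.const_mul 2)) fun p => ?_
    have e1 := norm_sub_sq_real (φx p) (ψx p)
    have e2 : inner ℝ (φx p) (φx p - ψx p) = ‖φx p‖ ^ 2 - inner ℝ (φx p) (ψx p) := by
      rw [inner_sub_right, real_inner_self_eq_norm_sq]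
    simp only [e2]
    nlinarith [sq_nonneg ‖φx p - ψx p‖, sq_nonneg (φy p - ψy p)]
  rw [integral_add i2 (i3.const_mul 2), integral_const_mul, h0, mul_zero, add_zero] at h1
  refine h1.trans (hE.trans ?_)
  have h2 : ∑' ξ, freqNorm ξ * ‖c ξ‖ ^ 2 ≤ sobolevNormSq (1 / 2) ψ :=
    hs.tsum_le_tsum (freqNorm_mul_le_sobolevTerm ψ) hψ.summable
  gcongr

end

/-! ### The one-dimensional weak problem in the vertical variable. -/

section

/-- Smooth functions with compact support in the interval `(α, β)`. -/
structure IsBump (α β : ℝ) (χ : ℝ → ℝ) : Prop where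
  smooth : ContDiff ℝ ((⊤ : ℕ∞) : WithTop ℕ∞) χ
  compact : HasCompactSupport χ
  supp : tsupport χ ⊆ Set.Ioo α β

variable {α β : ℝ}

theorem IsBump.continuous_deriv {χ : ℝ → ℝ} (hχ : IsBump α β χ) : Continuous (deriv χ) :=
  hχ.smooth.continuous_deriv (by simp)

theorem IsBump.hasDerivAt {χ : ℝ → ℝ} (hχ : IsBump α β χ) (y : ℝ) : HasDerivAt χ (deriv χ y) y :=
  ((hχ.smooth.differentiable (by simp)) y).hasDerivAt

theorem IsBump.mul {χ ρ : ℝ → ℝ} (hχ : IsBump α β χ) (hρ : ContDiff ℝ ((⊤ : ℕ∞) : WithTop ℕ∞) ρ) :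
    IsBump α β fun y => χ y * ρ y :=
  ⟨hχ.smooth.mul hρ, hχ.compact.mul_right, (tsupport_mul_subset_left (f := χ)).trans hχ.supp⟩

theorem integrableOn_smul_Ioo {χ : ℝ → ℝ} {f : ℝ → ℂ} (hχ : Continuous χ) (hf : IntegrableOn f (Set.Ioo α β)) :
    IntegrableOn (fun y => χ y • f y) (Set.Ioo α β) := by
  rw [← integrableOn_Icc_iff_integrableOn_Ioo] at hf ⊢
  exact hf.continuousOn_smul hχ.continuousOn isCompact_Icc

theorem ae_eq_zero_of_integral_bump {F : ℝ → ℂ} (hF : IntegrableOn F (Set.Ioo α β))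
    (h : ∀ χ, IsBump α β χ → ∫ y in Set.Ioo α β, χ y • F y = 0) :
    ∀ᵐ y, y ∈ Set.Ioo α β → F y = 0 := by
  refine isOpen_Ioo.ae_eq_zero_of_integral_contDiff_smul_eq_zero hF.locallyIntegrableOn fun χ h1 h2 h3 => ?_
  rw [← h χ ⟨h1, h2, h3⟩, setIntegral_eq_integral_of_forall_compl_eq_zero]
  intro y hy
  rw [image_eq_zero_of_notMem_tsupport fun hh => hy (h3 hh), zero_smul]

theorem exists_bump_integral_one (hαβ : α < β) : ∃ χ, IsBump α β χ ∧ ∫ y, χ y = 1 := by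
  let b : ContDiffBump ((α + β) / 2) :=
    ⟨(β - α) / 8, (β - α) / 4, by linarith, by linarith⟩
  refine ⟨b.normed volume, ⟨b.contDiff_normed, b.hasCompactSupport_normed, ?_⟩, b.integral_normed⟩
  rw [b.tsupport_normed_eq, Real.closedBall_eq_Icc]
  change Set.Icc ((α + β) / 2 - (β - α) / 4) ((α + β) / 2 + (β - α) / 4) ⊆ _
  exact fun y hy => ⟨by linarith [hy.1], by linarith [hy.2]⟩

/-- Integrating from the left end of the support gives a primitive that vanishes to the left, and
also to the right because the total integral is zero. -/
theorem IsBump.exists_primitive {χ : ℝ → ℝ} (hχ : IsBump α β χ) (h0 : ∫ y, χ y = 0) :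
    ∃ ρ, IsBump α β ρ ∧ deriv ρ = χ := by
  by_cases hne : (tsupport χ).Nonempty
  · have hc : IsCompact (tsupport χ) := hχ.compact
    set a := sInf (tsupport χ) with ha
    set b := sSup (tsupport χ) with hb
    have ha' := hχ.supp (hc.sInf_mem hne)
    have hb' := hχ.supp (hc.sSup_mem hne)
    have hsub : tsupport χ ⊆ Set.Icc a b := fun y hy =>
      ⟨csInf_le hc.bddBelow hy, le_csSup hc.bddAbove hy⟩
    have hab : a ≤ b := csInf_le_csSup hne hc.bddBelow hc.bddAbove
    have hcont := hχ.smooth.continuous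
    have hz : ∀ y, y ∉ Set.Icc a b → χ y = 0 := fun y hy =>
      image_eq_zero_of_notMem_tsupport fun hh => hy (hsub hh)
    set ρ : ℝ → ℝ := fun y => ∫ t in a..y, χ t with hρ
    have hder : ∀ y, HasDerivAt ρ (χ y) y := fun y =>
      intervalIntegral.integral_hasDerivAt_right (hcont.intervalIntegrable _ _)
        hcont.aestronglyMeasurable.stronglyMeasurableAtFilter hcont.continuousAt
    have hd : deriv ρ = χ := funext fun y => (hder y).deriv
    have hint : ∫ t in a..b, χ t = 0 := by
      rw [intervalIntegral.integral_of_le hab, ← integral_Icc_eq_integral_Ioc,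
        setIntegral_eq_integral_of_forall_compl_eq_zero hz, h0]
    have hρ0 : ∀ y, y ∉ Set.Icc a b → ρ y = 0 := fun y hy => by
      rcases lt_or_ge y a with h1 | h1
      · simp only [hρ]
        refine intervalIntegral.integral_zero_ae (Eventually.of_forall fun t ht => ?_)
        rw [Set.uIoc_of_ge h1.le] at ht
        -- The endpoint a belongs to the integration interval; χ vanishes there by continuity from
        -- the left.
        rcases eq_or_lt_of_le ht.2 with h2 | h2
        · refine closure_minimal (s := Set.Iio a) (t := {t | χ t = 0}) (fun t ht => hz t fun hh =>
            absurd hh.1 (not_le.2 ht)) (isClosed_eq hcont continuous_const) ?_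
          rw [closure_Iio]
          exact ht.2
        · exact hz t fun hh => absurd hh.1 (not_le.2 h2)
      · have h2 : b < y := by
          by_contra hcon
          exact hy ⟨h1, not_lt.1 hcon⟩
        simp only [hρ]
        rw [← intervalIntegral.integral_add_adjacent_intervals (hcont.intervalIntegrable a b)
          (hcont.intervalIntegrable b y), hint, zero_add]
        refine intervalIntegral.integral_zero_ae (Eventually.of_forall fun t ht => ?_)
        rw [Set.uIoc_of_le h2.le] at ht
        exact hz t fun hh => absurd hh.2 (not_le.2 ht.1)
    have hts : tsupport ρ ⊆ Set.Icc a b := by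
      refine closure_minimal (fun y hy => ?_) isClosed_Icc
      by_contra hcon
      exact hy (hρ0 y hcon)
    refine ⟨ρ, ⟨?_, ?_, ?_⟩, hd⟩
    · refine contDiff_infty_iff_deriv.2 ⟨fun y => (hder y).differentiableAt, ?_⟩
      rw [hd]; exact hχ.smooth
    · exact HasCompactSupport.of_support_subset_isCompact isCompact_Icc ((subset_tsupport ρ).trans hts)
    · exact hts.trans fun y hy => ⟨ha'.1.trans_le hy.1, hy.2.trans_lt hb'.2⟩
  · have h1 : χ = 0 := by
      rw [Set.not_nonempty_iff_eq_empty, tsupport_eq_empty_iff] at hne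
      exact hne
    subst h1
    exact ⟨0, hχ, by simp⟩

/-- The lemma of du Bois-Reymond. -/
theorem ae_eq_const_of_integral_deriv_bump (hαβ : α < β) {F : ℝ → ℂ} (hF : IntegrableOn F (Set.Ioo α β))
    (h : ∀ χ, IsBump α β χ → ∫ y in Set.Ioo α β, deriv χ y • F y = 0) :
    ∃ C : ℂ, ∀ᵐ y, y ∈ Set.Ioo α β → F y = C := by
  obtain ⟨θ₀, hθ₀, hI⟩ := exists_bump_integral_one hαβ
  refine ⟨∫ y in Set.Ioo α β, θ₀ y • F y, ?_⟩
  set C := ∫ y in Set.Ioo α β, θ₀ y • F y with hC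
  have hconst : IntegrableOn (fun _ : ℝ => C) (Set.Ioo α β) := integrableOn_const (by simp)
  have key := ae_eq_zero_of_integral_bump (hF.sub hconst) fun θ hθ => ?_
  · filter_upwards [key] with y hy hy2
    exact sub_eq_zero.1 (hy hy2)
  set I := ∫ y, θ y with hIθ
  have i1 : Integrable θ := hθ.smooth.continuous.integrable_of_hasCompactSupport hθ.compact
  have i2 : Integrable θ₀ := hθ₀.smooth.continuous.integrable_of_hasCompactSupport hθ₀.compact
  -- Subtracting I θ₀ makes the mean zero, so this bump is the derivative of another bump.
  have hb : IsBump α β fun y => θ y - θ₀ y * I := by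
    have hm := hθ₀.mul (contDiff_const (c := I))
    refine ⟨hθ.smooth.sub hm.smooth, hθ.compact.sub hm.compact, ?_⟩
    exact (tsupport_sub (f := θ) (g := fun y => θ₀ y * I)).trans (Set.union_subset hθ.supp hm.supp)
  obtain ⟨ρ, hρ, hd⟩ := hb.exists_primitive (by
    rw [integral_sub i1 (i2.mul_const I), integral_mul_const, hI, one_mul, sub_self])
  have h1 := h ρ hρ
  rw [hd] at h1
  have e1 : ∀ y, (θ y - θ₀ y * I) • F y = θ y • F y - I • (θ₀ y • F y) := fun y => by
    rw [sub_smul, smul_smul, mul_comm I]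
  simp_rw [e1] at h1
  have hθint : ∫ y in Set.Ioo α β, θ y • C = I • C := by
    rw [integral_smul_const, setIntegral_eq_integral_of_forall_compl_eq_zero]
    exact fun y hy => image_eq_zero_of_notMem_tsupport fun hh => hy (hθ.supp hh)
  have j1 := integrableOn_smul_Ioo hθ.smooth.continuous hF
  have j2 := integrableOn_smul_Ioo hθ₀.smooth.continuous hF
  have e2 := integral_sub j1 (j2.smul I)
  simp only [Pi.smul_apply] at e2
  rw [e2, integral_smul, ← hC] at h1
  simp only [Pi.sub_apply, smul_sub]
  rw [integral_sub j1 (integrableOn_smul_Ioo hθ.smooth.continuous hconst), hθint, h1]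

theorem hasDerivAt_cosh_shift (κ α y : ℝ) :
    HasDerivAt (fun y => Real.cosh (κ * (y - α))) (κ * Real.sinh (κ * (y - α))) y := by
  have := (((hasDerivAt_id y).sub_const α).const_mul κ).cosh
  simpa [mul_comm] using this

theorem hasDerivAt_sinh_shift (κ α y : ℝ) :
    HasDerivAt (fun y => Real.sinh (κ * (y - α))) (κ * Real.cosh (κ * (y - α))) y := by
  have := (((hasDerivAt_id y).sub_const α).const_mul κ).sinh
  simpa [mul_comm] using this

theorem contDiff_cosh_shift (κ α : ℝ) :
    ContDiff ℝ ((⊤ : ℕ∞) : WithTop ℕ∞) fun y => Real.cosh (κ * (y - α)) := by fun_prop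

theorem contDiff_sinh_shift (κ α : ℝ) :
    ContDiff ℝ ((⊤ : ℕ∞) : WithTop ℕ∞) fun y => Real.sinh (κ * (y - α)) := by fun_prop

/-- Weak solutions of `f' = g`, `g' = κ² f` with the natural boundary condition `g(α) = 0` are
multiples of `cosh (κ (y - α))`. -/
theorem ae_eq_cosh (hαβ : α < β) {κ : ℝ} (hκ : 0 < κ) {f g : ℝ → ℂ} (hf : IntegrableOn f (Set.Ioo α β))
    (hg : IntegrableOn g (Set.Ioo α β))
    (H1 : ∀ χ, IsBump α β χ → ∫ y in Set.Ioo α β, deriv χ y • f y = -∫ y in Set.Ioo α β, χ y • g y)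
    (H2 : ∀ χ : ℝ → ℝ, ContDiff ℝ ((⊤ : ℕ∞) : WithTop ℕ∞) χ → tsupport χ ⊆ Set.Iio β →
      ∫ y in Set.Ioo α β, ((κ ^ 2 * χ y) • f y + deriv χ y • g y) = 0) :
    ∃ A : ℂ, ∀ᵐ y, y ∈ Set.Ioo α β → f y = (Real.cosh (κ * (y - α)) : ℂ) * A := by
  set Ch : ℝ → ℝ := fun y => Real.cosh (κ * (y - α)) with hCh
  set Sh : ℝ → ℝ := fun y => Real.sinh (κ * (y - α)) with hSh
  have cC : Continuous Ch := (contDiff_cosh_shift κ α).continuous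
  have cS : Continuous Sh := (contDiff_sinh_shift κ α).continuous
  have dC : ∀ y, HasDerivAt Ch (κ * Sh y) y := hasDerivAt_cosh_shift κ α
  have dS : ∀ y, HasDerivAt Sh (κ * Ch y) y := hasDerivAt_sinh_shift κ α
  have hCS : ∀ y, (Ch y : ℂ) * Ch y - Sh y * Sh y = 1 := fun y => by
    have := Real.cosh_sq_sub_sinh_sq (κ * (y - α))
    have h2 : Ch y * Ch y - Sh y * Sh y = 1 := by rw [← this]; ring
    exact_mod_cast h2
  have H2' : ∀ χ, IsBump α β χ → ∫ y in Set.Ioo α β, ((κ ^ 2 * χ y) • f y + deriv χ y • g y) = 0 :=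
    fun χ hχ => H2 χ hχ.smooth (hχ.supp.trans fun y hy => hy.2)
  have H1' : ∀ χ, IsBump α β χ → ∫ y in Set.Ioo α β, (deriv χ y • f y + χ y • g y) = 0 := fun χ hχ => by
    rw [integral_add (integrableOn_smul_Ioo hχ.continuous_deriv hf)
      (integrableOn_smul_Ioo hχ.smooth.continuous hg), H1 χ hχ, neg_add_cancel]
  have I1 : ∀ χ, IsBump α β χ → IntegrableOn (fun y => deriv χ y • f y + χ y • g y) (Set.Ioo α β) := fun χ hχ =>
    (integrableOn_smul_Ioo hχ.continuous_deriv hf).add (integrableOn_smul_Ioo hχ.smooth.continuous hg)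
  have I2 : ∀ χ, IsBump α β χ → IntegrableOn (fun y => (κ ^ 2 * χ y) • f y + deriv χ y • g y) (Set.Ioo α β) :=
    fun χ hχ => (integrableOn_smul_Ioo (continuous_const.mul hχ.smooth.continuous) hf).add
      (integrableOn_smul_Ioo hχ.continuous_deriv hg)
  have dmul : ∀ χ, IsBump α β χ → ∀ y, deriv (fun y => χ y * Ch y) y = deriv χ y * Ch y + χ y * (κ * Sh y) :=
    fun χ hχ y => ((hχ.hasDerivAt y).mul (dC y)).deriv
  have dmul' : ∀ χ, IsBump α β χ → ∀ y, deriv (fun y => χ y * Sh y) y = deriv χ y * Sh y + χ y * (κ * Ch y) :=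
    fun χ hχ y => ((hχ.hasDerivAt y).mul (dS y)).deriv
  -- Testing the second equation with ρ cosh and the first with ρ sinh, the terms containing ρ
  -- cancel in the second minus κ times the first, leaving ρ'(cosh · g - κ sinh · f).
  obtain ⟨b, hb⟩ := ae_eq_const_of_integral_deriv_bump hαβ (F := fun y => Ch y • g y - (κ * Sh y) • f y)
    ((integrableOn_smul_Ioo cC hg).sub (integrableOn_smul_Ioo (continuous_const.mul cS) hf)) fun ρ hρ => by
    have hc : IsBump α β fun y => ρ y * Ch y := hρ.mul (contDiff_cosh_shift κ α)
    have hs : IsBump α β fun y => ρ y * Sh y := hρ.mul (contDiff_sinh_shift κ α)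
    have e := integral_sub (I2 _ hc) ((I1 _ hs).smul κ)
    rw [H2' _ hc] at e
    simp only [Pi.smul_apply] at e
    rw [integral_smul, H1' _ hs, smul_zero, sub_zero] at e
    rw [← e]
    congr 1
    funext y
    rw [dmul ρ hρ, dmul' ρ hρ]
    simp only [Complex.real_smul]
    push_cast
    ring
  -- The companion first integral, with the roles of cosh and sinh exchanged.
  obtain ⟨a, ha⟩ := ae_eq_const_of_integral_deriv_bump hαβ (F := fun y => (κ * Ch y) • f y - Sh y • g y)
    ((integrableOn_smul_Ioo (continuous_const.mul cC) hf).sub (integrableOn_smul_Ioo cS hg)) fun ρ hρ => by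
    have hc : IsBump α β fun y => ρ y * Ch y := hρ.mul (contDiff_cosh_shift κ α)
    have hs : IsBump α β fun y => ρ y * Sh y := hρ.mul (contDiff_sinh_shift κ α)
    have e := integral_sub ((I1 _ hc).smul κ) (I2 _ hs)
    rw [H2' _ hs] at e
    simp only [Pi.smul_apply] at e
    rw [integral_smul, H1' _ hc, smul_zero, sub_zero] at e
    rw [← e]
    congr 1
    funext y
    rw [dmul ρ hρ, dmul' ρ hρ]
    simp only [Complex.real_smul]
    push_cast
    ring
  have hκ' : (κ : ℂ) ≠ 0 := by exact_mod_cast hκ.ne'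
  -- The two first integrals form a linear system for κf and g with determinant cosh² - sinh² = 1.
  have hfe : ∀ᵐ y, y ∈ Set.Ioo α β → f y = (Ch y * a + Sh y * b) / κ ∧ g y = Ch y * b + Sh y * a := by
    filter_upwards [ha, hb] with y h1 h2 hy
    have h1 := h1 hy
    have h2 := h2 hy
    simp only [Complex.real_smul] at h1 h2
    push_cast at h1 h2
    have h3 := hCS y
    constructor
    · rw [eq_div_iff hκ', ← h1, ← h2]
      linear_combination (-(f y) * κ) * h3
    · rw [← h1, ← h2]
      linear_combination (-(g y)) * h3
  -- The constant b is the boundary value of g at α. For a test function equal to 1 at α and 0 at β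
  -- the integrand is the derivative of B G, so the natural boundary condition reads -G(α) = -b = 0.
  have hb0 : b = 0 := by
    let B : ContDiffBump α := ⟨(β - α) / 4, (β - α) / 2, by linarith, by linarith⟩
    have hBs : tsupport B ⊆ Set.Iio β := by
      rw [B.tsupport_eq, Real.closedBall_eq_Icc]
      change Set.Icc (α - (β - α) / 2) (α + (β - α) / 2) ⊆ _
      exact fun y hy => by
        have := hy.2
        change y < β
        linarith
    have hBd : ∀ y, HasDerivAt B (deriv B y) y := fun y =>
      ((B.contDiff (n := 1)).differentiable (by simp) y).hasDerivAt
    have hBc : Continuous (deriv B) := (B.contDiff (n := 1)).continuous_deriv (by simp)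
    have h2 := H2 B B.contDiff hBs
    set G : ℝ → ℂ := fun y => (Ch y : ℂ) * b + Sh y * a with hG
    have dG : ∀ y, HasDerivAt G (κ * (Ch y * a + Sh y * b)) y := fun y => by
      have := ((dC y).ofReal_comp.mul_const b).add ((dS y).ofReal_comp.mul_const a)
      refine this.congr_deriv ?_
      push_cast; ring
    have dBG : ∀ y, HasDerivAt (fun y => B y • G y) (B y • (κ * (Ch y * a + Sh y * b)) + deriv B y • G y) y :=
      fun y => (hBd y).smul (dG y)
    have e : ∫ y in Set.Ioo α β, ((κ ^ 2 * B y) • f y + deriv B y • g y) =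
        ∫ y in Set.Ioo α β, (B y • (κ * (Ch y * a + Sh y * b)) + deriv B y • G y) := by
      refine setIntegral_congr_ae measurableSet_Ioo ?_
      filter_upwards [hfe] with y hy hy2
      obtain ⟨h3, h4⟩ := hy hy2
      rw [h3, h4]
      simp only [Complex.real_smul, hG]
      push_cast
      field_simp
    have cB := B.continuous
    rw [e, ← integral_Ioc_eq_integral_Ioo, ← intervalIntegral.integral_of_le hαβ.le,
      intervalIntegral.integral_eq_sub_of_hasDerivAt fun y _ => dBG y] at h2
    · have h3 : B β = 0 := image_eq_zero_of_notMem_tsupport fun hh => lt_irrefl β (hBs hh)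
      have h4 : B α = 1 := B.one_of_mem_closedBall (Metric.mem_closedBall_self B.rIn_pos.le)
      rw [h3, h4] at h2
      simpa [hG, hCh, hSh] using h2
    · refine Continuous.intervalIntegrable ?_ _ _
      fun_prop
  refine ⟨a / κ, ?_⟩
  filter_upwards [hfe] with y hy hy2
  rw [(hy hy2).1, hb0]
  simp only [mul_zero, add_zero]
  ring

end

/-! ### Fourier coefficients of horizontal slices in a strip. -/

section

variable {d : ℕ} {h : ℝ} {η : Horiz d → ℝ} {α β : ℝ}

/-- The part of a horizontal strip above the cell. -/
def strip (d : ℕ) (α β : ℝ) : Set (Horiz d × ℝ) := cell d ×ˢ Set.Ioo α β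

theorem measurableSet_strip (d : ℕ) (α β : ℝ) : MeasurableSet (strip d α β) :=
  (measurableSet_cell d).prod measurableSet_Ioo

theorem restrict_strip (d : ℕ) (α β : ℝ) : (volume : Measure (Horiz d × ℝ)).restrict (strip d α β) =
    (volume.restrict (cell d)).prod (volume.restrict (Set.Ioo α β)) := by
  rw [strip, Measure.volume_eq_prod, Measure.prod_restrict]

instance isFiniteMeasure_Ioo (α β : ℝ) : IsFiniteMeasure ((volume : Measure ℝ).restrict (Set.Ioo α β)) :=
  ⟨by rw [Measure.restrict_apply_univ, Real.volume_Ioo]; exact ENNReal.ofReal_lt_top⟩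

instance isFiniteMeasure_strip (d : ℕ) (α β : ℝ) :
    IsFiniteMeasure ((volume : Measure (Horiz d × ℝ)).restrict (strip d α β)) := by
  rw [restrict_strip]; infer_instance

/-- The Fourier coefficient of the slice of `u` at height `y`. -/
def sliceCoeff (u : Horiz d × ℝ → ℝ) (ξ : Fin d → ℤ) (y : ℝ) : ℂ := fc (fun x => (u (x, y) : ℂ)) ξ

/-- The integral of `u` over a strip against `χ(y) e^{-i x·ξ}`. -/
def stripPairing (α β : ℝ) (u : Horiz d × ℝ → ℝ) (χ : ℝ → ℝ) (ξ : Fin d → ℤ) : ℂ :=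
  ∫ p in strip d α β, ((χ p.2 * u p : ℝ) : ℂ) * expo (-ξ) p.1

section Slices

variable {u : Horiz d × ℝ → ℝ}

theorem integrable_expo_mul_strip (hu : IntegrableOn u (strip d α β)) (ξ : Fin d → ℤ) :
    IntegrableOn (fun p => expo (-ξ) p.1 * (u p : ℂ)) (strip d α β) := by
  have hc := continuous_expo (-ξ)
  exact hu.ofReal.bdd_mul (c := 1) (by fun_prop) (Eventually.of_forall fun p => (norm_expo _ _).le)

theorem integrableOn_sliceCoeff (hu : IntegrableOn u (strip d α β)) (ξ : Fin d → ℤ) :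
    IntegrableOn (sliceCoeff u ξ) (Set.Ioo α β) := by
  have h1 := integrable_expo_mul_strip hu ξ
  unfold IntegrableOn at h1
  rw [restrict_strip] at h1
  exact h1.integral_prod_right.const_mul _

theorem integrable_mul_strip (hu : IntegrableOn u (strip d α β)) {χ : ℝ → ℝ} (hχ : Continuous χ) :
    IntegrableOn (fun p => χ p.2 * u p) (strip d α β) := by
  obtain ⟨C, hC⟩ := isCompact_Icc.exists_bound_of_continuousOn (s := Set.Icc α β) hχ.continuousOn
  refine hu.bdd_mul (c := C) (by fun_prop) ?_
  exact (ae_restrict_iff' (measurableSet_strip d α β)).2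
    (Eventually.of_forall fun p hp => hC p.2 ⟨hp.2.1.le, hp.2.2.le⟩)

/-- Fubini; the power of 2π undoes the normalisation of the Fourier coefficient. An identity between
strip integrals thereby becomes a one-dimensional weak identity in y. -/
theorem stripPairing_eq (hu : IntegrableOn u (strip d α β)) {χ : ℝ → ℝ} (hχ : Continuous χ) (ξ : Fin d → ℤ) :
    stripPairing α β u χ ξ = (2 * Real.pi : ℂ) ^ d * ∫ y in Set.Ioo α β, χ y • sliceCoeff u ξ y := by
  have h1 := integrable_expo_mul_strip (integrable_mul_strip hu hχ) ξ
  unfold IntegrableOn at h1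
  have hpi : ((2 * Real.pi : ℂ) ^ d) ≠ 0 := by
    exact_mod_cast (two_pi_pow_pos d).ne'
  unfold stripPairing
  simp_rw [mul_comm _ (expo (-ξ) _)]
  rw [restrict_strip] at h1 ⊢
  rw [integral_prod_symm _ h1, ← integral_const_mul]
  refine integral_congr_ae (Eventually.of_forall fun y => ?_)
  simp only [sliceCoeff, fc, Complex.real_smul]
  rw [mul_left_comm _ (χ y : ℂ), mul_inv_cancel_left₀ hpi, ← integral_const_mul]
  refine integral_congr_ae (Eventually.of_forall fun x => ?_)
  push_cast
  ring

theorem stripPairing_re (hu : IntegrableOn u (strip d α β)) {χ : ℝ → ℝ} (hχ : Continuous χ) (ξ : Fin d → ℤ) :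
    (stripPairing α β u χ ξ).re = ∫ p in strip d α β, χ p.2 * u p * (expo (-ξ) p.1).re := by
  have h1 := integrable_expo_mul_strip (integrable_mul_strip hu hχ) ξ
  simp_rw [mul_comm (expo (-ξ) _)] at h1
  have := Complex.reCLM.integral_comp_comm h1
  simp only [Complex.reCLM_apply] at this
  rw [stripPairing, ← this]
  simp_rw [Complex.re_ofReal_mul]

theorem stripPairing_im (hu : IntegrableOn u (strip d α β)) {χ : ℝ → ℝ} (hχ : Continuous χ) (ξ : Fin d → ℤ) :
    (stripPairing α β u χ ξ).im = ∫ p in strip d α β, χ p.2 * u p * (expo (-ξ) p.1).im := by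
  have h1 := integrable_expo_mul_strip (integrable_mul_strip hu hχ) ξ
  simp_rw [mul_comm (expo (-ξ) _)] at h1
  have := Complex.imCLM.integral_comp_comm h1
  simp only [Complex.imCLM_apply] at this
  rw [stripPairing, ← this]
  simp_rw [Complex.im_ofReal_mul]

end Slices

/-- A smooth periodic function on the torus whose derivative is `a ↦ (a · ξ) T'`. -/
structure IsWave (ξ : Fin d → ℤ) (T T' : Horiz d → ℝ) : Prop where
  smooth : ContDiff ℝ ((⊤ : ℕ∞) : WithTop ℕ∞) T
  periodic : TorusPeriodic T
  periodic' : TorusPeriodic T'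
  continuous' : Continuous T'
  hasDeriv : ∀ x a, fderiv ℝ T x a = pairing ξ a * T' x

theorem contDiff_expo (ξ : Fin d → ℤ) : ContDiff ℝ ((⊤ : ℕ∞) : WithTop ℕ∞) (expo ξ) := by
  have h0 : ContDiff ℝ ((⊤ : ℕ∞) : WithTop ℕ∞) fun x : Horiz d => pairing ξ x := by
    unfold pairing
    fun_prop
  exact (contDiff_const.mul (Complex.ofRealCLM.contDiff.comp h0)).cexp

theorem fderiv_expo_neg (ξ : Fin d → ℤ) (x a : Horiz d) :
    fderiv ℝ (expo (-ξ)) x a = -(Complex.I * pairing ξ a * expo (-ξ) x) := by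
  have hd : HasLineDerivAt ℝ (expo (-ξ)) (fderiv ℝ (expo (-ξ)) x a) x a :=
    (((contDiff_expo (-ξ)).differentiable (by simp)) x).hasFDerivAt.hasLineDerivAt a
  have e : ∀ t : ℝ, expo (-ξ) (x + t • a) =
      Complex.exp (Complex.I * pairing (-ξ) x + (t : ℂ) * (Complex.I * pairing (-ξ) a)) := fun t => by
    rw [expo, pairing_add, pairing_smul]; push_cast; ring_nf
  have h1 : HasLineDerivAt ℝ (expo (-ξ)) (expo (-ξ) x * (Complex.I * pairing (-ξ) a)) x a := by
    unfold HasLineDerivAt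
    simp_rw [e]
    have h2 : HasDerivAt (fun t : ℝ => Complex.I * pairing (-ξ) x + (t : ℂ) * (Complex.I * pairing (-ξ) a))
        (1 * (Complex.I * pairing (-ξ) a)) 0 :=
      ((Complex.ofRealCLM.hasDerivAt (x := (0 : ℝ))).mul_const _).const_add _
    simpa [expo] using h2.cexp
  have hn : pairing (-ξ) a = -pairing ξ a := by simp [pairing]
  rw [← hd.lineDeriv, h1.lineDeriv, hn]
  push_cast
  ring

/-- Test functions are real, so e^{-ix·ξ} is tested through its real and imaginary parts; each is,
up to sign, the derivative profile of the other. -/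
theorem isWave_re (ξ : Fin d → ℤ) : IsWave ξ (fun x => (expo (-ξ) x).re) (fun x => (expo (-ξ) x).im) := by
  refine ⟨Complex.reCLM.contDiff.comp (contDiff_expo _), fun i x => ?_, fun i x => ?_,
    Complex.continuous_im.comp (continuous_expo _), fun x a => ?_⟩
  · simp only [expo_periodic _ i x]
  · simp only [expo_periodic _ i x]
  · have h1 := Complex.reCLM.hasFDerivAt.comp x
      (((contDiff_expo (-ξ)).differentiable (by simp)) x).hasFDerivAt
    have h2 : fderiv ℝ (fun x => (expo (-ξ) x).re) x = Complex.reCLM.comp (fderiv ℝ (expo (-ξ)) x) := h1.fderiv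
    rw [h2, ContinuousLinearMap.comp_apply, fderiv_expo_neg]
    simp

theorem isWave_im (ξ : Fin d → ℤ) : IsWave ξ (fun x => (expo (-ξ) x).im) (fun x => -(expo (-ξ) x).re) := by
  refine ⟨Complex.imCLM.contDiff.comp (contDiff_expo _), fun i x => ?_, fun i x => ?_,
    (Complex.continuous_re.comp (continuous_expo _)).neg, fun x a => ?_⟩
  · simp only [expo_periodic _ i x]
  · simp only [expo_periodic _ i x]
  · have h1 := Complex.imCLM.hasFDerivAt.comp x
      (((contDiff_expo (-ξ)).differentiable (by simp)) x).hasFDerivAt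
    have h2 : fderiv ℝ (fun x => (expo (-ξ) x).im) x = Complex.imCLM.comp (fderiv ℝ (expo (-ξ)) x) := h1.fderiv
    rw [h2, ContinuousLinearMap.comp_apply, fderiv_expo_neg]
    simp

/-! ### Products χ(y)T(x) as test functions. -/

section Wave

variable {ξ : Fin d → ℤ} {T T' : Horiz d → ℝ} {χ : ℝ → ℝ}

theorem IsWave.contDiff_mul (hT : IsWave ξ T T') (hχ : ContDiff ℝ ((⊤ : ℕ∞) : WithTop ℕ∞) χ) :
    ContDiff ℝ ((⊤ : ℕ∞) : WithTop ℕ∞) fun p : Horiz d × ℝ => χ p.2 * T p.1 :=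
  (hχ.comp contDiff_snd).mul (hT.smooth.comp contDiff_fst)

theorem IsWave.periodic_mul (hT : IsWave ξ T T') (χ : ℝ → ℝ) :
    HorizPeriodic fun p : Horiz d × ℝ => χ p.2 * T p.1 := fun y i x => by
  simp only [hT.periodic i x]

theorem IsWave.hasFDerivAt_mul (hT : IsWave ξ T T') (hχ : ContDiff ℝ ((⊤ : ℕ∞) : WithTop ℕ∞) χ)
    (p : Horiz d × ℝ) (a : Horiz d) (b : ℝ) :
    fderiv ℝ (fun p : Horiz d × ℝ => χ p.2 * T p.1) p (a, b) =
      deriv χ p.2 * b * T p.1 + χ p.2 * (pairing ξ a * T' p.1) := by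
  have h1 : HasFDerivAt (fun p : Horiz d × ℝ => χ p.2) (deriv χ p.2 • ContinuousLinearMap.snd ℝ (Horiz d) ℝ) p :=
    HasDerivAt.comp_hasFDerivAt p ((hχ.differentiable (by simp)) p.2).hasDerivAt hasFDerivAt_snd
  have h2 : HasFDerivAt (fun p : Horiz d × ℝ => T p.1)
      ((fderiv ℝ T p.1).comp (ContinuousLinearMap.fst ℝ (Horiz d) ℝ)) p :=
    ((hT.smooth.differentiable (by simp)) p.1).hasFDerivAt.comp p hasFDerivAt_fst
  have h3 := (h1.mul h2).fderiv
  change fderiv ℝ (fun p : Horiz d × ℝ => χ p.2 * T p.1) p = _ at h3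
  rw [h3]
  simp [hT.hasDeriv]
  ring

theorem strip_subset_fluidCell (hα : -h ≤ α) (hβ : ∀ x, β ≤ η x) : strip d α β ⊆ fluidCell h η := fun _ hp =>
  ⟨hp.1, hα.trans_lt hp.2.1, hp.2.2.trans_le (hβ _)⟩

theorem IsBump.eq_zero {χ : ℝ → ℝ} (hχ : IsBump α β χ) {y : ℝ} (hy : y ∉ Set.Ioo α β) : χ y = 0 :=
  image_eq_zero_of_notMem_tsupport fun hh => hy (hχ.supp hh)

theorem deriv_eq_zero_of_notMem_tsupport {χ : ℝ → ℝ} {y : ℝ} (hy : y ∉ tsupport χ) : deriv χ y = 0 := by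
  rw [← fderiv_apply_one_eq_deriv, fderiv_of_notMem_tsupport ℝ hy]; rfl

/-- A bump supported inside (α, β) keeps the product's support inside the fluid, so the integrals
over the fluid reduce to the strip. -/
theorem IsH1.weak_strip {u : Horiz d × ℝ → ℝ} {ux : Horiz d × ℝ → Horiz d} {uy : Horiz d × ℝ → ℝ}
    (hu : IsH1 h η u ux uy) (hη : Continuous η) (hα : -h ≤ α) (hβ : ∀ x, β ≤ η x) (hT : IsWave ξ T T')
    (hχ : IsBump α β χ) (a : Horiz d) (b : ℝ) :
    ∫ p in strip d α β, u p * (deriv χ p.2 * b * T p.1 + χ p.2 * (pairing ξ a * T' p.1)) =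
      -∫ p in strip d α β, (inner ℝ (ux p) a + uy p * b) * (χ p.2 * T p.1) := by
  have hs : tsupport (fun p : Horiz d × ℝ => χ p.2 * T p.1) ⊆ fluid h η := by
    have h1 : tsupport (fun p : Horiz d × ℝ => χ p.2 * T p.1) ⊆ Prod.snd ⁻¹' tsupport χ := by
      refine closure_minimal (fun p hp => subset_tsupport χ fun h0 => hp ?_)
        ((isClosed_tsupport χ).preimage continuous_snd)
      simp only [h0, zero_mul]
    intro p hp
    have h2 := hχ.supp (h1 hp)
    exact ⟨hα.trans_lt h2.1, h2.2.trans_le (hβ _)⟩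
  have h0 := hu.weak _ (hT.periodic_mul χ) (hT.contDiff_mul hχ.smooth) hs a b
  simp_rw [hT.hasFDerivAt_mul hχ.smooth] at h0
  have hz : ∀ p ∈ fluidCell h η \ strip d α β, χ p.2 = 0 ∧ deriv χ p.2 = 0 := fun p hp => by
    have h3 : p.2 ∉ Set.Ioo α β := fun hh => hp.2 ⟨hp.1.1, hh⟩
    exact ⟨hχ.eq_zero h3, deriv_eq_zero_of_notMem_tsupport fun hh => h3 (hχ.supp hh)⟩
  rw [setIntegral_eq_of_subset_of_forall_sdiff_eq_zero (measurableSet_fluidCell hη h)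
    (strip_subset_fluidCell hα hβ), setIntegral_eq_of_subset_of_forall_sdiff_eq_zero
    (measurableSet_fluidCell hη h) (strip_subset_fluidCell hα hβ)] at h0
  · exact h0
  · intro p hp
    rw [(hz p hp).1]; ring
  · intro p hp
    rw [(hz p hp).1, (hz p hp).2]; ring

/-- A frequency as a horizontal vector. -/
def freqVec (ξ : Fin d → ℤ) : Horiz d := WithLp.toLp 2 fun j => (ξ j : ℝ)

theorem inner_freqVec (ξ : Fin d → ℤ) (a : Horiz d) : inner ℝ (freqVec ξ) a = pairing ξ a := by
  rw [PiLp.inner_apply]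
  simp [freqVec, pairing]

theorem memLp_fluidCell_of_continuous {F : Type*} [NormedAddCommGroup F] {f : Horiz d × ℝ → F}
    (hf : Continuous f) (hη : Continuous η) {M : ℝ} (hM : ∀ x, |η x| ≤ M) :
    MemLp f 2 (volume.restrict (fluidCell h η)) := by
  have := isFiniteMeasure_fluidCell hM h
  obtain ⟨r, -, hr⟩ := exists_ball d (max |h| M)
  obtain ⟨C, hC⟩ := (isCompact_closedBall (0 : Horiz d × ℝ) r).exists_bound_of_continuousOn hf.continuousOn
  refine MemLp.of_bound hf.aestronglyMeasurable C ((ae_restrict_iff' (measurableSet_fluidCell hη h)).2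
    (Eventually.of_forall fun p hp => hC p (hr p hp.1 ?_)))
  by_contra hcon
  exact notMem_fluid_of_lt hM (not_le.1 hcon) hp.2

theorem IsWave.isH1_mul (hT : IsWave ξ T T') (hχ : ContDiff ℝ ((⊤ : ℕ∞) : WithTop ℕ∞) χ) (hη : Continuous η)
    {M : ℝ} (hM : ∀ x, |η x| ≤ M) (h : ℝ) : IsH1 h η (fun p => χ p.2 * T p.1)
      (fun p => (χ p.2 * T' p.1) • freqVec ξ) (fun p => deriv χ p.2 * T p.1) := by
  have c1 := hχ.continuous
  have c2 := hT.smooth.continuous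
  have c3 := hT.continuous'
  have c4 : Continuous (deriv χ) := hχ.continuous_deriv (by simp)
  refine IsH1.of_locallyLipschitz hη hM (hT.periodic_mul χ) (fun y i x => ?_) (hT.periodic_mul _)
    (memLp_fluidCell_of_continuous (by fun_prop) hη hM) (memLp_fluidCell_of_continuous (by fun_prop) hη hM)
    (memLp_fluidCell_of_continuous (by fun_prop) hη hM)
    ((hT.contDiff_mul hχ).of_le (by exact_mod_cast le_top) : ContDiff ℝ 1 _).locallyLipschitz
    (Eventually.of_forall fun p a b => ?_)
  · simp only [hT.periodic' i x]
  · have h1 := (((hT.contDiff_mul hχ).differentiable (by simp)) p).hasFDerivAt.hasLineDerivAt (a, b)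
    rw [hT.hasFDerivAt_mul hχ] at h1
    have e : inner ℝ ((χ p.2 * T' p.1) • freqVec ξ) a + deriv χ p.2 * T p.1 * b =
        deriv χ p.2 * b * T p.1 + χ p.2 * (pairing ξ a * T' p.1) := by
      rw [inner_smul_left, inner_freqVec]
      simp only [conj_trivial]
      ring
    rw [e]
    exact h1

/-- Only the top of the strip constrains χ, and nothing is imposed at y = -h: this is where the
Neumann condition enters. The margin δ makes the product vanish identically near the surface, so its
trace is zero. -/
theorem IsVariationalSolution.variational_strip {ψ : Horiz d → ℝ} {φ : Horiz d × ℝ → ℝ}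
    {φx : Horiz d × ℝ → Horiz d} {φy : Horiz d × ℝ → ℝ} (hφ : IsVariationalSolution h η ψ φ φx φy)
    (hη : Continuous η) {M : ℝ} (hM : ∀ x, |η x| ≤ M) {δ : ℝ} (hδ : 0 < δ) (hβ : ∀ x, β + δ ≤ η x)
    (hT : IsWave ξ T T') (hχ : ContDiff ℝ ((⊤ : ℕ∞) : WithTop ℕ∞) χ) (hs : tsupport χ ⊆ Set.Iio β) :
    ∫ p in strip d (-h) β, (χ p.2 * inner ℝ (φx p) (freqVec ξ) * T' p.1 + deriv χ p.2 * φy p * T p.1) = 0 := by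
  have hz : ∀ y, β ≤ y → χ y = 0 ∧ deriv χ y = 0 := fun y hy =>
    ⟨image_eq_zero_of_notMem_tsupport fun hh => absurd (hs hh) (not_lt.2 hy),
      deriv_eq_zero_of_notMem_tsupport fun hh => absurd (hs hh) (not_lt.2 hy)⟩
  have htr : HasSurfaceTrace η (fun p => χ p.2 * T p.1) fun _ => 0 := by
    refine HasGraphTrace.of_lintegral_le (s₀ := δ) (A := 0) hδ ?_ (Eventually.of_forall fun s hs => ?_)
    · have c1 := hχ.continuous
      have c2 := hT.smooth.continuous
      exact (by fun_prop : Continuous fun p : Horiz d × ℝ =>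
        ‖χ (η p.1 + -1 * p.2) * T p.1 - 0‖ₑ ^ 2).measurable.aemeasurable
    · have h1 : ∀ x, χ (η x + -1 * s) = 0 := fun x => (hz _ (by
        have := hβ x
        have := hs.2
        linarith)).1
      simp_rw [h1]
      simp
  have h0 := hφ.variational _ _ _ (hT.isH1_mul hχ hη hM h) htr
  rw [setIntegral_eq_of_subset_of_forall_sdiff_eq_zero (measurableSet_fluidCell hη h)
    (strip_subset_fluidCell (α := -h) (β := β) le_rfl fun x => by have := hβ x; linarith)] at h0
  · rw [← h0]
    refine integral_congr_ae (Eventually.of_forall fun p => ?_)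
    simp only [inner_smul_right]
    ring
  · rintro p ⟨h1, h2⟩
    have h3 : β ≤ p.2 := by
      by_contra hcon
      exact h2 ⟨h1.1, h1.2.1, not_le.1 hcon⟩
    simp [hz _ h3]

end Wave

/-! ### The modes of the solution. -/

section Coefficients

variable {ψ : Horiz d → ℝ} {φ : Horiz d × ℝ → ℝ} {φx : Horiz d × ℝ → Horiz d} {φy : Horiz d × ℝ → ℝ}

theorem memLp_inner_const {α : Type*} [MeasurableSpace α] {μ : Measure α} {f : α → Horiz d} (hf : MemLp f 2 μ)
    (a : Horiz d) : MemLp (fun p => inner ℝ (f p) a) 2 μ :=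
  (hf.norm.mul_const ‖a‖).mono (hf.1.inner aestronglyMeasurable_const)
    (Eventually.of_forall fun p => by simpa using abs_real_inner_le_norm (f p) a)

theorem integrableOn_strip_of_memLp {u : Horiz d × ℝ → ℝ} (hα : -h ≤ α) (hβ : ∀ x, β ≤ η x)
    (hu : MemLp u 2 (volume.restrict (fluidCell h η))) : IntegrableOn u (strip d α β) :=
  (hu.mono_measure (Measure.restrict_mono (strip_subset_fluidCell hα hβ) le_rfl)).integrable one_le_two

theorem IsH1.stripPairing_y (hφ : IsH1 h η φ φx φy) (hη : Continuous η) (hα : -h ≤ α) (hβ : ∀ x, β ≤ η x)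
    {χ : ℝ → ℝ} (hχ : IsBump α β χ) (ξ : Fin d → ℤ) :
    stripPairing α β φ (deriv χ) ξ = -stripPairing α β φy χ ξ := by
  have i1 := integrableOn_strip_of_memLp hα hβ hφ.memLp
  have i2 := integrableOn_strip_of_memLp hα hβ hφ.memLp_y
  have h1 := hφ.weak_strip hη hα hβ (isWave_re ξ) hχ 0 1
  have h2 := hφ.weak_strip hη hα hβ (isWave_im ξ) hχ 0 1
  have hp : pairing ξ (0 : Horiz d) = 0 := by simp [pairing]
  simp only [hp, inner_zero_right, zero_mul, mul_zero, add_zero, zero_add, mul_one] at h1 h2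
  refine Complex.ext ?_ ?_
  · rw [Complex.neg_re, stripPairing_re i1 hχ.continuous_deriv, stripPairing_re i2 hχ.smooth.continuous]
    calc _ = _ := integral_congr_ae (Eventually.of_forall fun p => by ring)
      _ = _ := h1
      _ = _ := congrArg _ (integral_congr_ae (Eventually.of_forall fun p => by simp only; ring))
  · rw [Complex.neg_im, stripPairing_im i1 hχ.continuous_deriv, stripPairing_im i2 hχ.smooth.continuous]
    calc _ = _ := integral_congr_ae (Eventually.of_forall fun p => by ring)
      _ = _ := h2
      _ = _ := congrArg _ (integral_congr_ae (Eventually.of_forall fun p => by simp only; ring))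

theorem IsH1.stripPairing_x (hφ : IsH1 h η φ φx φy) (hη : Continuous η) (hα : -h ≤ α) (hβ : ∀ x, β ≤ η x)
    {χ : ℝ → ℝ} (hχ : IsBump α β χ) (ξ : Fin d → ℤ) (a : Horiz d) :
    stripPairing α β (fun p => inner ℝ (φx p) a) χ ξ = Complex.I * pairing ξ a * stripPairing α β φ χ ξ := by
  have i1 := integrableOn_strip_of_memLp hα hβ hφ.memLp
  have i2 := integrableOn_strip_of_memLp hα hβ (memLp_inner_const hφ.memLp_x a)
  have h1 := hφ.weak_strip hη hα hβ (isWave_re ξ) hχ a 0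
  have h2 := hφ.weak_strip hη hα hβ (isWave_im ξ) hχ a 0
  simp only [zero_mul, mul_zero, add_zero, zero_add] at h1 h2
  have c1 := hχ.smooth.continuous
  have e1 : pairing ξ a * (stripPairing α β φ χ ξ).im =
      -(stripPairing α β (fun p => inner ℝ (φx p) a) χ ξ).re := by
    rw [stripPairing_im i1 c1, stripPairing_re i2 c1, ← integral_const_mul]
    calc _ = _ := integral_congr_ae (Eventually.of_forall fun p => by ring)
      _ = _ := h1
      _ = _ := congrArg _ (integral_congr_ae (Eventually.of_forall fun p => by simp only; ring))
  have e2 : -pairing ξ a * (stripPairing α β φ χ ξ).re =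
      -(stripPairing α β (fun p => inner ℝ (φx p) a) χ ξ).im := by
    rw [stripPairing_re i1 c1, stripPairing_im i2 c1, ← integral_const_mul]
    calc _ = _ := integral_congr_ae (Eventually.of_forall fun p => by ring)
      _ = _ := h2
      _ = _ := congrArg _ (integral_congr_ae (Eventually.of_forall fun p => by simp only; ring))
  refine Complex.ext ?_ ?_
  · simp; linarith
  · simp; linarith

theorem IsVariationalSolution.stripPairing_eq (hφ : IsVariationalSolution h η ψ φ φx φy)
    (hη : Continuous η) {M : ℝ} (hM : ∀ x, |η x| ≤ M) {δ : ℝ} (hδ : 0 < δ) (hβ : ∀ x, β + δ ≤ η x)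
    {χ : ℝ → ℝ} (hχ : ContDiff ℝ ((⊤ : ℕ∞) : WithTop ℕ∞) χ) (hs : tsupport χ ⊆ Set.Iio β) (ξ : Fin d → ℤ) :
    stripPairing (-h) β φy (deriv χ) ξ =
      Complex.I * stripPairing (-h) β (fun p => inner ℝ (φx p) (freqVec ξ)) χ ξ := by
  have hβ' : ∀ x, β ≤ η x := fun x => by have := hβ x; linarith
  have i1 := integrableOn_strip_of_memLp (α := -h) le_rfl hβ' hφ.isH1.memLp_y
  have i2 := integrableOn_strip_of_memLp (α := -h) le_rfl hβ' (memLp_inner_const hφ.isH1.memLp_x (freqVec ξ))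
  have c1 := hχ.continuous
  have c2 : Continuous (deriv χ) := hχ.continuous_deriv (by simp)
  have hb : ∀ {u : Horiz d × ℝ → ℝ} {k : ℝ → ℝ} {S : Horiz d → ℝ}, IntegrableOn u (strip d (-h) β) → Continuous k →
      Continuous S → (∀ x, |S x| ≤ 1) → IntegrableOn (fun p => k p.2 * u p * S p.1) (strip d (-h) β) :=
    fun hu hk hS hS1 => (integrable_mul_strip hu hk).mul_bdd (c := 1) (by fun_prop)
      (Eventually.of_forall fun p => hS1 p.1)
  have hre : Continuous fun x : Horiz d => (expo (-ξ) x).re := Complex.continuous_re.comp (continuous_expo _)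
  have him : Continuous fun x : Horiz d => (expo (-ξ) x).im := Complex.continuous_im.comp (continuous_expo _)
  have hre1 : ∀ x : Horiz d, |(expo (-ξ) x).re| ≤ 1 := fun x =>
    (Complex.abs_re_le_norm _).trans (norm_expo _ _).le
  have him1 : ∀ x : Horiz d, |(expo (-ξ) x).im| ≤ 1 := fun x =>
    (Complex.abs_im_le_norm _).trans (norm_expo _ _).le
  have h1 := hφ.variational_strip hη hM hδ hβ (isWave_re ξ) hχ hs
  have h2 := hφ.variational_strip hη hM hδ hβ (isWave_im ξ) hχ hs
  rw [integral_add (hb i2 c1 him him1) (hb i1 c2 hre hre1), ← stripPairing_im i2 c1,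
    ← stripPairing_re i1 c2] at h1
  simp_rw [mul_neg] at h2
  have hn : IntegrableOn (fun p => -(χ p.2 * inner ℝ (φx p) (freqVec ξ) * (expo (-ξ) p.1).re)) (strip d (-h) β) :=
    (hb i2 c1 hre hre1).neg
  rw [integral_add hn (hb i1 c2 him him1), integral_neg, ← stripPairing_re i2 c1,
    ← stripPairing_im i1 c2] at h2
  refine Complex.ext ?_ ?_
  · simp; linarith
  · simp; linarith

/-- The integrated identity against every bump in y, localised to almost every height. -/
theorem IsH1.ae_sliceCoeff_x (hφ : IsH1 h η φ φx φy) (hη : Continuous η) (hα : -h ≤ α) (hβ : ∀ x, β ≤ η x)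
    (ξ : Fin d → ℤ) (a : Horiz d) : ∀ᵐ y, y ∈ Set.Ioo α β →
      sliceCoeff (fun p => inner ℝ (φx p) a) ξ y = Complex.I * pairing ξ a * sliceCoeff φ ξ y := by
  have i1 := integrableOn_strip_of_memLp hα hβ hφ.memLp
  have i2 := integrableOn_strip_of_memLp hα hβ (memLp_inner_const hφ.memLp_x a)
  have s1 := integrableOn_sliceCoeff i1 ξ
  have s2 := integrableOn_sliceCoeff i2 ξ
  have hpi : ((2 * Real.pi : ℂ) ^ d) ≠ 0 := by exact_mod_cast (two_pi_pow_pos d).ne'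
  have key := ae_eq_zero_of_integral_bump (s2.sub (s1.const_mul (Complex.I * pairing ξ a))) fun χ hχ => ?_
  · filter_upwards [key] with y hy hy2
    exact sub_eq_zero.1 (hy hy2)
  · have c1 := hχ.smooth.continuous
    have h1 := hφ.stripPairing_x hη hα hβ hχ ξ a
    rw [BottomTrace.stripPairing_eq i1 c1, BottomTrace.stripPairing_eq i2 c1, mul_left_comm] at h1
    have h2 := mul_left_cancel₀ hpi h1
    have e : ∀ y, χ y • (sliceCoeff (fun p => inner ℝ (φx p) a) ξ - fun y =>
        Complex.I * pairing ξ a * sliceCoeff φ ξ y) y = χ y • sliceCoeff (fun p => inner ℝ (φx p) a) ξ y -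
        χ y • (Complex.I * pairing ξ a * sliceCoeff φ ξ y) := fun y => smul_sub _ _ _
    refine (integral_congr_ae (Eventually.of_forall e)).trans ?_
    rw [integral_sub (integrableOn_smul_Ioo c1 s2) (integrableOn_smul_Ioo c1 (s1.const_mul _)), h2]
    rw [← integral_const_mul, sub_eq_zero]
    exact integral_congr_ae (Eventually.of_forall fun y => mul_smul_comm _ _ _)

/-- On a strip below the surface the modes of the solution are multiples of `cosh (|ξ| (y + h))`. -/
theorem IsVariationalSolution.ae_sliceCoeff_eq (hφ : IsVariationalSolution h η ψ φ φx φy)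
    (hη : Continuous η) {M : ℝ} (hM : ∀ x, |η x| ≤ M) {δ : ℝ} (hδ : 0 < δ) (hβ : ∀ x, β + δ ≤ η x)
    (hhβ : -h < β) {ξ : Fin d → ℤ} (hξ : ξ ≠ 0) : ∃ A : ℂ, ∀ᵐ y, y ∈ Set.Ioo (-h) β →
      sliceCoeff φ ξ y = (Real.cosh (freqNorm ξ * (y - -h)) : ℂ) * A := by
  have hβ' : ∀ x, β ≤ η x := fun x => by have := hβ x; linarith
  have i1 := integrableOn_strip_of_memLp (α := -h) le_rfl hβ' hφ.isH1.memLp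
  have i2 := integrableOn_strip_of_memLp (α := -h) le_rfl hβ' hφ.isH1.memLp_y
  have i3 := integrableOn_strip_of_memLp (α := -h) le_rfl hβ' (memLp_inner_const hφ.isH1.memLp_x (freqVec ξ))
  have s1 := integrableOn_sliceCoeff i1 ξ
  have s2 := integrableOn_sliceCoeff i2 ξ
  have hpi : ((2 * Real.pi : ℂ) ^ d) ≠ 0 := by exact_mod_cast (two_pi_pow_pos d).ne'
  refine ae_eq_cosh hhβ (zero_lt_one.trans_le (one_le_freqNorm hξ)) s1 s2 (fun χ hχ => ?_) fun χ hχ hs => ?_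
  · have h1 := hφ.isH1.stripPairing_y hη le_rfl hβ' hχ ξ
    rw [BottomTrace.stripPairing_eq i1 hχ.continuous_deriv, BottomTrace.stripPairing_eq i2 hχ.smooth.continuous,
      ← mul_neg] at h1
    exact mul_left_cancel₀ hpi h1
  · have c1 := hχ.continuous
    have c2 : Continuous (deriv χ) := hχ.continuous_deriv (by simp)
    have h1 := hφ.stripPairing_eq hη hM hδ hβ hχ hs ξ
    rw [BottomTrace.stripPairing_eq i2 c2, BottomTrace.stripPairing_eq i3 c1, mul_left_comm] at h1
    have h2 := mul_left_cancel₀ hpi h1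
    have hp : pairing ξ (freqVec ξ) = freqNorm ξ ^ 2 := by
      rw [freqNorm_sq]
      simp [pairing, freqVec, sq]
    -- The Fourier coefficient of ∇_xφ·ξ is i|ξ|² times that of φ. The other factor i in `h1` turns
    -- this into -|ξ|², so the equation is g' = |ξ|² f in weak form.
    have hk : ∫ y in Set.Ioo (-h) β, χ y • sliceCoeff (fun p => inner ℝ (φx p) (freqVec ξ)) ξ y =
        Complex.I * ∫ y in Set.Ioo (-h) β, (freqNorm ξ ^ 2 * χ y) • sliceCoeff φ ξ y := by
      rw [← integral_const_mul]
      refine setIntegral_congr_ae measurableSet_Ioo ?_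
      filter_upwards [hφ.isH1.ae_sliceCoeff_x hη le_rfl hβ' ξ (freqVec ξ)] with y hy hy2
      rw [hy hy2, hp]
      simp only [Complex.real_smul]
      push_cast
      ring
    have c3 : Continuous fun y => freqNorm ξ ^ 2 * χ y := continuous_const.mul c1
    rw [integral_add (integrableOn_smul_Ioo c3 s1) (integrableOn_smul_Ioo c2 s2), h2, hk,
      ← mul_assoc, Complex.I_mul_I]
    ring

/-- There are countably many frequencies, so one null set of heights serves all of them. The value
of A at ξ = 0 is irrelevant, since the horizontal derivative of that mode vanishes. -/
theorem IsVariationalSolution.exists_coeff (hφ : IsVariationalSolution h η ψ φ φx φy)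
    (hη : Continuous η) {M : ℝ} (hM : ∀ x, |η x| ≤ M) {δ : ℝ} (hδ : 0 < δ) (hβ : ∀ x, β + δ ≤ η x)
    (hhβ : -h < β) : ∃ A : (Fin d → ℤ) → ℂ, ∀ᵐ y, y ∈ Set.Ioo (-h) β → ∀ ξ j,
      sliceCoeff (fun p => φx p j) ξ y = dirCoeff A j ξ * (Real.cosh (freqNorm ξ * (y + h)) : ℂ) := by
  have hβ' : ∀ x, β ≤ η x := fun x => by have := hβ x; linarith
  have h1 : ∀ ξ : Fin d → ℤ, ∃ A : ℂ, ξ ≠ 0 → ∀ᵐ y, y ∈ Set.Ioo (-h) β →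
      sliceCoeff φ ξ y = (Real.cosh (freqNorm ξ * (y - -h)) : ℂ) * A := fun ξ => by
    by_cases hξ : ξ = 0
    · exact ⟨0, fun hh => absurd hξ hh⟩
    · obtain ⟨A, hA⟩ := hφ.ae_sliceCoeff_eq hη hM hδ hβ hhβ hξ
      exact ⟨A, fun _ => hA⟩
  choose A hA using h1
  refine ⟨A, ?_⟩
  have hA' : ∀ᵐ y, ∀ ξ : Fin d → ℤ, ξ ≠ 0 → y ∈ Set.Ioo (-h) β →
      sliceCoeff φ ξ y = (Real.cosh (freqNorm ξ * (y - -h)) : ℂ) * A ξ := by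
    refine ae_all_iff.2 fun ξ => ?_
    by_cases hξ : ξ = 0
    · exact Eventually.of_forall fun y hh => absurd hξ hh
    · filter_upwards [hA ξ hξ] with y hy _ using hy
  have hX : ∀ᵐ y, ∀ (ξ : Fin d → ℤ) (j : Fin d), y ∈ Set.Ioo (-h) β →
      sliceCoeff (fun p => inner ℝ (φx p) (EuclideanSpace.single j 1)) ξ y =
        Complex.I * pairing ξ (EuclideanSpace.single j (1 : ℝ)) * sliceCoeff φ ξ y :=
    ae_all_iff.2 fun ξ => ae_all_iff.2 fun j => hφ.isH1.ae_sliceCoeff_x hη le_rfl hβ' ξ _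
  filter_upwards [hA', hX] with y hy1 hy2 hy ξ j
  have h3 := hy2 ξ j hy
  have e1 : (fun p => inner ℝ (φx p) (EuclideanSpace.single j (1 : ℝ))) = fun p => φx p j := by
    funext p
    rw [EuclideanSpace.inner_single_right]; simp
  rw [e1, pairing_single] at h3
  rw [h3, dirCoeff]
  by_cases hξ : ξ = 0
  · simp [hξ]
  · rw [hy1 ξ hξ hy, sub_neg_eq_add]
    push_cast
    ring

end Coefficients

end

/-! ### The bottom trace and its exponential decay. -/

section

variable {d : ℕ} {h : ℝ} {η : Horiz d → ℝ} {β : ℝ}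

theorem exp_mul_le {r : ℝ} (h0 : 0 ≤ r) (h1 : r ≤ 1) (t : ℝ) : Real.exp (r * t) ≤ r * Real.exp t + (1 - r) := by
  have := convexOn_exp.2 (Set.mem_univ t) (Set.mem_univ 0) h0 (sub_nonneg.2 h1) (by ring)
  simpa using this

/-- Convexity of cosh between 0 and t. With r the ratio of two heights, it yields the linear rate at
which slices approach the bottom. -/
theorem cosh_mul_sub_one_le {r : ℝ} (h0 : 0 ≤ r) (h1 : r ≤ 1) (t : ℝ) :
    Real.cosh (r * t) - 1 ≤ r * (Real.cosh t - 1) := by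
  have e1 := exp_mul_le h0 h1 t
  have e2 := exp_mul_le h0 h1 (-t)
  rw [mul_neg] at e2
  rw [Real.cosh_eq, Real.cosh_eq]
  linarith

theorem exp_div_two_le_cosh (t : ℝ) : Real.exp t / 2 ≤ Real.cosh t := by
  rw [Real.cosh_eq]
  have := Real.exp_pos (-t)
  linarith

/-- Parseval's identity for finite families. -/
theorem hasSum_sum_sq_fc {W : Fin d → Horiz d → ℂ} (hW : ∀ j, MemLp (W j) 2 (volume.restrict (cell d))) :
    HasSum (fun ξ => ∑ j, ‖fc (W j) ξ‖ ^ 2) (((2 * Real.pi) ^ d)⁻¹ * ∑ j, ∫ x in cell d, ‖W j x‖ ^ 2) := by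
  rw [Finset.mul_sum]
  exact hasSum_sum fun j _ => hasSum_sq_fc (hW j)

theorem integral_norm_sq_le_tsum {V : Horiz d → Horiz d} {W : Fin d → Horiz d → ℂ}
    (hV : MemLp V 2 (volume.restrict (cell d))) (hW : ∀ j, MemLp (W j) 2 (volume.restrict (cell d)))
    (hVW : ∀ x j, V x j = (W j x).re) :
    ∫ x in cell d, ‖V x‖ ^ 2 ≤ (2 * Real.pi) ^ d * ∑' ξ, ∑ j, ‖fc (W j) ξ‖ ^ 2 := by
  rw [(hasSum_sum_sq_fc hW).tsum_eq, mul_inv_cancel_left₀ (two_pi_pow_pos d).ne', ← integral_finsetSum _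
    fun j _ => (hW j).norm.integrable_sq]
  refine integral_mono hV.norm.integrable_sq (integrable_finsetSum _ fun j _ => (hW j).norm.integrable_sq)
    fun x => ?_
  simp only
  rw [EuclideanSpace.norm_sq_eq]
  refine Finset.sum_le_sum fun j _ => pow_le_pow_left₀ (norm_nonneg _) ?_ 2
  rw [hVW, Real.norm_eq_abs]
  exact Complex.abs_re_le_norm _

theorem MemLp.apply_ofReal {α : Type*} [MeasurableSpace α] {μ : Measure α} {V : α → Horiz d} (hV : MemLp V 2 μ)
    (j : Fin d) : MemLp (fun x => ((V x j : ℝ) : ℂ)) 2 μ := by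
  have := memLp_inner_const hV (EuclideanSpace.single j (1 : ℝ))
  have h2 : MemLp (fun x => V x j) 2 μ := by simpa [EuclideanSpace.inner_single_right] using this
  exact h2.ofReal

theorem integral_norm_sq_eq_sum {V : Horiz d → Horiz d} (hV : MemLp V 2 (volume.restrict (cell d))) :
    ∫ x in cell d, ‖V x‖ ^ 2 = ∑ j, ∫ x in cell d, ‖((V x j : ℝ) : ℂ)‖ ^ 2 := by
  rw [← integral_finsetSum Finset.univ fun j _ => (MemLp.apply_ofReal hV j).norm.integrable_sq]
  refine integral_congr_ae (Eventually.of_forall fun x => ?_)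
  simp only [EuclideanSpace.norm_sq_eq, Complex.norm_real]

/-- Almost every horizontal slice of a square integrable field is square integrable. -/
theorem ae_memLp_slice {α : ℝ} {V : Horiz d × ℝ → Horiz d} (hV : MemLp V 2 (volume.restrict (strip d α β))) :
    ∀ᵐ y, y ∈ Set.Ioo α β → MemLp (fun x => V (x, y)) 2 (volume.restrict (cell d)) := by
  have h1 := hV.integrable one_le_two
  have h2 := hV.norm.integrable_sq
  rw [restrict_strip] at h1 h2
  have h3 := (ae_restrict_iff' measurableSet_Ioo).1 h1.prod_left_ae
  have h4 := (ae_restrict_iff' measurableSet_Ioo).1 h2.prod_left_ae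
  filter_upwards [h3, h4] with y h5 h6 hy
  exact (memLp_two_iff_integrable_sq_norm (h5 hy).1).2 (h6 hy)

/-- A height in the upper half of a strip at which a property valid almost everywhere holds and the
slice is at most twice the average. -/
theorem exists_good_slice {α : ℝ} (hαβ : α < β) {V : Horiz d × ℝ → Horiz d}
    (hV : MemLp V 2 (volume.restrict (strip d α β))) {P : ℝ → Prop} (hP : ∀ᵐ y, y ∈ Set.Ioo α β → P y) :
    ∃ y, (α + β) / 2 < y ∧ y < β ∧ P y ∧
      ∫ x in cell d, ‖V (x, y)‖ ^ 2 ≤ 2 / (β - α) * ∫ p in strip d α β, ‖V p‖ ^ 2 := by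
  have h2 := hV.norm.integrable_sq
  have hsub : Set.Ioo ((α + β) / 2) β ⊆ Set.Ioo α β := fun y hy => ⟨by linarith [hy.1], hy.2⟩
  have hint : IntegrableOn (fun y => ∫ x in cell d, ‖V (x, y)‖ ^ 2) (Set.Ioo α β) := by
    have := h2
    rw [restrict_strip] at this
    exact this.integral_prod_right
  have htot : ∫ y in Set.Ioo α β, ∫ x in cell d, ‖V (x, y)‖ ^ 2 = ∫ p in strip d α β, ‖V p‖ ^ 2 := by
    have h3 := h2
    rw [restrict_strip] at h3 ⊢
    rw [integral_prod_symm _ h3]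
  set N : Set ℝ := {y | ¬(y ∈ Set.Ioo ((α + β) / 2) β ∧ P y)} with hN
  have hN0 : (volume.restrict (Set.Ioo ((α + β) / 2) β)) N = 0 := by
    have : ∀ᵐ y ∂volume.restrict (Set.Ioo ((α + β) / 2) β), y ∈ Set.Ioo ((α + β) / 2) β ∧ P y := by
      refine (ae_restrict_iff' measurableSet_Ioo).2 ?_
      filter_upwards [hP] with y hy hy2 using ⟨hy2, hy (hsub hy2)⟩
    exact this
  have hpos : 0 < β - (α + β) / 2 := by linarith
  have hμ : (volume.restrict (Set.Ioo ((α + β) / 2) β)) ≠ 0 := by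
    rw [Ne, Measure.restrict_eq_zero, Real.volume_Ioo, ENNReal.ofReal_eq_zero]
    linarith
  -- The upper half has length (β - α)/2, hence the factor 2/(β - α) once its integral is bounded by
  -- that over the whole strip.
  obtain ⟨y, hy, hle⟩ := exists_notMem_null_le_average hμ (hint.mono_set hsub) hN0
  have hy' : y ∈ Set.Ioo ((α + β) / 2) β ∧ P y := by
    by_contra hcon
    exact hy hcon
  refine ⟨y, hy'.1.1, hy'.1.2, hy'.2, hle.trans ?_⟩
  rw [average_eq, measureReal_restrict_apply_univ, Real.volume_real_Ioo_of_le (by linarith), smul_eq_mul]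
  have e : (β - (α + β) / 2)⁻¹ = 2 / (β - α) := by
    have : β - α ≠ 0 := by linarith
    have : β - (α + β) / 2 = (β - α) / 2 := by ring
    rw [this, inv_div]
  rw [e]
  have h0 : 0 ≤ 2 / (β - α) := div_nonneg (by norm_num) (by linarith)
  refine mul_le_mul_of_nonneg_left ?_ h0
  rw [← htot]
  exact setIntegral_mono_set hint (Eventually.of_forall fun y => integral_nonneg fun x => by positivity)
    (Eventually.of_forall hsub)

theorem aestronglyMeasurable_shift {F : Type*} [NormedAddCommGroup F] {V : Horiz d × ℝ → F} {s₀ : ℝ}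
    (hs : -h + s₀ ≤ β) (hV : AEStronglyMeasurable V (volume.restrict (strip d (-h) β))) :
    AEStronglyMeasurable (fun p : Horiz d × ℝ => V (p.1, -h + 1 * p.2)) (volume.restrict (cell d ×ˢ Set.Ioo 0 s₀)) := by
  have hT : MeasurePreserving (fun p : Horiz d × ℝ => ((0 : Horiz d), -h) + p) volume volume :=
    haveI : (volume : Measure (Horiz d × ℝ)).IsAddLeftInvariant := by
      rw [Measure.volume_eq_prod]
      infer_instance
    measurePreserving_add_left volume _
  have h1 := hV.comp_measurePreserving (hT.restrict_preimage (measurableSet_strip d (-h) β))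
  have h2 : V ∘ (fun p : Horiz d × ℝ => ((0 : Horiz d), -h) + p) = fun p : Horiz d × ℝ => V (p.1, -h + 1 * p.2) := by
    funext p
    simp only [Function.comp_apply]
    congr 1
    refine Prod.ext ?_ ?_
    · simp
    · simp
  rw [h2] at h1
  have h3 : cell d ×ˢ Set.Ioo 0 s₀ ⊆ (fun p : Horiz d × ℝ => ((0 : Horiz d), -h) + p) ⁻¹' strip d (-h) β := by
    intro p hp
    refine ⟨?_, ?_, ?_⟩
    · simpa using hp.1
    · have := hp.2.1
      change -h < -h + p.2
      linarith
    · have := hp.2.2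
      change -h + p.2 < β
      linarith
  exact h1.mono_measure (Measure.restrict_mono h3 le_rfl)

/-- The trace on a graph is unique up to null sets. -/
theorem HasGraphTrace.ae_eq {F : Type*} [NormedAddCommGroup F] {γ : Horiz d → ℝ} {σ : ℝ} {u : Horiz d × ℝ → F}
    {f g : Horiz d → F} (hf : HasGraphTrace γ σ u f) (hg : HasGraphTrace γ σ u g)
    (hfm : AEStronglyMeasurable f (volume.restrict (cell d))) (hgm : AEStronglyMeasurable g (volume.restrict (cell d)))
    (hm : ∀ᶠ ε in 𝓝[>] (0 : ℝ), AEMeasurable (fun p : Horiz d × ℝ => ‖u (p.1, γ p.1 + σ * p.2) - g p.1‖ₑ ^ 2)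
      (volume.restrict (cell d ×ˢ Set.Ioo 0 ε))) : f =ᵐ[volume.restrict (cell d)] g := by
  have h1 := hf.sub hg hm
  unfold HasGraphTrace at h1
  simp only [sub_self, zero_sub, enorm_neg] at h1
  have hmeas : AEMeasurable (fun x => ‖f x - g x‖ₑ ^ 2) (volume.restrict (cell d)) :=
    (hfm.sub hgm).enorm.pow_const 2
  -- The difference of the two traces does not depend on the height, so its average over (0, ε) is
  -- the same for every ε.
  have h2 : ∀ᶠ ε in 𝓝[>] (0 : ℝ), ENNReal.ofReal ε⁻¹ * ∫⁻ p in (cell d) ×ˢ (Set.Ioo (0 : ℝ) ε), ‖f p.1 - g p.1‖ₑ ^ 2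
      = ∫⁻ x in cell d, ‖f x - g x‖ₑ ^ 2 := by
    filter_upwards [self_mem_nhdsWithin] with ε hε
    rw [lintegral_cell_prod]
    · change ENNReal.ofReal ε⁻¹ * ∫⁻ _ in Set.Ioo 0 ε, (∫⁻ x in cell d, ‖f x - g x‖ₑ ^ 2) = _
      rw [lintegral_const, Measure.restrict_apply_univ, Real.volume_Ioo, sub_zero, mul_comm, mul_assoc,
        ← ENNReal.ofReal_mul (le_of_lt hε), mul_inv_cancel₀ (ne_of_gt hε), ENNReal.ofReal_one, mul_one]
    · rw [Measure.volume_eq_prod, ← Measure.prod_restrict]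
      exact hmeas.comp_fst
  have h3 := tendsto_nhds_unique (h1.congr' h2) tendsto_const_nhds
  rw [eq_comm, lintegral_eq_zero_iff' hmeas] at h3
  filter_upwards [h3] with x hx
  simpa [sub_eq_zero] using hx

/-- The real vector field with components the real parts of the trigonometric series with
coefficients `i ξ_j A_ξ`. -/
def gradSeries (A : (Fin d → ℤ) → ℂ) (x : Horiz d) : Horiz d :=
  WithLp.toLp 2 fun j => (trigSeries (dirCoeff A j) x).re

section GradSeries

variable {A : (Fin d → ℤ) → ℂ}

/-- A bound on the modes after amplification by cosh(|ξ|t) forces the bottom coefficients to decay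
like e^{-|ξ|t}. -/
theorem summable_norm_dirCoeff {t Q : ℝ} (ht : 0 < t)
    (hQ : ∀ ξ, (freqNorm ξ * ‖A ξ‖ * Real.cosh (freqNorm ξ * t)) ^ 2 ≤ Q ^ 2) (hQ0 : 0 ≤ Q) (j : Fin d) :
    Summable fun ξ => ‖dirCoeff A j ξ‖ := by
  refine Summable.of_nonneg_of_le (fun _ => norm_nonneg _) (fun ξ => (norm_dirCoeff_le A j ξ).trans ?_)
    ((summable_exp_neg_freqNorm d ht).mul_left (2 * Q))
  have h0 := freqNorm_nonneg ξ
  have h1 := abs_le_of_sq_le_sq (hQ ξ) hQ0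
  have h2 := (le_abs_self _).trans h1
  have h3 := exp_div_two_le_cosh (freqNorm ξ * t)
  have h4 : freqNorm ξ * ‖A ξ‖ * (Real.exp (freqNorm ξ * t) / 2) ≤ Q :=
    (mul_le_mul_of_nonneg_left h3 (by positivity)).trans h2
  rw [neg_mul, mul_comm t, Real.exp_neg, ← div_eq_mul_inv, le_div_iff₀ (Real.exp_pos _)]
  linarith

theorem continuous_gradSeries (hs : ∀ j, Summable fun ξ => ‖dirCoeff A j ξ‖) :
    Continuous (gradSeries A) := by
  unfold gradSeries
  refine (PiLp.continuous_toLp 2 (fun _ : Fin d => ℝ)).comp (continuous_pi fun j => ?_)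
  exact Complex.continuous_re.comp (continuous_trigSeries (hs j))

theorem memLp_gradSeries (hs : ∀ j, Summable fun ξ => ‖dirCoeff A j ξ‖) :
    MemLp (gradSeries A) 2 (volume.restrict (cell d)) := by
  refine MemLp.of_bound (continuous_gradSeries hs).aestronglyMeasurable (∑ j, ∑' ξ, ‖dirCoeff A j ξ‖)
    (Eventually.of_forall fun x => (norm_toLp_le _).trans (Finset.sum_le_sum fun j _ => ?_))
  exact (Complex.abs_re_le_norm _).trans (norm_trigSeries_le (hs j) x)

end GradSeries

theorem gradSeries_periodic (A : (Fin d → ℤ) → ℂ) : TorusPeriodic (gradSeries A) := fun i x => by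
  unfold gradSeries
  simp_rw [trigSeries_periodic _ i x]

theorem sum_norm_dirCoeff_mul_sq (A : (Fin d → ℤ) → ℂ) (ξ : Fin d → ℤ) (r : ℝ) :
    ∑ j, ‖dirCoeff A j ξ * (r : ℂ)‖ ^ 2 = (freqNorm ξ * ‖A ξ‖ * r) ^ 2 := by
  simp_rw [norm_mul, mul_pow, Complex.norm_real, Real.norm_eq_abs, sq_abs]
  rw [← Finset.sum_mul, sum_norm_dirCoeff_sq]

/-- The candidate is the series with coefficients iξA_ξ, the value of the modes at y = -h where cosh
is 1. One good slice in the upper half of the strip controls both its convergence and its size. -/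
theorem IsVariationalSolution.exists_bottomTrace {ψ : Horiz d → ℝ} {φ : Horiz d × ℝ → ℝ}
    {φx : Horiz d × ℝ → Horiz d} {φy : Horiz d × ℝ → ℝ} (hφ : IsVariationalSolution h η ψ φ φx φy)
    (hη : Continuous η) {M : ℝ} (hM : ∀ x, |η x| ≤ M) {δ : ℝ} (hδ : 0 < δ) (hβ : ∀ x, β + δ ≤ η x)
    (hhβ : -h < β) : ∃ G : Horiz d → Horiz d, HasBottomTrace h φx G ∧
      (∀ᶠ ε in 𝓝[>] (0 : ℝ), AEMeasurable (fun p : Horiz d × ℝ => ‖φx (p.1, -h + 1 * p.2) - G p.1‖ₑ ^ 2)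
        (volume.restrict (cell d ×ˢ Set.Ioo 0 ε))) ∧
      ∫ x in cell d, ‖G x‖ ^ 2 ≤ 8 / (β + h) * Real.exp (-(β + h)) * ∫ p in fluidCell h η, ‖φx p‖ ^ 2 := by
  have hβ' : ∀ x, β ≤ η x := fun x => by have := hβ x; linarith
  have hsub : strip d (-h) β ⊆ fluidCell h η := strip_subset_fluidCell le_rfl hβ'
  have hV : MemLp φx 2 (volume.restrict (strip d (-h) β)) :=
    hφ.isH1.memLp_x.mono_measure (Measure.restrict_mono hsub le_rfl)
  obtain ⟨A, hA⟩ := hφ.exists_coeff hη hM hδ hβ hhβ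
  have hP : ∀ᵐ y, y ∈ Set.Ioo (-h) β → MemLp (fun x => φx (x, y)) 2 (volume.restrict (cell d)) ∧
      ∀ ξ j, fc (fun x => ((φx (x, y) j : ℝ) : ℂ)) ξ =
        dirCoeff A j ξ * (Real.cosh (freqNorm ξ * (y + h)) : ℂ) := by
    filter_upwards [hA, ae_memLp_slice hV] with y h1 h2 hy using ⟨h2 hy, h1 hy⟩
  obtain ⟨y₁, hy1, hy2, ⟨hm, hc⟩, hle⟩ := exists_good_slice hhβ hV hP
  set m := ∫ x in cell d, ‖φx (x, y₁)‖ ^ 2 with hmdef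
  have hm0 : 0 ≤ m := integral_nonneg fun x => by positivity
  set t := y₁ + h with ht
  have ht0 : (β + h) / 2 ≤ t := by linarith
  have htpos : 0 < t := by linarith
  have hpi := two_pi_pow_pos d
  have hsum : HasSum (fun ξ => (freqNorm ξ * ‖A ξ‖ * Real.cosh (freqNorm ξ * t)) ^ 2)
      (((2 * Real.pi) ^ d)⁻¹ * m) := by
    have h1 := hasSum_sum_sq_fc fun j => MemLp.apply_ofReal hm j
    rw [← integral_norm_sq_eq_sum hm] at h1
    simp_rw [hc, sum_norm_dirCoeff_mul_sq] at h1
    exact h1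
  have hs : ∀ j, Summable fun ξ => ‖dirCoeff A j ξ‖ := by
    refine summable_norm_dirCoeff htpos (Q := Real.sqrt (((2 * Real.pi) ^ d)⁻¹ * m)) (fun ξ => ?_) (Real.sqrt_nonneg _)
    rw [Real.sq_sqrt (by positivity)]
    exact le_hasSum hsum ξ fun _ _ => by positivity
  have hG := memLp_gradSeries hs
  have hW : ∀ j, MemLp (trigSeries (dirCoeff A j)) 2 (volume.restrict (cell d)) := fun j => memLp_trigSeries (hs j)
  have hmeas : ∀ s₀, -h + s₀ ≤ β → AEMeasurable
      (fun p : Horiz d × ℝ => ‖φx (p.1, -h + 1 * p.2) - gradSeries A p.1‖ₑ ^ 2)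
      (volume.restrict (cell d ×ˢ Set.Ioo 0 s₀)) := fun s₀ hs₀ =>
    ((aestronglyMeasurable_shift hs₀ hV.1).sub
      ((continuous_gradSeries hs).comp continuous_fst).aestronglyMeasurable).enorm.pow_const 2
  refine ⟨gradSeries A, ⟨gradSeries_periodic A, hG, ?_⟩, ?_, ?_⟩
  · refine HasGraphTrace.of_lintegral_le (s₀ := t) (A := m / t) htpos (hmeas t (by linarith)) ?_
    have hshift := (measurePreserving_add_left (volume : Measure ℝ) (-h)).quasiMeasurePreserving.ae hP
    filter_upwards [hshift] with s hs1 hst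
    rw [one_mul]
    obtain ⟨hms, hcs⟩ := hs1 ⟨by linarith [hst.1], by linarith [hst.2]⟩
    rw [lintegral_enorm_sq (f := fun x => φx (x, -h + s) - gradSeries A x) (hms.sub hG)]
    refine ENNReal.ofReal_le_ofReal ?_
    refine (integral_norm_sq_le_tsum (W := fun j x => ((φx (x, -h + s) j : ℝ) : ℂ) - trigSeries (dirCoeff A j) x)
      (hms.sub hG) (fun j => (MemLp.apply_ofReal hms j).sub (hW j)) fun x j => by simp [gradSeries]).trans ?_
    have e1 : ∀ ξ j, fc (fun x => ((φx (x, -h + s) j : ℝ) : ℂ) - trigSeries (dirCoeff A j) x) ξ =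
        dirCoeff A j ξ * ((Real.cosh (freqNorm ξ * s) - 1 : ℝ) : ℂ) := fun ξ j => by
      rw [fc_sub ((MemLp.apply_ofReal hms j).integrable one_le_two) ((hW j).integrable one_le_two), hcs,
        fc_trigSeries (hs j), neg_add_cancel_comm]
      push_cast
      ring
    simp_rw [e1, sum_norm_dirCoeff_mul_sq]
    have hr0 : 0 ≤ s / t := div_nonneg hst.1.le htpos.le
    have hr1 : s / t ≤ 1 := (div_le_one htpos).2 hst.2.le
    -- Convexity gives (s/t)² after squaring; one factor s/t ≤ 1 is discarded.
    have e2 : ∀ ξ : Fin d → ℤ, (freqNorm ξ * ‖A ξ‖ * (Real.cosh (freqNorm ξ * s) - 1)) ^ 2 ≤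
        s / t * (freqNorm ξ * ‖A ξ‖ * Real.cosh (freqNorm ξ * t)) ^ 2 := fun ξ => by
      have h0 := freqNorm_nonneg ξ
      have h1 := cosh_mul_sub_one_le hr0 hr1 (freqNorm ξ * t)
      have h2 : s / t * (freqNorm ξ * t) = freqNorm ξ * s := by field_simp
      rw [h2] at h1
      have h3 := Real.one_le_cosh (freqNorm ξ * s)
      have h4 := Real.one_le_cosh (freqNorm ξ * t)
      have h5 : (Real.cosh (freqNorm ξ * s) - 1) ^ 2 ≤ s / t * Real.cosh (freqNorm ξ * t) ^ 2 := by
        calc _ ≤ (s / t * (Real.cosh (freqNorm ξ * t) - 1)) ^ 2 := pow_le_pow_left₀ (by linarith) h1 2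
          _ = (s / t) * ((s / t) * (Real.cosh (freqNorm ξ * t) - 1) ^ 2) := by ring
          _ ≤ (s / t) * (1 * Real.cosh (freqNorm ξ * t) ^ 2) := by (gcongr; linarith)
          _ = _ := by ring
      rw [mul_pow, mul_pow _ (Real.cosh _)]
      calc _ ≤ (freqNorm ξ * ‖A ξ‖) ^ 2 * (s / t * Real.cosh (freqNorm ξ * t) ^ 2) := by gcongr
        _ = _ := by ring
    have hsum2 := hsum.mul_left (s / t)
    have e3 := Summable.tsum_le_tsum e2 (Summable.of_nonneg_of_le (fun _ => by positivity) e2 hsum2.summable)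
      hsum2.summable
    rw [hsum2.tsum_eq] at e3
    calc _ ≤ (2 * Real.pi) ^ d * (s / t * (((2 * Real.pi) ^ d)⁻¹ * m)) := by gcongr
      _ = m / t * s := by field_simp
  · filter_upwards [Ioo_mem_nhdsGT htpos] with ε hε
    exact hmeas ε (by linarith [hε.2])
  · refine (integral_norm_sq_le_tsum hG hW fun x j => rfl).trans ?_
    simp_rw [fun ξ j => fc_trigSeries (hs j) ξ, sum_norm_dirCoeff_sq]
    have hct := Real.cosh_pos t
    -- For ξ ≠ 0, |ξ| ≥ 1 and t ≥ (β + h)/2 give cosh(|ξ|t)² ≥ e^{β + h}/4; for ξ = 0 both sides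
    -- vanish.
    have e1 : ∀ ξ : Fin d → ℤ, freqNorm ξ ^ 2 * ‖A ξ‖ ^ 2 ≤
        4 * Real.exp (-(β + h)) * (freqNorm ξ * ‖A ξ‖ * Real.cosh (freqNorm ξ * t)) ^ 2 := fun ξ => by
      have h0 := freqNorm_nonneg ξ
      by_cases hξ : ξ = 0
      · simp [hξ]
      have h1 := one_le_freqNorm hξ
      have h2 : Real.exp ((β + h) / 2) / 2 ≤ Real.cosh (freqNorm ξ * t) := by
        refine le_trans ?_ (exp_div_two_le_cosh _)
        gcongr
        nlinarith
      have h3 := pow_le_pow_left₀ (by positivity) h2 2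
      have h4 : Real.exp (-(β + h)) * Real.exp ((β + h) / 2) ^ 2 = 1 := by
        rw [← Real.exp_nat_mul, ← Real.exp_add]
        simp
        ring
      have h5 : 1 ≤ 4 * Real.exp (-(β + h)) * Real.cosh (freqNorm ξ * t) ^ 2 := by
        calc (1 : ℝ) = 4 * Real.exp (-(β + h)) * (Real.exp ((β + h) / 2) / 2) ^ 2 := by rw [← h4]; ring
          _ ≤ _ := by gcongr
      calc _ = freqNorm ξ ^ 2 * ‖A ξ‖ ^ 2 * 1 := by ring
        _ ≤ freqNorm ξ ^ 2 * ‖A ξ‖ ^ 2 * (4 * Real.exp (-(β + h)) * Real.cosh (freqNorm ξ * t) ^ 2) := by gcongr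
        _ = _ := by ring
    have hsum2 := hsum.mul_left (4 * Real.exp (-(β + h)))
    have e3 := Summable.tsum_le_tsum e1 (Summable.of_nonneg_of_le (fun _ => by positivity) e1 hsum2.summable)
      hsum2.summable
    rw [hsum2.tsum_eq] at e3
    have hle2 : m ≤ 2 / (β + h) * ∫ p in fluidCell h η, ‖φx p‖ ^ 2 := by
      rw [sub_neg_eq_add] at hle
      refine hle.trans (mul_le_mul_of_nonneg_left ?_ (div_nonneg zero_le_two (by linarith)))
      exact setIntegral_mono_set hφ.isH1.memLp_x.norm.integrable_sq
        (Eventually.of_forall fun p => by positivity) (Eventually.of_forall hsub)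
    calc _ ≤ (2 * Real.pi) ^ d * (4 * Real.exp (-(β + h)) * (((2 * Real.pi) ^ d)⁻¹ * m)) := by gcongr
      _ = 4 * Real.exp (-(β + h)) * m := by field_simp
      _ ≤ 4 * Real.exp (-(β + h)) * (2 / (β + h) * ∫ p in fluidCell h η, ‖φx p‖ ^ 2) := by gcongr
      _ = _ := by ring

theorem bottomTrace_estimate {ψ : Horiz d → ℝ} {φ : Horiz d × ℝ → ℝ} {φx : Horiz d × ℝ → Horiz d}
    {φy : Horiz d × ℝ → ℝ} (hh : 2 ≤ h) (hη : IsProfile η) (hinf : -(h / 3) < ⨅ x, η x)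
    (hψ : MemSobolev (1 / 2) ψ) (hφ : IsVariationalSolution h η ψ φ φx φy) :
    (∃ G, HasBottomTrace h φx G) ∧ ∀ G, HasBottomTrace h φx G → ∫ x in cell d, ‖G x‖ ^ 2 ≤
      48 * (2 * Real.pi) ^ d * (1 + gradSupNorm η ^ 3) * Real.exp (-(1 / 4) * h) * sobolevNormSq (1 / 2) ψ := by
  obtain ⟨M, -, hM⟩ := hη.exists_bound
  have hbdd : BddBelow (Set.range η) := ⟨-M, by rintro _ ⟨x, rfl⟩; exact (abs_le.1 (hM x)).1⟩
  have hβ : ∀ x, -(h / 3) + ((⨅ x, η x) + h / 3) ≤ η x := fun x => by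
    have := ciInf_le hbdd x
    linarith
  -- The strip ends at y = -h/3, so β + h = 2h/3, and the margin to the surface is inf η + h/3 > 0.
  obtain ⟨G₀, hG₀, hm, hE⟩ := hφ.exists_bottomTrace hη.continuous hM (β := -(h / 3))
    (δ := (⨅ x, η x) + h / 3) (by linarith) hβ (by linarith)
  refine ⟨⟨G₀, hG₀⟩, fun G hG => ?_⟩
  have hae := hG.trace.ae_eq hG₀.trace hG.memLp.1 hG₀.memLp.1 hm
  have heq : ∫ x in cell d, ‖G x‖ ^ 2 = ∫ x in cell d, ‖G₀ x‖ ^ 2 :=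
    integral_congr_ae (by filter_upwards [hae] with x hx; rw [hx])
  have hen := hφ.integral_energy_le hη hψ
  have hx : ∫ p in fluidCell h η, ‖φx p‖ ^ 2 ≤ ∫ p in fluidCell h η, (‖φx p‖ ^ 2 + φy p ^ 2) :=
    integral_mono hφ.isH1.memLp_x.norm.integrable_sq
      (hφ.isH1.memLp_x.norm.integrable_sq.add hφ.isH1.memLp_y.integrable_sq) fun p => by
        simp only; nlinarith [sq_nonneg (φy p)]
  have hN : 0 ≤ sobolevNormSq (1 / 2) ψ := tsum_nonneg fun ξ => by
    rw [sobolevTerm]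
    have : 0 ≤ ∑ i, (ξ i : ℝ) ^ 2 := Finset.sum_nonneg fun i _ => sq_nonneg _
    positivity
  have hL := gradSupNorm_nonneg η
  have hpi := two_pi_pow_pos d
  -- The quotient is 12/h, at most 6 because h ≥ 2.
  have e1 : 8 / (-(h / 3) + h) ≤ 6 := by
    rw [div_le_iff₀ (by linarith)]; linarith
  have e2 : Real.exp (-(-(h / 3) + h)) ≤ Real.exp (-(1 / 4) * h) := Real.exp_le_exp.2 (by linarith)
  have e3 : 1 + gradSupNorm η ^ 2 ≤ 2 * (1 + gradSupNorm η ^ 3) := by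
    nlinarith [mul_nonneg hL (sq_nonneg (gradSupNorm η - 1)), sq_nonneg (gradSupNorm η - 1)]
  rw [heq]
  calc _ ≤ _ := hE
    _ ≤ 6 * Real.exp (-(1 / 4) * h) * (2 * (2 * (1 + gradSupNorm η ^ 3)) *
        ((2 * Real.pi) ^ d * sobolevNormSq (1 / 2) ψ)) := by
        refine mul_le_mul ?_ ?_ (integral_nonneg fun p => by positivity) (by positivity)
        · exact mul_le_mul e1 e2 (Real.exp_pos _).le (by norm_num)
        · refine (hx.trans hen).trans ?_
          gcongr
    _ ≤ _ := by
        -- The constants multiply to 24; the stated 48 leaves room.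
        have : 0 ≤ Real.exp (-(1 / 4) * h) * (1 + gradSupNorm η ^ 3) *
          ((2 * Real.pi) ^ d * sobolevNormSq (1 / 2) ψ) := by positivity
        linarith

end

end BottomTrace

end

/-! ### The estimate and the limit of infinite depth. -/

theorem propositionB4 (d : ℕ) (hd : 1 ≤ d) :
    (∃ C : ℝ, 0 < C ∧
      ∀ (h : ℝ) (η ψ : BottomTrace.Horiz d → ℝ)
        (φ : BottomTrace.Horiz d × ℝ → ℝ)
        (φx : BottomTrace.Horiz d × ℝ → BottomTrace.Horiz d)
        (φy : BottomTrace.Horiz d × ℝ → ℝ),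
        2 ≤ h →
        BottomTrace.IsProfile η →
        -(h / 3) < ⨅ x, η x →
        BottomTrace.MemSobolev (1 / 2 : ℝ) ψ →
        BottomTrace.IsVariationalSolution h η ψ φ φx φy →
        (∃ G : BottomTrace.Horiz d → BottomTrace.Horiz d, BottomTrace.HasBottomTrace h φx G) ∧
        ∀ G : BottomTrace.Horiz d → BottomTrace.Horiz d, BottomTrace.HasBottomTrace h φx G →
          ∫ x in BottomTrace.cell d, ‖G x‖ ^ 2 ≤
            C * (1 + BottomTrace.gradSupNorm η ^ 3) * Real.exp (-(1 / 4) * h) *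
              BottomTrace.sobolevNormSq (1 / 2 : ℝ) ψ) ∧
    (∀ (η ψ : BottomTrace.Horiz d → ℝ)
        (φ : ℝ → BottomTrace.Horiz d × ℝ → ℝ)
        (φx : ℝ → BottomTrace.Horiz d × ℝ → BottomTrace.Horiz d)
        (φy : ℝ → BottomTrace.Horiz d × ℝ → ℝ)
        (G : ℝ → BottomTrace.Horiz d → BottomTrace.Horiz d),
        BottomTrace.IsProfile η →
        BottomTrace.MemSobolev (1 / 2 : ℝ) ψ →
        (∀ᶠ h in Filter.atTop,
          BottomTrace.IsVariationalSolution h η ψ (φ h) (φx h) (φy h) ∧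
          BottomTrace.HasBottomTrace h (φx h) (G h)) →
        Filter.Tendsto (fun h : ℝ => h / 4 * ∫ x in BottomTrace.cell d, ‖G h x‖ ^ 2)
          Filter.atTop (nhds 0)) := by
  refine ⟨⟨48 * (2 * Real.pi) ^ d, by positivity, fun h η ψ φ φx φy hh hη hinf hψ hφ =>
    BottomTrace.bottomTrace_estimate hh hη hinf hψ hφ⟩, fun η ψ φ φx φy G hη hψ hev => ?_⟩
  set D : ℝ := 48 * (2 * Real.pi) ^ d * (1 + BottomTrace.gradSupNorm η ^ 3) *
    BottomTrace.sobolevNormSq (1 / 2) ψ with hD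
  have hlim : Filter.Tendsto (fun h : ℝ => D * (1 / 4 * h * Real.exp (-(1 / 4 * h)))) Filter.atTop (nhds 0) := by
    have h1 := (Real.tendsto_pow_mul_exp_neg_atTop_nhds_zero 1).comp
      (Filter.tendsto_id.const_mul_atTop (by norm_num : (0 : ℝ) < 1 / 4))
    have h2 := h1.const_mul D
    rw [mul_zero] at h2
    refine h2.congr fun h => ?_
    simp
  refine tendsto_of_tendsto_of_tendsto_of_le_of_le' tendsto_const_nhds hlim ?_ ?_
  · filter_upwards [Filter.eventually_ge_atTop 0] with h hh
    exact mul_nonneg (by linarith) (MeasureTheory.integral_nonneg fun x => by positivity)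
  -- For a fixed profile the condition inf η > -h/3 holds as soon as h > -3 inf η, and the constant
  -- D does not depend on h.
  · filter_upwards [hev, Filter.eventually_ge_atTop 2, Filter.eventually_gt_atTop (-(3 * ⨅ x, η x))]
      with h hφ hh hinf
    have h1 := (BottomTrace.bottomTrace_estimate hh hη (by linarith) hψ hφ.1).2 (G h) hφ.2
    calc _ ≤ h / 4 * _ := mul_le_mul_of_nonneg_left h1 (by linarith)
      _ = _ := by rw [hD]; ring_nf
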